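/- Let $(M^n,\sigma)$ be a smooth closed Riemannian $n$-manifold with $\mathrm{Ric}_M(X)>0$ for all tangent vectors $X\neq 0$, and let $N=\mathbb{R}_+\times M$ carry the warped product metric $\gamma=dr^2\oplus r^2\sigma$. For a positive $C^2$ function $f$ on $M$, the graph $\{(f(p),p):p\in M\}\subset N$ has the outward unit normal $\nu=v^{-1}\bigl(\partial_r-f^{-2}f^k\partial_k\bigr)$, where $f^k=\sigma^{kl}\partial_l f$ and $v=\sqrt{1+f^{-2}|Df|_\sigma^2}$; let $H$ be its mean curvature, the trace of the second fundamental form $h_{ij}$ defined by $x_{ij}=-h_{ij}\nu$. Let $u_0:M\to\mathbb{R}_+$ be of class $C^2$ such that its graph has mean curvature $H_0>0$. A solution on $[0,T)$ of the inverse mean curvature flow of graphs starting from $u_0$ is a function $u:[0,T)\times M\to\mathbb{R}_+$ with $u(0,\cdot)=u_0$, smooth on $(0,T)\times M$ and of class $C^2$ in space and $C^1$ in time up to $t=0$ (these derivatives being continuous on $[0,T)\times M$), such that the graphs $M_t$ of $u(t,\cdot)$ have nowhere vanishing mean curvature $H$ and move with normal velocity $H^{-1}$, i.e. $\gamma(\partial_t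 u\,\partial_r,\nu)=H^{-1}$, equivalently $\partial_t u=vH^{-1}$. Then there are positive constants $c$ and $C$, which do not depend on $T$ or on the solution, such that for every solution $u$ on $[0,T)$ with initial value $u_0$ $$c\le H\,e^{t/n}\le C\qquad\text{on }[0,T)\times M .$$ The constants depend only on $n$ and on $u_0$, $Du_0$, $D^2u_0$, in the following sense: for all $n$, $\delta>0$ and $\Lambda$ there are $c,C>0$ such that the estimate holds, with these $c$ and $C$, for all $(M^n,\sigma)$, $u_0$ and $u$ as above with $\delta\le u_0\le\Lambda$, $|Du_0|_\sigma\le\Lambda$, $|D^2u_0|_\sigma\le\Lambda$ and $H_0\ge\delta$ on $M$. -/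

import Mathlib

open scoped Manifold ContDiff
open Bundle

noncomputable section

namespace IMCF

/-- Coordinate space `ℝⁿ`. -/
abbrev Eucl (n : ℕ) : Type := EuclideanSpace ℝ (Fin n)

/-! ### Riemannian geometry in a coordinate domain -/

/-- The partial derivative `∂f/∂yⁱ`. -/
def pd {n : ℕ} (i : Fin n) (f : Eucl n → ℝ) (y : Eucl n) : ℝ :=
  fderiv ℝ f y (EuclideanSpace.single i 1)

/-- The Christoffel symbols `Γᶜ_{ab} = ½ gᶜᵉ (∂_a g_{eb} + ∂_b g_{ae} - ∂_e g_{ab})`. -/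
def christoffel {n : ℕ} (g : Eucl n → Matrix (Fin n) (Fin n) ℝ) (c a b : Fin n)
    (y : Eucl n) : ℝ :=
  (1 / 2) * ∑ e, (g y)⁻¹ c e *
    (pd a (fun z => g z e b) y + pd b (fun z => g z a e) y - pd e (fun z => g z a b) y)

/-- The curvature tensor
`R_{abc}{}^d = ∂_b Γᵈ_{ac} - ∂_a Γᵈ_{bc} + Γᵈ_{be} Γᵉ_{ac} - Γᵈ_{ae} Γᵉ_{bc}`. -/
def riemann {n : ℕ} (g : Eucl n → Matrix (Fin n) (Fin n) ℝ) (a b c d : Fin n)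
    (y : Eucl n) : ℝ :=
  pd b (christoffel g d a c) y - pd a (christoffel g d b c) y
    + ∑ e, (christoffel g d b e y * christoffel g e a c y
        - christoffel g d a e y * christoffel g e b c y)

/-- The Ricci tensor `R_{ac} = R_{abc}{}^b` (positive on round spheres). -/
def ricci {n : ℕ} (g : Eucl n → Matrix (Fin n) (Fin n) ℝ) (a c : Fin n) (y : Eucl n) : ℝ :=
  ∑ b, riemann g a b c b y

/-- The squared norm `|Df|² = gⁱʲ f_i f_j` of the differential of `f`. -/
def gradNormSq {n : ℕ} (g : Eucl n → Matrix (Fin n) (Fin n) ℝ) (f : Eucl n → ℝ)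
    (y : Eucl n) : ℝ :=
  ∑ i, ∑ j, (g y)⁻¹ i j * pd i f y * pd j f y

/-- The covariant Hessian `f_{ij} = ∂_i ∂_j f - Γᵏ_{ij} f_k`. -/
def hessian {n : ℕ} (g : Eucl n → Matrix (Fin n) (Fin n) ℝ) (f : Eucl n → ℝ)
    (i j : Fin n) (y : Eucl n) : ℝ :=
  pd i (pd j f) y - ∑ k, christoffel g k i j y * pd k f y

/-- The squared norm `|D²f|² = gⁱᵏ gʲˡ f_{ij} f_{kl}` of the Hessian of `f`. -/
def hessNormSq {n : ℕ} (g : Eucl n → Matrix (Fin n) (Fin n) ℝ) (f : Eucl n → ℝ)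
    (y : Eucl n) : ℝ :=
  ∑ i, ∑ j, ∑ k, ∑ l, (g y)⁻¹ i k * (g y)⁻¹ j l * hessian g f i j y * hessian g f k l y

/-! ### Hypersurfaces in coordinates -/

/-- The coordinate tangent vectors `x_i = ∂X/∂yⁱ` of `X : ℝⁿ → ℝⁿ⁺¹`. -/
def tangentVec {n : ℕ} (X : Eucl n → Eucl (n + 1)) (i : Fin n) (y : Eucl n) :
    Fin (n + 1) → ℝ :=
  fun a => pd i (fun z => X z a) y

/-- The inner product `γ_{ab} Vᵃ Wᵇ` of two vectors at `z`. -/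
def ip {m : ℕ} (γ : Eucl m → Matrix (Fin m) (Fin m) ℝ) (z : Eucl m) (V W : Fin m → ℝ) : ℝ :=
  ∑ a, ∑ b, γ z a b * V a * W b

/-- The induced metric `g_{ij} = γ(x_i, x_j)`. -/
def inducedMetric {n : ℕ} (γ : Eucl (n + 1) → Matrix (Fin (n + 1)) (Fin (n + 1)) ℝ)
    (X : Eucl n → Eucl (n + 1)) (y : Eucl n) : Matrix (Fin n) (Fin n) ℝ :=
  Matrix.of fun i j => ip γ (X y) (tangentVec X i y) (tangentVec X j y)

/-- The second derivative `∂_i ∂_j Xᵃ + Γᵃ_{bc} x_iᵇ x_jᶜ` of `X` with respect to the ambient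
Levi-Civita connection; it differs from `x_{ij}` by a vector tangent to the hypersurface. -/
def secondDeriv {n : ℕ} (γ : Eucl (n + 1) → Matrix (Fin (n + 1)) (Fin (n + 1)) ℝ)
    (X : Eucl n → Eucl (n + 1)) (i j : Fin n) (y : Eucl n) : Fin (n + 1) → ℝ :=
  fun a => pd i (pd j (fun z => X z a)) y
    + ∑ b, ∑ c, christoffel γ a b c (X y) * tangentVec X i y b * tangentVec X j y c

/-- The second fundamental form with respect to the unit normal `ν`, with the sign convention
`x_{ij} = - h_{ij} ν`. -/
def secondFundForm {n : ℕ} (γ : Eucl (n + 1) → Matrix (Fin (n + 1)) (Fin (n + 1)) ℝ)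
    (X : Eucl n → Eucl (n + 1)) (ν : Fin (n + 1) → ℝ) (i j : Fin n) (y : Eucl n) : ℝ :=
  - ip γ (X y) (secondDeriv γ X i j y) ν

/-- The mean curvature `H = gⁱʲ h_{ij}`. -/
def meanCurv {n : ℕ} (γ : Eucl (n + 1) → Matrix (Fin (n + 1)) (Fin (n + 1)) ℝ)
    (X : Eucl n → Eucl (n + 1)) (ν : Fin (n + 1) → ℝ) (y : Eucl n) : ℝ :=
  ∑ i, ∑ j, (inducedMetric γ X y)⁻¹ i j * secondFundForm γ X ν i j y

/-! ### The warped product `ℝ₊ ×_Id M` and graphs in coordinates -/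

/-- The last `n` coordinates of `(r, y) ∈ ℝ × ℝⁿ`. -/
def tailPt {n : ℕ} (z : Eucl (n + 1)) : Eucl n := WithLp.toLp 2 fun i => z i.succ

/-- The warped product metric `γ = dr² ⊕ r² σ` in the coordinates `(r, y)`. -/
def warped {n : ℕ} (σ : Eucl n → Matrix (Fin n) (Fin n) ℝ) (z : Eucl (n + 1)) :
    Matrix (Fin (n + 1)) (Fin (n + 1)) ℝ :=
  Matrix.of fun a b =>
    Fin.cases (Fin.cases 1 (fun _ => 0) b)
      (fun i => Fin.cases 0 (fun j => z 0 ^ 2 * σ (tailPt z) i j) b) a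

/-- The graph embedding `y ↦ (f(y), y)`. -/
def graphMap {n : ℕ} (f : Eucl n → ℝ) (y : Eucl n) : Eucl (n + 1) :=
  WithLp.toLp 2 (Fin.cons (f y) fun i => y i)

/-- `v = √(1 + f⁻² |Df|²)`. -/
def slant {n : ℕ} (σ : Eucl n → Matrix (Fin n) (Fin n) ℝ) (f : Eucl n → ℝ) (y : Eucl n) : ℝ :=
  √(1 + (f y)⁻¹ ^ 2 * gradNormSq σ f y)

/-- The outward unit normal `ν = v⁻¹ (e₀ - f⁻² fᵏ e_k)` of the graph of `f` in the warped product
(see `ip_graphNormal_tangentVec`, `ip_graphNormal_self`). -/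
def graphNormal {n : ℕ} (σ : Eucl n → Matrix (Fin n) (Fin n) ℝ) (f : Eucl n → ℝ) (y : Eucl n) :
    Fin (n + 1) → ℝ :=
  Fin.cons (slant σ f y)⁻¹
    fun k => - ((slant σ f y)⁻¹ * (f y)⁻¹ ^ 2 * ∑ l, (σ y)⁻¹ k l * pd l f y)

theorem tailPt_graphMap {n : ℕ} (f : Eucl n → ℝ) (y : Eucl n) : tailPt (graphMap f y) = y := by
  ext i; simp [tailPt, graphMap]

theorem pd_coord {n : ℕ} (i k : Fin n) (y : Eucl n) :
    pd i (fun z => z k) y = if k = i then 1 else 0 := by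
  have h : (fun z : Eucl n => z k) = (EuclideanSpace.proj k : Eucl n →L[ℝ] ℝ) := by
    ext z; simp
  rw [pd, h, ContinuousLinearMap.fderiv]
  simp

theorem tangentVec_graphMap_zero {n : ℕ} (f : Eucl n → ℝ) (i : Fin n) (y : Eucl n) :
    tangentVec (graphMap f) i y 0 = pd i f y := by
  simp [tangentVec, graphMap]

theorem tangentVec_graphMap_succ {n : ℕ} (f : Eucl n → ℝ) (i k : Fin n) (y : Eucl n) :
    tangentVec (graphMap f) i y k.succ = if k = i then 1 else 0 := by
  simpa [tangentVec, graphMap] using pd_coord i k y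

theorem ip_warped {n : ℕ} (σ : Eucl n → Matrix (Fin n) (Fin n) ℝ) (f : Eucl n → ℝ) (y : Eucl n)
    (V W : Fin (n + 1) → ℝ) :
    ip (warped σ) (graphMap f y) V W
      = V 0 * W 0 + f y ^ 2 * ∑ i, ∑ j, σ y i j * V i.succ * W j.succ := by
  simp only [ip, Fin.sum_univ_succ, warped, Matrix.of_apply, Fin.cases_zero, Fin.cases_succ,
    tailPt_graphMap, one_mul, zero_mul, Finset.sum_const_zero, add_zero, zero_add]
  simp [graphMap, Finset.mul_sum, mul_assoc]

/-- The normal of a graph is orthogonal to the graph. -/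
theorem ip_graphNormal_tangentVec {n : ℕ} (σ : Eucl n → Matrix (Fin n) (Fin n) ℝ)
    (f : Eucl n → ℝ) (y : Eucl n) (hσ : (σ y).PosDef) (hf : f y ≠ 0) (i : Fin n) :
    ip (warped σ) (graphMap f y) (tangentVec (graphMap f) i y) (graphNormal σ f y) = 0 := by
  have hu : IsUnit (σ y).det := (Matrix.isUnit_iff_isUnit_det _).1 hσ.isUnit
  have h2 : (σ y).mulVec ((σ y)⁻¹.mulVec fun l => pd l f y) i = pd i f y := by
    rw [Matrix.mulVec_mulVec, Matrix.mul_nonsing_inv _ hu, Matrix.one_mulVec]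
  simp only [Matrix.mulVec, dotProduct] at h2
  rw [ip_warped]
  simp only [tangentVec_graphMap_zero, tangentVec_graphMap_succ, graphNormal, Fin.cons_zero,
    Fin.cons_succ, mul_ite, ite_mul, mul_one, mul_zero, zero_mul]
  rw [Finset.sum_comm]
  simp only [Finset.sum_ite_eq', Finset.mem_univ, if_true]
  have h3 : ∑ j, σ y i j * -((slant σ f y)⁻¹ * (f y)⁻¹ ^ 2 * ∑ l, (σ y)⁻¹ j l * pd l f y)
      = -((slant σ f y)⁻¹ * (f y)⁻¹ ^ 2) * pd i f y := by
    rw [← h2, Finset.mul_sum]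
    exact Finset.sum_congr rfl fun j _ => by ring
  rw [h3]
  field_simp
  ring

/-- The normal of a graph has unit length. -/
theorem ip_graphNormal_self {n : ℕ} (σ : Eucl n → Matrix (Fin n) (Fin n) ℝ)
    (f : Eucl n → ℝ) (y : Eucl n) (hσ : (σ y).PosDef) (hf : f y ≠ 0) :
    ip (warped σ) (graphMap f y) (graphNormal σ f y) (graphNormal σ f y) = 1 := by
  have hu : IsUnit (σ y).det := (Matrix.isUnit_iff_isUnit_det _).1 hσ.isUnit
  set w : Fin n → ℝ := (σ y)⁻¹.mulVec fun l => pd l f y with hw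
  have h2 : (σ y).mulVec w = fun l => pd l f y := by
    rw [hw, Matrix.mulVec_mulVec, Matrix.mul_nonsing_inv _ hu, Matrix.one_mulVec]
  have hq : gradNormSq σ f y = ∑ i, pd i f y * w i := by
    simp only [gradNormSq, hw, Matrix.mulVec, dotProduct, Finset.mul_sum]
    exact Finset.sum_congr rfl fun i _ => Finset.sum_congr rfl fun j _ => by ring
  have hq' : gradNormSq σ f y = ∑ i, ∑ j, σ y i j * w i * w j := by
    rw [hq]
    refine Finset.sum_congr rfl fun i _ => ?_
    rw [← congrFun h2 i]
    simp only [Matrix.mulVec, dotProduct, Finset.sum_mul]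
    exact Finset.sum_congr rfl fun j _ => by ring
  have hq0 : 0 ≤ gradNormSq σ f y := by
    have := hσ.posSemidef.dotProduct_mulVec_nonneg w
    rw [h2] at this
    rw [hq]
    simpa [dotProduct, mul_comm] using this
  have hv : 0 < 1 + (f y)⁻¹ ^ 2 * gradNormSq σ f y := by positivity
  have hs : slant σ f y ^ 2 = 1 + (f y)⁻¹ ^ 2 * gradNormSq σ f y := Real.sq_sqrt hv.le
  have hs0 : slant σ f y ≠ 0 := (Real.sqrt_pos.2 hv).ne'
  rw [ip_warped]
  have h3 : ∑ i, ∑ j, σ y i j * graphNormal σ f y i.succ * graphNormal σ f y j.succ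
      = ((slant σ f y)⁻¹ * (f y)⁻¹ ^ 2) ^ 2 * gradNormSq σ f y := by
    rw [hq', Finset.mul_sum]
    refine Finset.sum_congr rfl fun i _ => ?_
    rw [Finset.mul_sum]
    refine Finset.sum_congr rfl fun j _ => ?_
    simp only [graphNormal, Fin.cons_succ, hw, Matrix.mulVec, dotProduct]
    ring
  rw [h3]
  simp only [graphNormal, Fin.cons_zero]
  have h4 : (slant σ f y)⁻¹ ^ 2 * slant σ f y ^ 2 = 1 := by
    rw [← mul_pow, inv_mul_cancel₀ hs0, one_pow]
  rw [hs] at h4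
  have h5 : f y ^ 2 * (f y)⁻¹ ^ 2 = 1 := by
    rw [← mul_pow, mul_inv_cancel₀ hf, one_pow]
  linear_combination h4 + (slant σ f y)⁻¹ ^ 2 * (f y)⁻¹ ^ 2 * gradNormSq σ f y * h5

/-! ### Graphs over a Riemannian manifold -/

section Manifold

variable {n : ℕ} {M : Type*} [TopologicalSpace M] [ChartedSpace (Eucl n) M]
  [IsManifold 𝓘(ℝ, Eucl n) ∞ M]

/-- Smooth Riemannian metrics on `M`. -/
abbrev Metric (n : ℕ) (M : Type*) [TopologicalSpace M] [ChartedSpace (Eucl n) M]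
    [IsManifold 𝓘(ℝ, Eucl n) ∞ M] : Type _ :=
  ContMDiffRiemannianMetric 𝓘(ℝ, Eucl n) ∞ (Eucl n)
    (fun p : M => TangentSpace 𝓘(ℝ, Eucl n) p)

/-- The components `σ_{ij} = σ(∂_i, ∂_j)` in the chart `chartAt x₀`. -/
def chartMetric (σ : Metric n M) (x₀ : M) (y : Eucl n) : Matrix (Fin n) (Fin n) ℝ :=
  Matrix.of fun i j =>
    σ.inner ((extChartAt 𝓘(ℝ, Eucl n) x₀).symm y)
      (mfderiv 𝓘(ℝ, Eucl n) 𝓘(ℝ, Eucl n) (extChartAt 𝓘(ℝ, Eucl n) x₀).symm y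
        (EuclideanSpace.single i (1 : ℝ)))
      (mfderiv 𝓘(ℝ, Eucl n) 𝓘(ℝ, Eucl n) (extChartAt 𝓘(ℝ, Eucl n) x₀).symm y
        (EuclideanSpace.single j (1 : ℝ)))

/-- The coordinate representation of a function on `M` in the chart `chartAt x₀`. -/
def chartRep (x₀ : M) (f : M → ℝ) (y : Eucl n) : ℝ :=
  f ((extChartAt 𝓘(ℝ, Eucl n) x₀).symm y)

/-- `Ric(X) > 0` for all nonzero tangent vectors `X`. -/
def RicciPos (σ : Metric n M) : Prop :=
  ∀ x₀ : M, ∀ y ∈ (extChartAt 𝓘(ℝ, Eucl n) x₀).target, ∀ X : Fin n → ℝ, X ≠ 0 →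
    0 < ∑ i, ∑ j, ricci (chartMetric σ x₀) i j y * X i * X j

/-- The mean curvature at `(f(p), p)` of the graph of `f` in `ℝ₊ ×_Id M`, with respect to the
outward unit normal, computed in the chart `chartAt x₀` (whose source is to contain `p`). -/
def graphMeanCurv (σ : Metric n M) (x₀ : M) (f : M → ℝ) (p : M) : ℝ :=
  meanCurv (warped (chartMetric σ x₀)) (graphMap (chartRep x₀ f))
    (graphNormal (chartMetric σ x₀) (chartRep x₀ f) (extChartAt 𝓘(ℝ, Eucl n) x₀ p))
    (extChartAt 𝓘(ℝ, Eucl n) x₀ p)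

/-- The norm `|Df|_σ(p)`, computed in the chart `chartAt x₀`. -/
def gradNorm (σ : Metric n M) (x₀ : M) (f : M → ℝ) (p : M) : ℝ :=
  √(gradNormSq (chartMetric σ x₀) (chartRep x₀ f) (extChartAt 𝓘(ℝ, Eucl n) x₀ p))

/-- The norm `|D²f|_σ(p)`, computed in the chart `chartAt x₀`. -/
def hessNorm (σ : Metric n M) (x₀ : M) (f : M → ℝ) (p : M) : ℝ :=
  √(hessNormSq (chartMetric σ x₀) (chartRep x₀ f) (extChartAt 𝓘(ℝ, Eucl n) x₀ p))

/-- The normal component `γ(∂ₜx, ν)` at `p` of the velocity of graphs `x = (f, p)` when the height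
`f` has time derivative `f'` at `p`, computed in the chart `chartAt x₀`. -/
def normalSpeed (σ : Metric n M) (x₀ : M) (f : M → ℝ) (f' : ℝ) (p : M) : ℝ :=
  ip (warped (chartMetric σ x₀))
    (graphMap (chartRep x₀ f) (extChartAt 𝓘(ℝ, Eucl n) x₀ p))
    (Fin.cons f' fun _ => 0)
    (graphNormal (chartMetric σ x₀) (chartRep x₀ f) (extChartAt 𝓘(ℝ, Eucl n) x₀ p))

/-- The graphs of `u t`, `t ∈ [0, T)`, solve the inverse mean curvature flow in `ℝ₊ ×_Id M` with
initial surface the graph of `u₀`: they move with normal velocity `1 / H`.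
The solution is smooth for positive times, and of class `C²` in space and `C¹` in time up to
`t = 0` (continuity of `∂ₜu` follows from the equation). -/
structure IsGraphIMCF (σ : Metric n M) (u₀ : M → ℝ) (T : ℝ) (u : ℝ → M → ℝ) : Prop where
  initial : u 0 = u₀
  pos : ∀ t ∈ Set.Ico 0 T, ∀ p, 0 < u t p
  smooth : ContMDiffOn (𝓘(ℝ, ℝ).prod 𝓘(ℝ, Eucl n)) 𝓘(ℝ, ℝ) ∞ (fun q : ℝ × M => u q.1 q.2)
    (Set.Ioo 0 T ×ˢ Set.univ)
  contMDiff_two : ∀ t ∈ Set.Ico 0 T, ContMDiff 𝓘(ℝ, Eucl n) 𝓘(ℝ, ℝ) 2 (u t)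
  continuousOn : ContinuousOn (fun q : ℝ × M => u q.1 q.2) (Set.Ico 0 T ×ˢ Set.univ)
  continuousOn_pd : ∀ (x₀ : M) (i : Fin n),
    ContinuousOn (fun q : ℝ × Eucl n => pd i (chartRep x₀ (u q.1)) q.2)
      (Set.Ico 0 T ×ˢ (extChartAt 𝓘(ℝ, Eucl n) x₀).target)
  continuousOn_pd_pd : ∀ (x₀ : M) (i j : Fin n),
    ContinuousOn (fun q : ℝ × Eucl n => pd i (pd j (chartRep x₀ (u q.1))) q.2)
      (Set.Ico 0 T ×ˢ (extChartAt 𝓘(ℝ, Eucl n) x₀).target)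
  flow : ∀ t ∈ Set.Ico 0 T, ∀ p : M, ∃ u' : ℝ,
    HasDerivWithinAt (fun s => u s p) u' (Set.Ico 0 T) t ∧
      ∀ x₀ : M, p ∈ (chartAt (Eucl n) x₀).source →
        graphMeanCurv σ x₀ (u t) p ≠ 0 ∧
          normalSpeed σ x₀ (u t) u' p = (graphMeanCurv σ x₀ (u t) p)⁻¹

end Manifold

end IMCF

end

/-!
Write `f = log u`, `v² = 1 + |Df|²` and `w = ∂ₜf`. In the warped product the mean curvature of the
graph of `u` satisfies `u v H = n - (σⁱʲ - fⁱ fʲ / v²) f_{ij}` (`meanCurv_graph`,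
`meanCurv_eq_graphOp`), an expression in `Df` and `D²f` only, and the flow reads
`w = v² / (u v H)`. Hence `H e^{t/n} = v / (w · u e^{-t/n})`, and the estimate follows from
two-sided bounds for each of the three factors. All of them come from the maximum principle on the
compact manifold `M` (`le_of_deriv_nonpos_at_max`).

* Height: at a spatial maximum of `u` one has `u v H ≥ n` and `v = 1`, so `∂ₜf ≤ 1/n` there, and
  conversely at a minimum. Thus `u e^{-t/n}` stays between the extrema of `u₀`.
* Speed: the equation for `f` does not contain `f` itself, so `w` solves a linear parabolic
  equation without zeroth order term; at a spatial critical point of `w` it reads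
  `∂ₜw = v² (u v H)⁻² (σᵏˡ - fᵏ fˡ / v²) w_{kl}` (`IsLogFlowOn.hasDerivAt_speed`). Thus `w` stays
  between its initial extrema.
* Gradient: at a spatial maximum of `|Df|²` the Bochner formula (`IsMetricOn.bochner`) gives
  `∂ₜ|Df|² ≤ -2 v² (u v H)⁻² (|D²f|² + Ric(Df, Df)) ≤ 0`
  (`IsLogFlowOn.deriv_gradNormSq_nonpos`). This is where the Ricci curvature enters.

These computations are done in coordinates. They apply on `M` because `w` is defined without
charts and `|Df|²` does not depend on the chart (`gradNormSq_chart_indep`). That `H` stays positive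
follows from continuity in time.
The constants only depend on one bound `K` for `u₀`, `u₀ v₀ H₀` and `|D log u₀|²`
(`IsGraphIMCF.meanCurv_bounds`). Such a bound exists by compactness, and it is explicit in terms of
bounds for `u₀`, `Du₀`, `D²u₀` and `H₀`.
-/

noncomputable section

namespace IMCF

/-! ### Coordinate calculus -/

section Calculus

variable {n : ℕ} {f g : Eucl n → ℝ} {y : Eucl n}

theorem pd_congr (h : f =ᶠ[nhds y] g) (i : Fin n) : pd i f y = pd i g y := by
  rw [pd, pd, h.fderiv_eq]

theorem pd_const (i : Fin n) (c : ℝ) : pd i (fun _ => c) y = 0 := by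
  simp [pd]

theorem pd_add (hf : DifferentiableAt ℝ f y) (hg : DifferentiableAt ℝ g y) (i : Fin n) :
    pd i (fun z => f z + g z) y = pd i f y + pd i g y := by
  rw [pd, fderiv_fun_add hf hg]; rfl

theorem pd_sub (hf : DifferentiableAt ℝ f y) (hg : DifferentiableAt ℝ g y) (i : Fin n) :
    pd i (fun z => f z - g z) y = pd i f y - pd i g y := by
  rw [pd, fderiv_fun_sub hf hg]; rfl

theorem pd_mul (hf : DifferentiableAt ℝ f y) (hg : DifferentiableAt ℝ g y) (i : Fin n) :
    pd i (fun z => f z * g z) y = pd i f y * g y + f y * pd i g y := by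
  rw [pd, fderiv_fun_mul hf hg]
  simp [pd]; ring

theorem pd_sum {ι : Type*} {s : Finset ι} {F : ι → Eucl n → ℝ}
    (hF : ∀ k ∈ s, DifferentiableAt ℝ (F k) y) (i : Fin n) :
    pd i (fun z => ∑ k ∈ s, F k z) y = ∑ k ∈ s, pd i (F k) y := by
  rw [pd, fderiv_fun_sum hF]; simp [pd]

theorem pd_div (hf : DifferentiableAt ℝ f y) (hg : DifferentiableAt ℝ g y) (h0 : g y ≠ 0)
    (i : Fin n) :
    pd i (fun z => f z / g z) y = (pd i f y * g y - f y * pd i g y) / g y ^ 2 := by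
  have hi : HasFDerivAt (fun z => (g z)⁻¹) (-(g y ^ 2)⁻¹ • fderiv ℝ g y) y :=
    (hasDerivAt_inv h0).comp_hasFDerivAt y hg.hasFDerivAt
  have h := pd_mul hf hi.differentiableAt i
  have h2 : pd i (fun z => (g z)⁻¹) y = -(g y ^ 2)⁻¹ * pd i g y := by
    rw [pd, hi.fderiv]; simp [pd]
  simp only [div_eq_mul_inv] at h ⊢
  rw [h, h2]
  field_simp
  ring

theorem pd_log (hf : DifferentiableAt ℝ f y) (h0 : f y ≠ 0) (i : Fin n) :
    pd i (fun z => Real.log (f z)) y = (f y)⁻¹ * pd i f y := by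
  rw [pd, fderiv.log hf h0]
  simp [pd]

theorem contDiffOn_pd {Ω : Set (Eucl n)} (hΩ : IsOpen Ω) (hf : ContDiffOn ℝ ∞ f Ω) (i : Fin n) :
    ContDiffOn ℝ ∞ (pd i f) Ω := by
  have h : ContDiffOn ℝ ∞ (fderiv ℝ f) Ω := hf.fderiv_of_isOpen hΩ (by simp)
  exact h.clm_apply contDiffOn_const

theorem pd_pd_eq (hf : ContDiffAt ℝ 2 f y) (a b : Fin n) :
    pd a (pd b f) y
      = fderiv ℝ (fderiv ℝ f) y (EuclideanSpace.single a 1) (EuclideanSpace.single b 1) := by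
  have hd : DifferentiableAt ℝ (fderiv ℝ f) y :=
    (hf.fderiv_right (m := 1) (by norm_num)).differentiableAt (by norm_num)
  unfold pd
  rw [fderiv_clm_apply hd (by fun_prop)]
  simp

/-- The second partial derivatives of a `C²` function commute. -/
theorem pd_comm (hf : ContDiffAt ℝ 2 f y) (i j : Fin n) :
    pd i (pd j f) y = pd j (pd i f) y := by
  rw [pd_pd_eq hf, pd_pd_eq hf]
  exact (hf.isSymmSndFDerivAt (by simp)).eq _ _

end Calculus

/-! ### Calculus of time dependent functions -/

section TimeDependent

variable {n : ℕ} {I : Set ℝ} {Ω : Set (Eucl n)} {f : ℝ → Eucl n → ℝ}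

/-- A time dependent function which is smooth in time and space jointly. -/
def SmoothOn (f : ℝ → Eucl n → ℝ) (I : Set ℝ) (Ω : Set (Eucl n)) : Prop :=
  ContDiffOn ℝ ∞ (fun q : ℝ × Eucl n => f q.1 q.2) (I ×ˢ Ω)

theorem SmoothOn.hasFDerivAt (hf : SmoothOn f I Ω) (hI : IsOpen I) (hΩ : IsOpen Ω) {t : ℝ}
    {y : Eucl n} (ht : t ∈ I) (hy : y ∈ Ω) :
    HasFDerivAt (fun q : ℝ × Eucl n => f q.1 q.2)
      (fderiv ℝ (fun q : ℝ × Eucl n => f q.1 q.2) (t, y)) (t, y) :=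
  ((hf.contDiffAt ((hI.prod hΩ).mem_nhds ⟨ht, hy⟩)).differentiableAt (by simp)).hasFDerivAt

theorem SmoothOn.contDiffOn (hf : SmoothOn f I Ω) {t : ℝ} (ht : t ∈ I) :
    ContDiffOn ℝ ∞ (f t) Ω :=
  ContDiffOn.comp (t := I ×ˢ Ω) hf (contDiff_prodMk_right t).contDiffOn fun _ hy => ⟨ht, hy⟩

theorem SmoothOn.hasDerivAt_fderiv (hf : SmoothOn f I Ω) (hI : IsOpen I) (hΩ : IsOpen Ω) {t : ℝ}
    {y : Eucl n} (ht : t ∈ I) (hy : y ∈ Ω) :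
    HasDerivAt (fun s => f s y)
      (fderiv ℝ (fun q : ℝ × Eucl n => f q.1 q.2) (t, y) (1, 0)) t := by
  have h := (hf.hasFDerivAt hI hΩ ht hy).comp_hasDerivAt t
    ((hasDerivAt_id t).prodMk (hasDerivAt_const t y))
  exact h

theorem SmoothOn.hasDerivAt (hf : SmoothOn f I Ω) (hI : IsOpen I) (hΩ : IsOpen Ω) {t : ℝ}
    {y : Eucl n} (ht : t ∈ I) (hy : y ∈ Ω) :
    HasDerivAt (fun s => f s y) (deriv (fun s => f s y) t) t :=
  (hf.hasDerivAt_fderiv hI hΩ ht hy).differentiableAt.hasDerivAt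

theorem SmoothOn.pd_eq (hf : SmoothOn f I Ω) (hI : IsOpen I) (hΩ : IsOpen Ω) {t : ℝ}
    {y : Eucl n} (ht : t ∈ I) (hy : y ∈ Ω) (i : Fin n) :
    pd i (f t) y
      = fderiv ℝ (fun q : ℝ × Eucl n => f q.1 q.2) (t, y) (0, EuclideanSpace.single i 1) := by
  have h := (hf.hasFDerivAt hI hΩ ht hy).comp y
    ((hasFDerivAt_const t y).prodMk (hasFDerivAt_id y))
  rw [pd]
  erw [h.fderiv]
  simp

theorem SmoothOn.fderiv_apply (hf : SmoothOn f I Ω) (hI : IsOpen I) (hΩ : IsOpen Ω)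
    (V : ℝ × Eucl n) :
    ContDiffOn ℝ ∞ (fun q => fderiv ℝ (fun q : ℝ × Eucl n => f q.1 q.2) q V) (I ×ˢ Ω) := by
  have h := ContDiffOn.fderiv_of_isOpen (m := ∞) hf (hI.prod hΩ) (by simp)
  exact h.clm_apply contDiffOn_const

theorem SmoothOn.pd (hf : SmoothOn f I Ω) (hI : IsOpen I) (hΩ : IsOpen Ω) (i : Fin n) :
    SmoothOn (fun t => IMCF.pd i (f t)) I Ω :=
  (hf.fderiv_apply hI hΩ (0, EuclideanSpace.single i 1)).congr fun _ hq =>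
    hf.pd_eq hI hΩ hq.1 hq.2 i

theorem SmoothOn.deriv (hf : SmoothOn f I Ω) (hI : IsOpen I) (hΩ : IsOpen Ω) :
    SmoothOn (fun t y => deriv (fun s => f s y) t) I Ω :=
  (hf.fderiv_apply hI hΩ (1, 0)).congr fun _ hq =>
    (hf.hasDerivAt_fderiv hI hΩ hq.1 hq.2).deriv

/-- Time and space derivatives of a smooth function commute. -/
theorem SmoothOn.hasDerivAt_pd (hf : SmoothOn f I Ω) (hI : IsOpen I) (hΩ : IsOpen Ω) {t : ℝ}
    {y : Eucl n} (ht : t ∈ I) (hy : y ∈ Ω) (i : Fin n) :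
    HasDerivAt (fun s => IMCF.pd i (f s) y)
      (IMCF.pd i (fun z => _root_.deriv (fun s => f s z) t) y) t := by
  have hO : I ×ˢ Ω ∈ nhds (t, y) := (hI.prod hΩ).mem_nhds ⟨ht, hy⟩
  have hc : ContDiffAt ℝ ∞ (fun q : ℝ × Eucl n => f q.1 q.2) (t, y) := hf.contDiffAt hO
  have hd : DifferentiableAt ℝ (fderiv ℝ (fun q : ℝ × Eucl n => f q.1 q.2)) (t, y) :=
    (hc.fderiv_right (m := 1) (by exact WithTop.coe_le_coe.2 le_top)).differentiableAt (by norm_num)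
  have h := (hf.pd hI hΩ i).hasDerivAt_fderiv hI hΩ ht hy
  convert h using 1
  rw [(hf.deriv hI hΩ).pd_eq hI hΩ ht hy]
  have e1 : (fun q : ℝ × Eucl n => _root_.deriv (fun s => f s q.2) q.1) =ᶠ[nhds (t, y)]
      fun q => fderiv ℝ (fun q : ℝ × Eucl n => f q.1 q.2) q (1, 0) := by
    filter_upwards [hO] with q hq
    exact (hf.hasDerivAt_fderiv hI hΩ hq.1 hq.2).deriv
  have e2 : (fun q : ℝ × Eucl n => IMCF.pd i (f q.1) q.2) =ᶠ[nhds (t, y)]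
      fun q => fderiv ℝ (fun q : ℝ × Eucl n => f q.1 q.2) q (0, EuclideanSpace.single i 1) := by
    filter_upwards [hO] with q hq
    exact hf.pd_eq hI hΩ hq.1 hq.2 i
  rw [e1.fderiv_eq, e2.fderiv_eq, fderiv_clm_apply hd (by fun_prop),
    fderiv_clm_apply hd (by fun_prop)]
  simp only [fderiv_fun_const, Pi.zero_apply, ContinuousLinearMap.comp_zero, zero_add,
    ContinuousLinearMap.flip_apply]
  exact (hc.isSymmSndFDerivAt (by
    rw [minSmoothness_of_isRCLikeNormedField]; exact WithTop.coe_le_coe.2 le_top)).eq _ _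

theorem SmoothOn.hasDerivAt_pd_pd (hf : SmoothOn f I Ω) (hI : IsOpen I) (hΩ : IsOpen Ω) {t : ℝ}
    {y : Eucl n} (ht : t ∈ I) (hy : y ∈ Ω) (i j : Fin n) :
    HasDerivAt (fun s => IMCF.pd i (IMCF.pd j (f s)) y)
      (IMCF.pd i (IMCF.pd j (fun z => _root_.deriv (fun s => f s z) t)) y) t := by
  convert (hf.pd hI hΩ j).hasDerivAt_pd hI hΩ ht hy i using 1
  refine pd_congr ?_ i
  filter_upwards [hΩ.mem_nhds hy] with z hz
  exact (hf.hasDerivAt_pd hI hΩ ht hz j).deriv.symm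

end TimeDependent

/-! ### Second derivative test -/

theorem deriv_deriv_nonpos_of_isLocalMax {g : ℝ → ℝ} {s : ℝ} (hg : ContinuousAt g s)
    (h : IsLocalMax g s) : deriv (deriv g) s ≤ 0 := by
  by_contra! hpos
  have hmin := isLocalMin_of_deriv_deriv_pos hpos h.deriv_eq_zero hg
  -- a local minimum which is also a local maximum: `g` is locally constant
  have hconst : g =ᶠ[nhds s] fun _ => g s := by
    filter_upwards [h, hmin] with x h1 h2 using le_antisymm h1 h2
  have h1 : deriv g =ᶠ[nhds s] deriv fun _ => g s := hconst.deriv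
  rw [h1.deriv_eq] at hpos
  simp at hpos

theorem fderiv_fderiv_nonpos_of_isLocalMax {n : ℕ} {f : Eucl n → ℝ} {y : Eucl n}
    (hf : ContDiffAt ℝ 2 f y) (hmax : IsLocalMax f y) (X : Eucl n) :
    fderiv ℝ (fderiv ℝ f) y X X ≤ 0 := by
  have hd : DifferentiableAt ℝ (fderiv ℝ f) y :=
    (hf.fderiv_right (m := 1) (by norm_num)).differentiableAt (by norm_num)
  have hl : ∀ s : ℝ, HasDerivAt (fun s : ℝ => y + s • X) X s := fun s => by
    simpa using ((hasDerivAt_id s).smul_const X).const_add y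
  have hl0 : Filter.Tendsto (fun s : ℝ => y + s • X) (nhds 0) (nhds y) := by
    have := (hl 0).continuousAt.tendsto
    simpa using this
  have h1 : deriv (fun s : ℝ => f (y + s • X)) =ᶠ[nhds 0] fun s => fderiv ℝ f (y + s • X) X := by
    have : ∀ᶠ z in nhds y, DifferentiableAt ℝ f z := by
      filter_upwards [hf.eventually (by simp)] with z hz
      exact hz.differentiableAt (by norm_num)
    filter_upwards [hl0.eventually this] with s hs
    exact (hs.hasFDerivAt.comp_hasDerivAt s (hl s)).deriv
  have h2 : HasDerivAt (fun s : ℝ => fderiv ℝ f (y + s • X) X)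
      (fderiv ℝ (fderiv ℝ f) y X X) 0 := by
    have hd' : HasFDerivAt (fderiv ℝ f) (fderiv ℝ (fderiv ℝ f) y) (y + (0 : ℝ) • X) := by
      simpa using hd.hasFDerivAt
    exact (ContinuousLinearMap.apply ℝ ℝ X).hasFDerivAt.comp_hasDerivAt (0 : ℝ)
      (hd'.comp_hasDerivAt (0 : ℝ) (hl 0))
  rw [← h2.deriv, ← h1.deriv_eq]
  have hcont : ContinuousAt f (y + (0 : ℝ) • X) := by simpa using hf.continuousAt
  refine deriv_deriv_nonpos_of_isLocalMax
    (ContinuousAt.comp (f := fun s : ℝ => y + s • X) hcont (hl 0).continuousAt) ?_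
  filter_upwards [hl0.eventually hmax] with s hs
  simpa using hs

/-- At a local maximum the trace of the Hessian against a positive semidefinite matrix is
nonpositive: decompose the matrix into squares of vectors, and use the second derivative test
along each of them. -/
theorem sum_mul_pd_pd_nonpos {n : ℕ} {f : Eucl n → ℝ} {y : Eucl n} (hf : ContDiffAt ℝ 2 f y)
    (hmax : IsLocalMax f y) {A : Matrix (Fin n) (Fin n) ℝ} (hA : A.PosSemidef) :
    ∑ k, ∑ l, A k l * pd k (pd l f) y ≤ 0 := by
  have hdir := fderiv_fderiv_nonpos_of_isLocalMax hf hmax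
  simp only [pd_pd_eq hf]
  generalize fderiv ℝ (fderiv ℝ f) y = D at hdir
  obtain ⟨m, v, rfl⟩ := Matrix.posSemidef_iff_eq_sum_vecMulVec.1 hA
  have key : ∀ e, D (WithLp.toLp 2 (v e)) (WithLp.toLp 2 (v e)) = ∑ k, ∑ l, v e k * v e l *
      D (EuclideanSpace.single k 1) (EuclideanSpace.single l 1) := by
    intro e
    have hX : (WithLp.toLp 2 (v e) : Eucl n) = ∑ k, v e k • EuclideanSpace.single k (1 : ℝ) := by
      ext i
      simp [Finset.sum_apply, Pi.single_apply]
    rw [hX]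
    simp only [map_sum, map_smul, FunLike.coe_sum, Finset.sum_apply, FunLike.coe_smul,
      Pi.smul_apply, smul_eq_mul, Finset.mul_sum]
    rw [Finset.sum_comm]
    refine Finset.sum_congr rfl fun k _ => Finset.sum_congr rfl fun l _ => by ring
  calc _ = ∑ k, ∑ l, ∑ e, v e k * v e l *
      D (EuclideanSpace.single k 1) (EuclideanSpace.single l 1) := by
        simp only [Matrix.sum_apply, Matrix.vecMulVec_apply, Finset.sum_mul, star_trivial]
    _ = ∑ e, ∑ k, ∑ l, v e k * v e l *
      D (EuclideanSpace.single k 1) (EuclideanSpace.single l 1) := by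
        rw [Finset.sum_comm (s := (Finset.univ : Finset (Fin m)))]
        exact Finset.sum_congr rfl fun k _ => Finset.sum_comm
    _ ≤ 0 := Finset.sum_nonpos fun e _ => (key e).symm.trans_le (hdir _)

/-! ### Gradient, Laplacian and the metric at a point -/

section Pointwise

variable {n : ℕ} {σ : Eucl n → Matrix (Fin n) (Fin n) ℝ} {f : Eucl n → ℝ} {y : Eucl n}

/-- The gradient `fᵏ = σᵏˡ f_l`. -/
def gradVec (σ : Eucl n → Matrix (Fin n) (Fin n) ℝ) (f : Eucl n → ℝ) (k : Fin n) (y : Eucl n) :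
    ℝ :=
  ∑ l, (σ y)⁻¹ k l * pd l f y

/-- The Laplacian `Δf = σⁱʲ f_{ij}`. -/
def laplacian (σ : Eucl n → Matrix (Fin n) (Fin n) ℝ) (f : Eucl n → ℝ) (y : Eucl n) : ℝ :=
  ∑ i, ∑ j, (σ y)⁻¹ i j * hessian σ f i j y

/-- The second derivative `f_{ij} fⁱ fʲ` in the direction of the gradient. -/
def hessGrad (σ : Eucl n → Matrix (Fin n) (Fin n) ℝ) (f : Eucl n → ℝ) (y : Eucl n) : ℝ :=
  ∑ i, ∑ j, hessian σ f i j y * gradVec σ f i y * gradVec σ f j y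

theorem _root_.Matrix.PosDef.apply_comm {S : Matrix (Fin n) (Fin n) ℝ} (h : S.PosDef)
    (i j : Fin n) : S i j = S j i := by
  simpa using h.isHermitian.apply j i

theorem _root_.Matrix.PosDef.isUnit_det' {S : Matrix (Fin n) (Fin n) ℝ} (h : S.PosDef) :
    IsUnit S.det :=
  (Matrix.isUnit_iff_isUnit_det _).1 h.isUnit

theorem sum_metric_gradVec (h : (σ y).PosDef) (i : Fin n) :
    ∑ j, σ y i j * gradVec σ f j y = pd i f y := by
  have h2 : (σ y).mulVec ((σ y)⁻¹.mulVec fun l => pd l f y) i = pd i f y := by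
    rw [Matrix.mulVec_mulVec, Matrix.mul_nonsing_inv _ h.isUnit_det', Matrix.one_mulVec]
  exact h2

theorem gradNormSq_eq_sum : gradNormSq σ f y = ∑ i, pd i f y * gradVec σ f i y := by
  simp only [gradNormSq, gradVec, Finset.mul_sum]
  exact Finset.sum_congr rfl fun i _ => Finset.sum_congr rfl fun j _ => by ring

theorem gradNormSq_eq_metric (h : (σ y).PosDef) :
    gradNormSq σ f y = ∑ i, ∑ j, σ y i j * gradVec σ f i y * gradVec σ f j y := by
  rw [gradNormSq_eq_sum]
  refine Finset.sum_congr rfl fun i _ => ?_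
  rw [← sum_metric_gradVec h, Finset.sum_mul]
  exact Finset.sum_congr rfl fun j _ => by ring

theorem gradNormSq_nonneg (h : (σ y).PosDef) : 0 ≤ gradNormSq σ f y := by
  have := h.inv.posSemidef.dotProduct_mulVec_nonneg fun l => pd l f y
  rw [gradNormSq_eq_sum]
  simpa [dotProduct, Matrix.mulVec, gradVec] using this

theorem sum_inv_mul_metric (h : (σ y).PosDef) :
    ∑ i, ∑ j, (σ y)⁻¹ i j * σ y i j = n := by
  have h1 : ((σ y)⁻¹ * σ y).trace = n := by
    rw [Matrix.nonsing_inv_mul _ h.isUnit_det']; simp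
  rw [← h1]
  simp only [Matrix.trace, Matrix.diag, Matrix.mul_apply]
  exact Finset.sum_congr rfl fun i _ => Finset.sum_congr rfl fun j _ => by
    rw [h.apply_comm i j]

/-- The Christoffel symbols of the first kind. -/
def christoffelLow {m : ℕ} (g : Eucl m → Matrix (Fin m) (Fin m) ℝ) (e a b : Fin m)
    (y : Eucl m) : ℝ :=
  (1 / 2) * (pd a (fun z => g z e b) y + pd b (fun z => g z a e) y - pd e (fun z => g z a b) y)

theorem sum_metric_christoffel {m : ℕ} {g : Eucl m → Matrix (Fin m) (Fin m) ℝ} {z : Eucl m}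
    (h : IsUnit (g z).det) (e a b : Fin m) :
    ∑ c, g z e c * christoffel g c a b z = christoffelLow g e a b z := by
  have h1 : (g z).mulVec ((g z)⁻¹.mulVec fun e => christoffelLow g e a b z) e
      = christoffelLow g e a b z := by
    rw [Matrix.mulVec_mulVec, Matrix.mul_nonsing_inv _ h, Matrix.one_mulVec]
  rw [← h1]
  simp only [Matrix.mulVec, dotProduct, christoffel, christoffelLow, Finset.mul_sum]
  exact Finset.sum_congr rfl fun i _ => Finset.sum_congr rfl fun j _ => by ring

theorem sum_christoffel_mul_pd (h : (σ y).PosDef) (i j : Fin n) :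
    ∑ k, christoffel σ k i j y * pd k f y = ∑ k, christoffelLow σ k i j y * gradVec σ f k y := by
  simp_rw [← sum_metric_christoffel h.isUnit_det', ← sum_metric_gradVec h, Finset.sum_mul,
    Finset.mul_sum]
  rw [Finset.sum_comm]
  refine Finset.sum_congr rfl fun k _ => Finset.sum_congr rfl fun l _ => ?_
  rw [h.apply_comm k l]; ring

end Pointwise

/-! ### Mean curvature of graphs -/

section Graph

variable {n : ℕ} {σ : Eucl n → Matrix (Fin n) (Fin n) ℝ} {f : Eucl n → ℝ} {y : Eucl n}

theorem isUnit_det_warped {z : Eucl (n + 1)} (h : (σ (tailPt z)).PosDef) (hz : z 0 ≠ 0) :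
    IsUnit (warped σ z).det := by
  refine Matrix.isUnit_det_of_right_inverse (B := Matrix.of fun a b =>
    Fin.cases (Fin.cases 1 (fun _ => 0) b)
      (fun i => Fin.cases 0 (fun j => (z 0 ^ 2)⁻¹ * (σ (tailPt z))⁻¹ i j) b) a) ?_
  have h1 := Matrix.mul_nonsing_inv _ h.isUnit_det'
  ext a b
  rw [Matrix.mul_apply, Fin.sum_univ_succ]
  induction a using Fin.cases with
  | zero =>
    induction b using Fin.cases with
    | zero => simp [warped]
    | succ j => simp [warped, (Fin.succ_ne_zero j).symm]
  | succ i =>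
    induction b using Fin.cases with
    | zero => simp [warped, Fin.succ_ne_zero]
    | succ j =>
      have h2 := congrFun (congrFun h1 i) j
      rw [Matrix.mul_apply] at h2
      simp only [warped, Matrix.of_apply, Fin.cases_succ, Fin.cases_zero, zero_mul, zero_add]
      have h3 : (1 : Matrix (Fin (n + 1)) (Fin (n + 1)) ℝ) i.succ j.succ
          = (1 : Matrix (Fin n) (Fin n) ℝ) i j := by simp [Matrix.one_apply]
      rw [h3, ← h2]
      refine Finset.sum_congr rfl fun k _ => ?_
      field_simp

theorem warped_comm {z : Eucl (n + 1)} (h : (σ (tailPt z)).PosDef) (a b : Fin (n + 1)) :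
    warped σ z a b = warped σ z b a := by
  induction a using Fin.cases <;> induction b using Fin.cases <;>
    simp [warped]
  exact Or.inl (h.apply_comm _ _)

/-- `tailPt` as a linear map. -/
def tailL (n : ℕ) : Eucl (n + 1) →L[ℝ] Eucl n :=
  LinearMap.toContinuousLinearMap
    { toFun := tailPt
      map_add' := fun _ _ => by ext; simp [tailPt]
      map_smul' := fun _ _ => by ext; simp [tailPt] }

theorem pd_comp_tailPt {g : Eucl n → ℝ} {z : Eucl (n + 1)}
    (hg : DifferentiableAt ℝ g (tailPt z)) (a : Fin (n + 1)) :
    pd a (fun z => g (tailPt z)) z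
      = Fin.cases 0 (fun k => pd k g (tailPt z)) a := by
  have h : HasFDerivAt (fun z => g (tailPt z)) ((fderiv ℝ g (tailPt z)).comp (tailL n)) z :=
    HasFDerivAt.comp (f := tailPt) z hg.hasFDerivAt (tailL n).hasFDerivAt
  rw [pd, h.fderiv, ContinuousLinearMap.comp_apply]
  have h2 : tailL n (EuclideanSpace.single a 1)
      = Fin.cases 0 (fun k => EuclideanSpace.single k 1) a := by
    change tailPt _ = _
    induction a using Fin.cases with
    | zero => ext i; simp [tailPt, Fin.succ_ne_zero]
    | succ k => ext i; simp [tailPt]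
  rw [h2]
  induction a using Fin.cases with
  | zero => simp
  | succ k => simp [pd]

theorem pd_warped {z : Eucl (n + 1)}
    (hσ : ∀ i j, DifferentiableAt ℝ (fun z => σ z i j) (tailPt z)) (i j : Fin n)
    (a : Fin (n + 1)) :
    pd a (fun z => warped σ z i.succ j.succ) z
      = Fin.cases (2 * z 0 * σ (tailPt z) i j)
          (fun k => z 0 ^ 2 * pd k (fun z => σ z i j) (tailPt z)) a := by
  have hd0 : DifferentiableAt ℝ (fun z : Eucl (n + 1) => z 0) z := by fun_prop
  have hd1 : DifferentiableAt ℝ (fun z => σ (tailPt z) i j) z :=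
    DifferentiableAt.comp (f := tailPt) z (hσ i j) (tailL n).differentiableAt
  have h : (fun z => warped σ z i.succ j.succ) = fun z => (z 0 * z 0) * σ (tailPt z) i j := by
    ext z; simp [warped, sq]
  rw [h, pd_mul (hd0.fun_mul hd0) hd1, pd_mul hd0 hd0, pd_comp_tailPt (hσ i j), pd_coord]
  induction a using Fin.cases with
  | zero => simp; left; ring
  | succ k => simp [(Fin.succ_ne_zero k).symm, sq]

theorem pd_warped_zero_left (b a : Fin (n + 1)) (z : Eucl (n + 1)) :
    pd a (fun z => warped σ z 0 b) z = 0 := by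
  induction b using Fin.cases with
  | zero => exact pd_const _ _
  | succ k => exact pd_const _ _

theorem pd_warped_zero_right (b a : Fin (n + 1)) (z : Eucl (n + 1)) :
    pd a (fun z => warped σ z b 0) z = 0 := by
  induction b using Fin.cases with
  | zero => exact pd_const _ _
  | succ k => exact pd_const _ _

/-- The second fundamental form of a graph, `v h_{ij} = f σ_{ij} + 2 f⁻¹ f_i f_j - f_{ij}`. Only
Christoffel symbols of the first kind of the warped metric enter, so its inverse is not needed. -/
theorem secondFundForm_graph (h : (σ y).PosDef)
    (hσ : ∀ i j, DifferentiableAt ℝ (fun z => σ z i j) y) (hf : f y ≠ 0) (i j : Fin n) :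
    secondFundForm (warped σ) (graphMap f) (graphNormal σ f y) i j y
      = (slant σ f y)⁻¹ *
        (f y * σ y i j + 2 * (f y)⁻¹ * pd i f y * pd j f y - hessian σ f i j y) := by
  have hy : tailPt (graphMap f y) = y := tailPt_graphMap f y
  have hy0 : (graphMap f y) 0 = f y := rfl
  have hu : IsUnit (warped σ (graphMap f y)).det :=
    isUnit_det_warped (by rwa [hy]) (by rwa [hy0])
  set Z := graphMap f y with hZ
  set ν := graphNormal σ f y with hν
  have hσ' : ∀ i j, DifferentiableAt ℝ (fun z => σ z i j) (tailPt Z) := by rwa [hy]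
  have hpd : ∀ a : Fin (n + 1), pd i (pd j (fun z => graphMap f z a)) y
      = Fin.cases (pd i (pd j f) y) (fun _ => 0) a := by
    intro a
    induction a using Fin.cases with
    | zero => rfl
    | succ k =>
      have : pd j (fun z => graphMap f z k.succ) = fun _ => if k = j then 1 else 0 := by
        ext z; exact tangentVec_graphMap_succ f j k z
      rw [this, pd_const]; rfl
  -- `γ(x_{ij}, ν)` with the Christoffel symbols lowered by `γ`
  have split : ip (warped σ) Z (secondDeriv (warped σ) (graphMap f) i j y) ν
      = ν 0 * pd i (pd j f) y + ∑ d, ν d * ∑ b, ∑ c, christoffelLow (warped σ) d b c Z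
          * tangentVec (graphMap f) i y b * tangentVec (graphMap f) j y c := by
    have e1 : ip (warped σ) Z (fun a => pd i (pd j (fun z => graphMap f z a)) y) ν
        = ν 0 * pd i (pd j f) y := by
      rw [ip_warped]; simp [hpd]; ring
    rw [← e1]
    simp only [ip, secondDeriv, ← hZ]
    simp_rw [← sum_metric_christoffel hu, mul_add, add_mul, Finset.sum_add_distrib]
    congr 1
    rw [Finset.sum_comm]
    refine Finset.sum_congr rfl fun d _ => ?_
    have : ∀ b c, (∑ a, warped σ Z d a * christoffel (warped σ) a b c Z)
        * tangentVec (graphMap f) i y b * tangentVec (graphMap f) j y c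
        = ∑ a, warped σ Z d a * (christoffel (warped σ) a b c Z
        * tangentVec (graphMap f) i y b * tangentVec (graphMap f) j y c) := by
      intro b c
      simp only [Finset.sum_mul, mul_assoc]
    simp_rw [this]
    have e2 : ∀ b, ∑ c, ∑ a, warped σ Z d a * (christoffel (warped σ) a b c Z
        * tangentVec (graphMap f) i y b * tangentVec (graphMap f) j y c)
        = ∑ a, ∑ c, warped σ Z d a * (christoffel (warped σ) a b c Z
        * tangentVec (graphMap f) i y b * tangentVec (graphMap f) j y c) :=
      fun b => Finset.sum_comm
    simp_rw [e2]
    rw [Finset.sum_comm, Finset.mul_sum]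
    refine Finset.sum_congr rfl fun a _ => ?_
    rw [warped_comm (by rwa [hy]) a d]
    simp only [← Finset.mul_sum]
    ring
  have low0 : ∑ b, ∑ c, christoffelLow (warped σ) 0 b c Z
          * tangentVec (graphMap f) i y b * tangentVec (graphMap f) j y c
      = - (f y * σ y i j) := by
    simp only [Fin.sum_univ_succ, christoffelLow, pd_warped_zero_left, pd_warped_zero_right,
      pd_warped hσ', tangentVec_graphMap_zero, tangentVec_graphMap_succ, hy, hy0, Fin.cases_zero]
    simp
    ring
  have lowk : ∀ k : Fin n, ∑ b, ∑ c, christoffelLow (warped σ) k.succ b c Z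
          * tangentVec (graphMap f) i y b * tangentVec (graphMap f) j y c
      = f y * pd i f y * σ y k j + f y * pd j f y * σ y i k
        + f y ^ 2 * christoffelLow σ k i j y := by
    intro k
    simp only [Fin.sum_univ_succ, christoffelLow, pd_warped_zero_left, pd_warped_zero_right,
      pd_warped hσ', tangentVec_graphMap_zero, tangentVec_graphMap_succ, hy, hy0, Fin.cases_zero,
      Fin.cases_succ]
    simp [Finset.sum_add_distrib]
    ring
  have hP : ∀ k : Fin n, ν k.succ = -((slant σ f y)⁻¹ * (f y)⁻¹ ^ 2) * gradVec σ f k y := by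
    intro k; simp [hν, graphNormal, gradVec]
  have s1 : ∑ k, gradVec σ f k y * (f y * pd i f y * σ y k j + f y * pd j f y * σ y i k
        + f y ^ 2 * christoffelLow σ k i j y)
      = 2 * f y * pd i f y * pd j f y + f y ^ 2 * ∑ k, christoffel σ k i j y * pd k f y := by
    rw [sum_christoffel_mul_pd h]
    simp only [mul_add, Finset.sum_add_distrib]
    have a1 : ∑ k, gradVec σ f k y * (f y * pd i f y * σ y k j)
        = f y * pd i f y * pd j f y := by
      rw [← sum_metric_gradVec h j, Finset.mul_sum]
      exact Finset.sum_congr rfl fun k _ => by rw [h.apply_comm k j]; ring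
    have a2 : ∑ k, gradVec σ f k y * (f y * pd j f y * σ y i k)
        = f y * pd i f y * pd j f y := by
      conv_rhs => rw [← sum_metric_gradVec h i, Finset.mul_sum, Finset.sum_mul]
      exact Finset.sum_congr rfl fun k _ => by ring
    have a3 : ∑ k, gradVec σ f k y * (f y ^ 2 * christoffelLow σ k i j y)
        = f y ^ 2 * ∑ k, christoffelLow σ k i j y * gradVec σ f k y := by
      rw [Finset.mul_sum]
      exact Finset.sum_congr rfl fun k _ => by ring
    rw [a1, a2, a3]; ring
  rw [secondFundForm, ← hZ, split, Fin.sum_univ_succ, low0]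
  simp_rw [lowk, hP, mul_assoc, ← Finset.mul_sum]
  have s2 := s1
  simp only [mul_assoc] at s2
  rw [s2, hessian]
  have : ν 0 = (slant σ f y)⁻¹ := rfl
  rw [this]
  field_simp
  ring

theorem inducedMetric_graph (i j : Fin n) :
    inducedMetric (warped σ) (graphMap f) y i j = f y ^ 2 * σ y i j + pd i f y * pd j f y := by
  simp only [inducedMetric, Matrix.of_apply, ip_warped, tangentVec_graphMap_zero,
    tangentVec_graphMap_succ]
  simp
  ring

/-- The inverse induced metric `gⁱʲ = f⁻² (σⁱʲ - fⁱ fʲ / (f² + |Df|²))`. -/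
theorem inducedMetric_graph_inv (h : (σ y).PosDef) (hf : f y ≠ 0) (i j : Fin n) :
    (inducedMetric (warped σ) (graphMap f) y)⁻¹ i j
      = (f y ^ 2)⁻¹ * ((σ y)⁻¹ i j
        - gradVec σ f i y * gradVec σ f j y / (f y ^ 2 + gradNormSq σ f y)) := by
  have hq := gradNormSq_nonneg (f := f) h
  have hpos : 0 < f y ^ 2 + gradNormSq σ f y := by positivity
  suffices (inducedMetric (warped σ) (graphMap f) y)⁻¹ = Matrix.of fun i j =>
      (f y ^ 2)⁻¹ * ((σ y)⁻¹ i j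
        - gradVec σ f i y * gradVec σ f j y / (f y ^ 2 + gradNormSq σ f y)) by
    rw [this]; rfl
  refine Matrix.inv_eq_right_inv ?_
  ext a b
  have h1 := congrFun (congrFun (Matrix.mul_nonsing_inv _ h.isUnit_det') a) b
  rw [Matrix.mul_apply] at h1
  have h2 := sum_metric_gradVec (f := f) h a
  have h3 : ∑ k, pd k f y * (σ y)⁻¹ k b = gradVec σ f b y := by
    simp only [gradVec]
    exact Finset.sum_congr rfl fun k _ => by rw [h.inv.apply_comm b k]; ring
  have h4 := gradNormSq_eq_sum (σ := σ) (f := f) (y := y)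
  rw [Matrix.mul_apply, ← h1]
  simp only [inducedMetric_graph, Matrix.of_apply]
  have e : ∀ k, (f y ^ 2 * σ y a k + pd a f y * pd k f y) * ((f y ^ 2)⁻¹ * ((σ y)⁻¹ k b
        - gradVec σ f k y * gradVec σ f b y / (f y ^ 2 + gradNormSq σ f y)))
      = σ y a k * (σ y)⁻¹ k b
        - gradVec σ f b y / (f y ^ 2 + gradNormSq σ f y) * (σ y a k * gradVec σ f k y)
        + (f y ^ 2)⁻¹ * pd a f y * (pd k f y * (σ y)⁻¹ k b)
        - (f y ^ 2)⁻¹ * pd a f y * gradVec σ f b y / (f y ^ 2 + gradNormSq σ f y)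
          * (pd k f y * gradVec σ f k y) := by
    intro k; field_simp; ring
  simp_rw [e, Finset.sum_sub_distrib, Finset.sum_add_distrib, Finset.sum_sub_distrib,
    ← Finset.mul_sum]
  rw [h2, h3, ← h4]
  field_simp
  ring

/-- The mean curvature of a graph. -/
theorem meanCurv_graph (h : (σ y).PosDef)
    (hσ : ∀ i j, DifferentiableAt ℝ (fun z => σ z i j) y) (hf : f y ≠ 0) :
    meanCurv (warped σ) (graphMap f) (graphNormal σ f y) y
      = (slant σ f y)⁻¹ * (f y ^ 2)⁻¹ *
        (n * f y + 2 * (f y)⁻¹ * gradNormSq σ f y - laplacian σ f y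
          - (f y * gradNormSq σ f y + 2 * (f y)⁻¹ * gradNormSq σ f y ^ 2 - hessGrad σ f y)
            / (f y ^ 2 + gradNormSq σ f y)) := by
  have e : ∀ i j, (inducedMetric (warped σ) (graphMap f) y)⁻¹ i j
        * secondFundForm (warped σ) (graphMap f) (graphNormal σ f y) i j y
      = (slant σ f y)⁻¹ * (f y ^ 2)⁻¹ *
        (f y * ((σ y)⁻¹ i j * σ y i j) + 2 * (f y)⁻¹ * ((σ y)⁻¹ i j * pd i f y * pd j f y)
          - (σ y)⁻¹ i j * hessian σ f i j y
          - (f y * (σ y i j * gradVec σ f i y * gradVec σ f j y)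
              + 2 * (f y)⁻¹ * ((pd i f y * gradVec σ f i y) * (pd j f y * gradVec σ f j y))
              - hessian σ f i j y * gradVec σ f i y * gradVec σ f j y)
            / (f y ^ 2 + gradNormSq σ f y)) := by
    intro i j
    rw [inducedMetric_graph_inv h hf, secondFundForm_graph h hσ hf]
    ring
  simp only [meanCurv, e, ← Finset.mul_sum, Finset.sum_sub_distrib, Finset.sum_add_distrib,
    ← Finset.sum_div]
  rw [sum_inv_mul_metric h, ← gradNormSq_eq_metric h]
  simp only [laplacian, hessGrad]
  rw [← gradNormSq, ← gradNormSq_eq_sum, ← Finset.sum_mul, ← gradNormSq_eq_sum]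
  ring

end Graph

/-! ### The Bochner identity in coordinates -/

section Bochner

variable {n : ℕ} {σ : Eucl n → Matrix (Fin n) (Fin n) ℝ} {f : Eucl n → ℝ} {Ω : Set (Eucl n)}
  {y : Eucl n}

/-- `σ` is a smooth Riemannian metric on the coordinate domain `Ω`. -/
structure IsMetricOn (σ : Eucl n → Matrix (Fin n) (Fin n) ℝ) (Ω : Set (Eucl n)) : Prop where
  isOpen : IsOpen Ω
  contDiffOn : ∀ i j, ContDiffOn ℝ ∞ (fun z => σ z i j) Ω
  posDef : ∀ z ∈ Ω, (σ z).PosDef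

theorem ContDiffOn.differentiableAt_of_isOpen {g : Eucl n → ℝ} (hg : ContDiffOn ℝ ∞ g Ω)
    (hΩ : IsOpen Ω) (hy : y ∈ Ω) : DifferentiableAt ℝ g y :=
  (hg.contDiffAt (hΩ.mem_nhds hy)).differentiableAt (by simp)

theorem pd_congr_on {g h : Eucl n → ℝ} (hΩ : IsOpen Ω) (hgh : ∀ z ∈ Ω, g z = h z) (hy : y ∈ Ω)
    (i : Fin n) : pd i g y = pd i h y :=
  pd_congr (Filter.eventually_of_mem (hΩ.mem_nhds hy) hgh) i

theorem contDiffOn_det {m : ℕ} {A : Eucl n → Matrix (Fin m) (Fin m) ℝ}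
    (hA : ∀ i j, ContDiffOn ℝ ∞ (fun z => A z i j) Ω) :
    ContDiffOn ℝ ∞ (fun z => (A z).det) Ω := by
  simp only [Matrix.det_apply]
  refine ContDiffOn.sum fun τ _ => ?_
  exact (contDiffOn_prod fun i _ => hA _ _).const_smul _

theorem IsMetricOn.contDiffOn_inv (hσ : IsMetricOn σ Ω) (i j : Fin n) :
    ContDiffOn ℝ ∞ (fun z => (σ z)⁻¹ i j) Ω := by
  have h1 : ContDiffOn ℝ ∞ (fun z => ((σ z).det)⁻¹ * (σ z).adjugate i j) Ω := by
    refine ((contDiffOn_det hσ.contDiffOn).inv fun z hz =>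
      (hσ.posDef z hz).det_pos.ne').mul ?_
    simp only [Matrix.adjugate_apply]
    refine contDiffOn_det fun a b => ?_
    by_cases h : a = j
    · subst h
      simpa using contDiffOn_const
    · simpa [Matrix.updateRow_ne h] using hσ.contDiffOn a b
  refine h1.congr fun z hz => ?_
  rw [Matrix.inv_def, Ring.inverse_eq_inv']
  rfl

theorem IsMetricOn.contDiffOn_christoffel (hσ : IsMetricOn σ Ω) (c a b : Fin n) :
    ContDiffOn ℝ ∞ (christoffel σ c a b) Ω := by
  unfold christoffel
  refine contDiffOn_const.mul (ContDiffOn.sum fun e _ => (hσ.contDiffOn_inv c e).mul ?_)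
  exact ((contDiffOn_pd hσ.isOpen (hσ.contDiffOn e b) a).add
    (contDiffOn_pd hσ.isOpen (hσ.contDiffOn a e) b)).sub
    (contDiffOn_pd hσ.isOpen (hσ.contDiffOn a b) e)

theorem IsMetricOn.contDiffOn_gradVec (hσ : IsMetricOn σ Ω) (hf : ContDiffOn ℝ ∞ f Ω) (k : Fin n) :
    ContDiffOn ℝ ∞ (gradVec σ f k) Ω := by
  unfold gradVec
  exact ContDiffOn.sum fun l _ => (hσ.contDiffOn_inv k l).mul (contDiffOn_pd hσ.isOpen hf l)

theorem IsMetricOn.contDiffOn_hessian (hσ : IsMetricOn σ Ω) (hf : ContDiffOn ℝ ∞ f Ω)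
    (i j : Fin n) : ContDiffOn ℝ ∞ (hessian σ f i j) Ω := by
  unfold hessian
  exact (contDiffOn_pd hσ.isOpen (contDiffOn_pd hσ.isOpen hf j) i).sub
    (ContDiffOn.sum fun k _ => (hσ.contDiffOn_christoffel k i j).mul
      (contDiffOn_pd hσ.isOpen hf k))

theorem IsMetricOn.contDiffOn_gradNormSq (hσ : IsMetricOn σ Ω) (hf : ContDiffOn ℝ ∞ f Ω) :
    ContDiffOn ℝ ∞ (gradNormSq σ f) Ω := by
  unfold gradNormSq
  exact ContDiffOn.sum fun i _ => ContDiffOn.sum fun j _ => ((hσ.contDiffOn_inv i j).mul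
    (contDiffOn_pd hσ.isOpen hf i)).mul (contDiffOn_pd hσ.isOpen hf j)

theorem IsMetricOn.contDiffOn_laplacian (hσ : IsMetricOn σ Ω) (hf : ContDiffOn ℝ ∞ f Ω) :
    ContDiffOn ℝ ∞ (laplacian σ f) Ω := by
  unfold laplacian
  exact ContDiffOn.sum fun i _ => ContDiffOn.sum fun j _ => (hσ.contDiffOn_inv i j).mul
    (hσ.contDiffOn_hessian hf i j)

theorem IsMetricOn.contDiffOn_hessGrad (hσ : IsMetricOn σ Ω) (hf : ContDiffOn ℝ ∞ f Ω) :
    ContDiffOn ℝ ∞ (hessGrad σ f) Ω := by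
  unfold hessGrad
  exact ContDiffOn.sum fun i _ => ContDiffOn.sum fun j _ => ((hσ.contDiffOn_hessian hf i j).mul
    (hσ.contDiffOn_gradVec hf i)).mul (hσ.contDiffOn_gradVec hf j)

/-- The derivatives of the components of a metric are symmetric in the components. -/
theorem IsMetricOn.pd_comm (hσ : IsMetricOn σ Ω) (hy : y ∈ Ω) (a i j : Fin n) :
    pd a (fun z => σ z i j) y = pd a (fun z => σ z j i) y :=
  pd_congr_on hσ.isOpen (fun z hz => (hσ.posDef z hz).apply_comm i j) hy a

theorem IsMetricOn.christoffel_comm (hσ : IsMetricOn σ Ω) (hy : y ∈ Ω) (c a b : Fin n) :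
    christoffel σ c a b y = christoffel σ c b a y := by
  unfold christoffel
  congr 1
  refine Finset.sum_congr rfl fun e _ => ?_
  rw [hσ.pd_comm hy a e b, hσ.pd_comm hy b a e, hσ.pd_comm hy e a b]
  ring

theorem IsMetricOn.hessian_comm (hσ : IsMetricOn σ Ω) (hf : ContDiffAt ℝ 2 f y) (hy : y ∈ Ω)
    (i j : Fin n) : hessian σ f i j y = hessian σ f j i y := by
  unfold hessian
  rw [IMCF.pd_comm hf]
  simp_rw [hσ.christoffel_comm hy _ i j]

/-- The Hessian with one index raised, `∇_k fˡ = σˡʲ f_{jk}`. -/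
def hessUp (σ : Eucl n → Matrix (Fin n) (Fin n) ℝ) (f : Eucl n → ℝ) (k l : Fin n) (y : Eucl n) :
    ℝ :=
  ∑ j, (σ y)⁻¹ l j * hessian σ f j k y

theorem IsMetricOn.contDiffOn_hessUp (hσ : IsMetricOn σ Ω) (hf : ContDiffOn ℝ ∞ f Ω)
    (k l : Fin n) : ContDiffOn ℝ ∞ (hessUp σ f k l) Ω := by
  unfold hessUp
  exact ContDiffOn.sum fun j _ => (hσ.contDiffOn_inv l j).mul (hσ.contDiffOn_hessian hf j k)

/-- `hessUp` is the covariant derivative of the vector field `gradVec`; this is the compatibility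
of the Levi-Civita connection with the metric. -/
theorem IsMetricOn.hessUp_eq (hσ : IsMetricOn σ Ω) (hf : ContDiffOn ℝ ∞ f Ω) (hy : y ∈ Ω)
    (k l : Fin n) :
    hessUp σ f k l y
      = pd k (gradVec σ f l) y + ∑ m, christoffel σ l k m y * gradVec σ f m y := by
  have hpos := hσ.posDef y hy
  set V : Fin n → ℝ := fun l => pd k (gradVec σ f l) y
    + ∑ m, christoffel σ l k m y * gradVec σ f m y with hV
  have hc2 : ContDiffAt ℝ 2 f y :=
    (hf.contDiffAt (hσ.isOpen.mem_nhds hy)).of_le (WithTop.coe_le_coe.2 le_top)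
  have key : (σ y).mulVec V = fun i => hessian σ f i k y := by
    ext i
    have hd := pd_congr_on hσ.isOpen (fun z hz => sum_metric_gradVec (f := f) (hσ.posDef z hz) i)
      hy k
    have hdσ : ∀ j, DifferentiableAt ℝ (fun z => σ z i j) y := fun j =>
      ContDiffOn.differentiableAt_of_isOpen (hσ.contDiffOn i j) hσ.isOpen hy
    have hdP : ∀ j, DifferentiableAt ℝ (gradVec σ f j) y := fun j =>
      ContDiffOn.differentiableAt_of_isOpen (hσ.contDiffOn_gradVec hf j) hσ.isOpen hy
    rw [pd_sum fun j _ => (hdσ j).fun_mul (hdP j)] at hd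
    simp_rw [fun j => pd_mul (hdσ j) (hdP j) k, Finset.sum_add_distrib] at hd
    have h1 : ∑ l, σ y i l * ∑ m, christoffel σ l k m y * gradVec σ f m y
        = ∑ m, christoffelLow σ i k m y * gradVec σ f m y := by
      simp_rw [← sum_metric_christoffel hpos.isUnit_det', Finset.sum_mul, Finset.mul_sum]
      rw [Finset.sum_comm]
      exact Finset.sum_congr rfl fun _ _ => Finset.sum_congr rfl fun _ _ => by ring
    have h2 : ∑ m, christoffelLow σ i k m y * gradVec σ f m y
        + ∑ m, christoffelLow σ m i k y * gradVec σ f m y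
        = ∑ m, pd k (fun z => σ z i m) y * gradVec σ f m y := by
      rw [← Finset.sum_add_distrib]
      refine Finset.sum_congr rfl fun m _ => ?_
      unfold christoffelLow
      rw [hσ.pd_comm hy m k i, hσ.pd_comm hy i m k]
      ring
    simp only [Matrix.mulVec, dotProduct, hV, mul_add, Finset.sum_add_distrib]
    rw [h1, hessian, sum_christoffel_mul_pd hpos, IMCF.pd_comm hc2 i k, ← hd]
    linarith [h2]
  have h3 : V l = (σ y)⁻¹.mulVec (fun i => hessian σ f i k y) l := by
    rw [← key, Matrix.mulVec_mulVec, Matrix.nonsing_inv_mul _ hpos.isUnit_det', Matrix.one_mulVec]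
  exact h3.symm

theorem IsMetricOn.pd_gradNormSq (hσ : IsMetricOn σ Ω) (hf : ContDiffOn ℝ ∞ f Ω) (hy : y ∈ Ω)
    (k : Fin n) :
    pd k (gradNormSq σ f) y = 2 * ∑ i, hessian σ f k i y * gradVec σ f i y := by
  have hc2 : ContDiffAt ℝ 2 f y :=
    (hf.contDiffAt (hσ.isOpen.mem_nhds hy)).of_le (WithTop.coe_le_coe.2 le_top)
  have hpos := hσ.posDef y hy
  have hdp : ∀ j, DifferentiableAt ℝ (pd j f) y := fun j =>
    ContDiffOn.differentiableAt_of_isOpen (contDiffOn_pd hσ.isOpen hf j) hσ.isOpen hy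
  have hdP : ∀ j, DifferentiableAt ℝ (gradVec σ f j) y := fun j =>
    ContDiffOn.differentiableAt_of_isOpen (hσ.contDiffOn_gradVec hf j) hσ.isOpen hy
  have e : gradNormSq σ f = fun z => ∑ i, pd i f z * gradVec σ f i z := by
    ext z; exact gradNormSq_eq_sum
  rw [e, pd_sum fun j _ => (hdp j).fun_mul (hdP j)]
  simp_rw [fun j => pd_mul (hdp j) (hdP j) k]
  have hP : ∀ i, pd k (gradVec σ f i) y
      = hessUp σ f k i y - ∑ m, christoffel σ i k m y * gradVec σ f m y := fun i => by
    rw [hσ.hessUp_eq hf hy]; ring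
  simp_rw [hP, mul_sub, Finset.sum_add_distrib, Finset.sum_sub_distrib]
  have h1 : ∑ i, pd i f y * hessUp σ f k i y = ∑ i, hessian σ f k i y * gradVec σ f i y := by
    simp_rw [hessUp, gradVec, Finset.mul_sum]
    rw [Finset.sum_comm]
    refine Finset.sum_congr rfl fun i _ => Finset.sum_congr rfl fun j _ => ?_
    rw [hpos.inv.apply_comm j i, hσ.hessian_comm hc2 hy k i]; ring
  have h2 : ∑ i, hessian σ f k i y * gradVec σ f i y
      = ∑ i, pd k (pd i f) y * gradVec σ f i y
        - ∑ i, pd i f y * ∑ m, christoffel σ i k m y * gradVec σ f m y := by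
    simp_rw [hessian, sub_mul, Finset.sum_sub_distrib, Finset.sum_mul, Finset.mul_sum]
    congr 1
    rw [Finset.sum_comm]
    exact Finset.sum_congr rfl fun i _ => Finset.sum_congr rfl fun j _ => by ring
  rw [h1]
  linarith [h2]

theorem laplacian_eq_sum_hessUp (h : (σ y).PosDef) :
    laplacian σ f y = ∑ l, hessUp σ f l l y := by
  simp_rw [laplacian, hessUp]
  rw [Finset.sum_comm]
  exact Finset.sum_congr rfl fun i _ => Finset.sum_congr rfl fun j _ => by
    rw [h.inv.apply_comm i j]

theorem sum_rotate {ι : Type*} [Fintype ι] (F : ι → ι → ι → ℝ) :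
    ∑ a, ∑ b, ∑ c, F a b c = ∑ b, ∑ c, ∑ a, F a b c := by
  rw [Finset.sum_comm]
  exact Finset.sum_congr rfl fun _ _ => Finset.sum_comm

theorem IsMetricOn.hessNormSq_eq_sum_hessUp (hσ : IsMetricOn σ Ω) (hf : ContDiffAt ℝ 2 f y)
    (hy : y ∈ Ω) :
    hessNormSq σ f y = ∑ k, ∑ l, hessUp σ f k l y * hessUp σ f l k y := by
  simp_rw [hessNormSq, hessUp, Finset.sum_mul_sum]
  refine Finset.sum_congr rfl fun a _ => ?_
  rw [← sum_rotate]
  refine Finset.sum_congr rfl fun d _ => Finset.sum_congr rfl fun b _ =>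
    Finset.sum_congr rfl fun c _ => ?_
  rw [(hσ.posDef y hy).inv.apply_comm b d, hσ.hessian_comm hf hy a b]
  ring

/-- The algebra behind the Bochner formula: commuting two covariant derivatives of the vector `p`
with `∇p = S`, `∂p = D`, Christoffel symbols `Γ` and their derivatives `E`, at a point where
`∇_p p = 0`. -/
theorem bochner_algebra (p : Fin n → ℝ) (D S : Fin n → Fin n → ℝ)
    (Γ : Fin n → Fin n → Fin n → ℝ) (E : Fin n → Fin n → Fin n → Fin n → ℝ)
    (hΓ : ∀ c a b, Γ c a b = Γ c b a) (hD : ∀ k l, D k l = S k l - ∑ m, Γ l k m * p m)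
    (hcrit : ∀ l, ∑ k, p k * S k l = 0) :
    ∑ l, ∑ k, D l k * S k l + ∑ k, p k * ∑ l, ∑ m, ((E l l k m - E k l l m) * p m
        + Γ l k m * D l m - Γ l l m * D k m)
      = ∑ k, ∑ l, S k l * S l k + ∑ k, ∑ m, (∑ l, (E l l k m - E k l l m
        + ∑ e, (Γ l l e * Γ e k m - Γ l k e * Γ e l m))) * p k * p m := by
  have a1 : ∑ l, ∑ k, D l k * S k l
      = ∑ k, ∑ l, S k l * S l k - ∑ k, ∑ l, ∑ m, p k * Γ l k m * S l m := by
    simp_rw [hD, sub_mul, Finset.sum_sub_distrib, Finset.sum_mul]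
    congr 1
    rw [sum_rotate, Finset.sum_comm]
    refine Finset.sum_congr rfl fun m _ => Finset.sum_congr rfl fun k _ =>
      Finset.sum_congr rfl fun l _ => ?_
    rw [hΓ k l m]; ring
  have a2 : ∑ k, ∑ l, ∑ m, p k * Γ l k m * D l m
      = ∑ k, ∑ l, ∑ m, p k * Γ l k m * S l m
        - ∑ k, ∑ l, ∑ m, ∑ e, p k * Γ l k e * Γ e l m * p m := by
    simp_rw [hD, mul_sub, Finset.sum_sub_distrib, Finset.mul_sum]
    congr 1
    refine Finset.sum_congr rfl fun k _ => Finset.sum_congr rfl fun l _ => ?_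
    rw [Finset.sum_comm]
    exact Finset.sum_congr rfl fun m _ => Finset.sum_congr rfl fun e _ => by ring
  have a3 : ∑ k, ∑ l, ∑ m, p k * Γ l l m * D k m
      = - ∑ k, ∑ l, ∑ m, ∑ e, p k * Γ l l e * Γ e k m * p m := by
    have h0 : ∑ k, ∑ l, ∑ m, p k * Γ l l m * S k m = 0 := by
      rw [sum_rotate]
      refine Finset.sum_eq_zero fun l _ => Finset.sum_eq_zero fun m _ => ?_
      rw [← mul_zero (Γ l l m), ← hcrit m, Finset.mul_sum]
      exact Finset.sum_congr rfl fun k _ => by ring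
    simp_rw [hD, mul_sub, Finset.sum_sub_distrib, Finset.mul_sum]
    rw [h0, zero_sub]
    congr 1
    refine Finset.sum_congr rfl fun k _ => Finset.sum_congr rfl fun l _ => ?_
    rw [Finset.sum_comm]
    exact Finset.sum_congr rfl fun m _ => Finset.sum_congr rfl fun e _ => by ring
  have a4 : ∑ k, p k * ∑ l, ∑ m, ((E l l k m - E k l l m) * p m
        + Γ l k m * D l m - Γ l l m * D k m)
      = ∑ k, ∑ l, ∑ m, p k * (E l l k m - E k l l m) * p m
        + ∑ k, ∑ l, ∑ m, p k * Γ l k m * D l m - ∑ k, ∑ l, ∑ m, p k * Γ l l m * D k m := by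
    simp_rw [Finset.mul_sum, ← Finset.sum_add_distrib, ← Finset.sum_sub_distrib]
    exact Finset.sum_congr rfl fun k _ => Finset.sum_congr rfl fun l _ =>
      Finset.sum_congr rfl fun m _ => by ring
  have a5 : ∑ k, ∑ m, (∑ l, (E l l k m - E k l l m
        + ∑ e, (Γ l l e * Γ e k m - Γ l k e * Γ e l m))) * p k * p m
      = ∑ k, ∑ l, ∑ m, p k * (E l l k m - E k l l m) * p m
        + (∑ k, ∑ l, ∑ m, ∑ e, p k * Γ l l e * Γ e k m * p m
        - ∑ k, ∑ l, ∑ m, ∑ e, p k * Γ l k e * Γ e l m * p m) := by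
    simp_rw [← Finset.sum_sub_distrib, ← Finset.sum_add_distrib, Finset.sum_mul]
    refine Finset.sum_congr rfl fun k _ => ?_
    rw [Finset.sum_comm]
    refine Finset.sum_congr rfl fun l _ => Finset.sum_congr rfl fun m _ => ?_
    rw [add_mul, add_mul, Finset.sum_mul, Finset.sum_mul]
    congr 1
    · ring
    · exact Finset.sum_congr rfl fun e _ => by ring
  rw [a4, a5, a1, a2, a3]
  ring

/-- The Bochner formula `½ Δ|∇f|² = |D²f|² + ⟨∇f, ∇Δf⟩ + Ric(∇f, ∇f)` at a critical point
of `|∇f|²`. -/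
theorem IsMetricOn.bochner (hσ : IsMetricOn σ Ω) (hf : ContDiffOn ℝ ∞ f Ω) (hy : y ∈ Ω)
    (hcrit : ∀ k, pd k (gradNormSq σ f) y = 0) :
    (1 / 2) * ∑ k, ∑ l, (σ y)⁻¹ k l * pd k (pd l (gradNormSq σ f)) y
      = hessNormSq σ f y + ∑ k, gradVec σ f k y * pd k (laplacian σ f) y
        + ∑ i, ∑ j, ricci σ i j y * gradVec σ f i y * gradVec σ f j y := by
  have hc2 : ∀ z ∈ Ω, ContDiffAt ℝ 2 f z := fun z hz =>
    (hf.contDiffAt (hσ.isOpen.mem_nhds hz)).of_le (WithTop.coe_le_coe.2 le_top)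
  have hpos := hσ.posDef y hy
  have dAt : ∀ {g : Eucl n → ℝ}, ContDiffOn ℝ ∞ g Ω → DifferentiableAt ℝ g y := fun hg =>
    ContDiffOn.differentiableAt_of_isOpen hg hσ.isOpen hy
  have sP := hσ.contDiffOn_gradVec hf
  have sS := hσ.contDiffOn_hessUp hf
  have sΓ := hσ.contDiffOn_christoffel
  -- `∇_P P = ½ ∇|P|²` for the gradient field `P`
  have hQ : ∀ l, ∀ z ∈ Ω, ∑ k, gradVec σ f k z * hessUp σ f k l z
      = ∑ i, (1 / 2) * ((σ z)⁻¹ l i * pd i (gradNormSq σ f) z) := by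
    intro l z hz
    simp_rw [hσ.pd_gradNormSq hf hz, hessUp, Finset.mul_sum]
    rw [Finset.sum_comm]
    exact Finset.sum_congr rfl fun i _ => Finset.sum_congr rfl fun j _ => by ring
  have hcrit' : ∀ l, ∑ k, gradVec σ f k y * hessUp σ f k l y = 0 := by
    intro l; rw [hQ l y hy]; simp [hcrit]
  have hL : ∀ l, pd l (fun z => ∑ i, (1 / 2) * ((σ z)⁻¹ l i * pd i (gradNormSq σ f) z)) y
      = (1 / 2) * ∑ i, (σ y)⁻¹ l i * pd l (pd i (gradNormSq σ f)) y := by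
    intro l
    have d1 : ∀ i, DifferentiableAt ℝ (fun z => (σ z)⁻¹ l i) y := fun i =>
      dAt (hσ.contDiffOn_inv l i)
    have d2 : ∀ i, DifferentiableAt ℝ (pd i (gradNormSq σ f)) y := fun i =>
      dAt (contDiffOn_pd hσ.isOpen (hσ.contDiffOn_gradNormSq hf) i)
    rw [pd_sum fun i _ => (((d1 i).fun_mul (d2 i)).const_mul _), Finset.mul_sum]
    refine Finset.sum_congr rfl fun i _ => ?_
    rw [pd_mul (differentiableAt_const _) ((d1 i).fun_mul (d2 i)), pd_mul (d1 i) (d2 i), hcrit,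
      pd_const]
    ring
  have hR : ∀ l, pd l (fun z => ∑ k, gradVec σ f k z * hessUp σ f k l z) y
      = ∑ k, (pd l (gradVec σ f k) y * hessUp σ f k l y
          + gradVec σ f k y * pd l (hessUp σ f k l) y) := by
    intro l
    rw [pd_sum fun k _ => (dAt (sP k)).fun_mul (dAt (sS k l))]
    exact Finset.sum_congr rfl fun k _ => pd_mul (dAt (sP k)) (dAt (sS k l)) l
  have hdS : ∀ a k l, pd a (hessUp σ f k l) y = pd a (pd k (gradVec σ f l)) y
      + ∑ m, (pd a (christoffel σ l k m) y * gradVec σ f m y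
        + christoffel σ l k m y * pd a (gradVec σ f m) y) := by
    intro a k l
    rw [pd_congr_on hσ.isOpen (fun z hz => hσ.hessUp_eq hf hz k l) hy a,
      pd_add (dAt (contDiffOn_pd hσ.isOpen (sP l) k))
        (dAt (ContDiffOn.sum fun m _ => (sΓ l k m).mul (sP m))),
      pd_sum fun m _ => (dAt (sΓ l k m)).fun_mul (dAt (sP m))]
    congr 1
    exact Finset.sum_congr rfl fun m _ => pd_mul (dAt (sΓ l k m)) (dAt (sP m)) a
  have hlap : ∀ k, pd k (laplacian σ f) y = ∑ l, pd k (hessUp σ f l l) y := by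
    intro k
    rw [pd_congr_on hσ.isOpen (fun z hz => laplacian_eq_sum_hessUp (f := f) (hσ.posDef z hz)) hy k,
      pd_sum fun l _ => dAt (sS l l)]
  -- commuting the covariant derivatives; the missing quadratic terms of the Ricci tensor are
  -- recovered in `bochner_algebra`
  have hcomm : ∀ k, ∑ l, pd l (hessUp σ f k l) y = pd k (laplacian σ f) y
      + ∑ l, ∑ m, ((pd l (christoffel σ l k m) y - pd k (christoffel σ l l m) y) * gradVec σ f m y
        + christoffel σ l k m y * pd l (gradVec σ f m) y
        - christoffel σ l l m y * pd k (gradVec σ f m) y) := by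
    intro k
    rw [hlap, ← Finset.sum_add_distrib]
    refine Finset.sum_congr rfl fun l _ => ?_
    rw [hdS, hdS, IMCF.pd_comm (((sP l).contDiffAt (hσ.isOpen.mem_nhds hy)).of_le
      (WithTop.coe_le_coe.2 le_top)) l k, add_assoc, ← Finset.sum_add_distrib]
    congr 1
    exact Finset.sum_congr rfl fun m _ => by ring
  have hmain : (1 / 2) * ∑ k, ∑ l, (σ y)⁻¹ k l * pd k (pd l (gradNormSq σ f)) y
      = ∑ l, ∑ k, pd l (gradVec σ f k) y * hessUp σ f k l y
        + ∑ k, gradVec σ f k y * ∑ l, pd l (hessUp σ f k l) y := by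
    rw [Finset.mul_sum]
    simp_rw [← hL, ← fun l => pd_congr_on hσ.isOpen (hQ l) hy l, hR, Finset.sum_add_distrib]
    congr 1
    rw [Finset.sum_comm]
    simp_rw [Finset.mul_sum]
  rw [hmain]
  simp_rw [hcomm, mul_add, Finset.sum_add_distrib]
  have halg := bochner_algebra (fun k => gradVec σ f k y) (fun l k => pd l (gradVec σ f k) y)
    (fun k l => hessUp σ f k l y) (fun c a b => christoffel σ c a b y)
    (fun a c d e => pd a (christoffel σ c d e) y) (hσ.christoffel_comm hy)
    (fun k l => by rw [hσ.hessUp_eq hf hy]; ring) hcrit'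
  rw [hσ.hessNormSq_eq_sum_hessUp (hc2 y hy) hy]
  simp only [ricci, riemann]
  linarith [halg]

end Bochner

/-! ### The inner product of two-tensors -/

section Tensor

variable {n : ℕ} {σ : Eucl n → Matrix (Fin n) (Fin n) ℝ} {f : Eucl n → ℝ} {y : Eucl n}

/-- The inner product `Gⁱᵏ Gʲˡ A_{ij} B_{kl}` of two-tensors. -/
def tensorIp (G : Matrix (Fin n) (Fin n) ℝ) (A B : Fin n → Fin n → ℝ) : ℝ :=
  ∑ i, ∑ j, ∑ k, ∑ l, G i k * G j l * A i j * B k l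

/-- The components of tensors with respect to a system of vectors `v` with `G = ∑ v ⊗ v` turn
`tensorIp G` into a sum of products. -/
theorem exists_tensorIp_eq {G : Matrix (Fin n) (Fin n) ℝ} (hG : G.PosSemidef) :
    ∃ (m : ℕ) (v : Fin m → Fin n → ℝ), ∀ A B, tensorIp G A B
      = ∑ e : Fin m × Fin m, (∑ i, ∑ j, v e.1 i * v e.2 j * A i j)
          * ∑ k, ∑ l, v e.1 k * v e.2 l * B k l := by
  obtain ⟨m, v, rfl⟩ := Matrix.posSemidef_iff_eq_sum_vecMulVec.1 hG
  refine ⟨m, v, fun A B => ?_⟩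
  have h1 : ∀ e : Fin m × Fin m, (∑ i, ∑ j, v e.1 i * v e.2 j * A i j)
          * ∑ k, ∑ l, v e.1 k * v e.2 l * B k l
      = ∑ i, ∑ j, ∑ k, ∑ l, v e.1 i * v e.1 k * (v e.2 j * v e.2 l) * A i j * B k l := by
    intro e
    simp_rw [Finset.sum_mul, Finset.mul_sum]
    exact Finset.sum_congr rfl fun _ _ => Finset.sum_congr rfl fun _ _ =>
      Finset.sum_congr rfl fun _ _ => Finset.sum_congr rfl fun _ _ => by ring
  simp_rw [h1, tensorIp, Matrix.sum_apply, Matrix.vecMulVec_apply, star_trivial]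
  symm
  rw [Finset.sum_comm]
  refine Finset.sum_congr rfl fun i _ => ?_
  rw [Finset.sum_comm]
  refine Finset.sum_congr rfl fun j _ => ?_
  rw [Finset.sum_comm]
  refine Finset.sum_congr rfl fun k _ => ?_
  rw [Finset.sum_comm]
  refine Finset.sum_congr rfl fun l _ => ?_
  rw [Finset.sum_mul_sum, Fintype.sum_prod_type, Finset.sum_mul, Finset.sum_mul]
  exact Finset.sum_congr rfl fun _ _ => by rw [Finset.sum_mul, Finset.sum_mul]

theorem tensorIp_self_nonneg {G : Matrix (Fin n) (Fin n) ℝ} (hG : G.PosSemidef)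
    (A : Fin n → Fin n → ℝ) : 0 ≤ tensorIp G A A := by
  obtain ⟨m, v, h⟩ := exists_tensorIp_eq hG
  rw [h]
  exact Finset.sum_nonneg fun e _ => mul_self_nonneg _

theorem tensorIp_sq_le {G : Matrix (Fin n) (Fin n) ℝ} (hG : G.PosSemidef)
    (A B : Fin n → Fin n → ℝ) : tensorIp G A B ^ 2 ≤ tensorIp G A A * tensorIp G B B := by
  obtain ⟨m, v, h⟩ := exists_tensorIp_eq hG
  simp only [h, ← sq]
  exact Finset.sum_mul_sq_le_sq_mul_sq _ _ _

theorem hessNormSq_nonneg (h : (σ y).PosDef) : 0 ≤ hessNormSq σ f y :=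
  tensorIp_self_nonneg h.inv.posSemidef fun i j => hessian σ f i j y

/-- `Δf` is the inner product of `D²f` with the metric, whose norm is `√n`. -/
theorem abs_laplacian_le (h : (σ y).PosDef) :
    |laplacian σ f y| ≤ √n * √(hessNormSq σ f y) := by
  have hG : ∀ i j, ∑ k, ∑ l, (σ y)⁻¹ i k * (σ y)⁻¹ j l * σ y k l = (σ y)⁻¹ i j := by
    intro i j
    have h1 : (σ y)⁻¹ * σ y * (σ y)⁻¹ = (σ y)⁻¹ := by
      rw [Matrix.nonsing_inv_mul _ h.isUnit_det', one_mul]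
    conv_rhs => rw [← h1]
    simp_rw [Matrix.mul_apply, Finset.sum_mul]
    rw [Finset.sum_comm]
    exact Finset.sum_congr rfl fun l _ => Finset.sum_congr rfl fun k _ => by
      rw [h.inv.apply_comm j l]; ring
  have e : ∀ A : Fin n → Fin n → ℝ, tensorIp (σ y)⁻¹ A (fun i j => σ y i j)
      = ∑ i, ∑ j, (σ y)⁻¹ i j * A i j := by
    intro A
    unfold tensorIp
    refine Finset.sum_congr rfl fun i _ => Finset.sum_congr rfl fun j _ => ?_
    rw [← hG i j]
    simp_rw [Finset.sum_mul]
    exact Finset.sum_congr rfl fun _ _ => Finset.sum_congr rfl fun _ _ => by ring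
  have h1 := tensorIp_sq_le h.inv.posSemidef (fun i j => hessian σ f i j y) (fun i j => σ y i j)
  rw [e, e, sum_inv_mul_metric h] at h1
  rw [← Real.sqrt_mul (by positivity)]
  refine Real.abs_le_sqrt ?_
  rw [mul_comm]
  exact h1

/-- `f_{ij} fⁱ fʲ` is the inner product of `D²f` with `Df ⊗ Df`, whose norm is `|Df|²`. -/
theorem abs_hessGrad_le (h : (σ y).PosDef) :
    |hessGrad σ f y| ≤ √(hessNormSq σ f y) * gradNormSq σ f y := by
  have e : ∀ A : Fin n → Fin n → ℝ, tensorIp (σ y)⁻¹ A (fun i j => pd i f y * pd j f y)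
      = ∑ i, ∑ j, A i j * gradVec σ f i y * gradVec σ f j y := by
    intro A
    simp_rw [tensorIp, gradVec, mul_assoc, Finset.sum_mul_sum, Finset.mul_sum]
    exact Finset.sum_congr rfl fun _ _ => Finset.sum_congr rfl fun _ _ =>
      Finset.sum_congr rfl fun _ _ => Finset.sum_congr rfl fun _ _ => by ring
  have h1 := tensorIp_sq_le h.inv.posSemidef (fun i j => hessian σ f i j y)
    (fun i j => pd i f y * pd j f y)
  have e2 : ∑ i, ∑ j, pd i f y * pd j f y * gradVec σ f i y * gradVec σ f j y
      = gradNormSq σ f y ^ 2 := by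
    rw [sq, gradNormSq_eq_sum, Finset.sum_mul_sum]
    exact Finset.sum_congr rfl fun _ _ => Finset.sum_congr rfl fun _ _ => by ring
  rw [e, e, e2] at h1
  rw [← Real.sqrt_sq (gradNormSq_nonneg h), ← Real.sqrt_mul (hessNormSq_nonneg h)]
  exact Real.abs_le_sqrt h1

end Tensor

/-! ### Graphs in logarithmic coordinates -/

section Log

variable {n : ℕ} {σ : Eucl n → Matrix (Fin n) (Fin n) ℝ} {f : Eucl n → ℝ} {y : Eucl n}

/-- The quantity `u v H` of the graph of `u`, in terms of `f = log u`:
`n - (σⁱʲ - fⁱ fʲ / (1 + |Df|²)) f_{ij}`. -/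
def graphOp (σ : Eucl n → Matrix (Fin n) (Fin n) ℝ) (f : Eucl n → ℝ) (y : Eucl n) : ℝ :=
  n - laplacian σ f y + hessGrad σ f y / (1 + gradNormSq σ f y)

theorem pd_pd_log (hf : ContDiffAt ℝ 2 f y) (h0 : f y ≠ 0) (i j : Fin n) :
    pd i (pd j fun z => Real.log (f z)) y
      = (f y)⁻¹ * pd i (pd j f) y - (f y)⁻¹ ^ 2 * (pd i f y * pd j f y) := by
  have h1 : pd j (fun z => Real.log (f z)) =ᶠ[nhds y] fun z => pd j f z / f z := by
    filter_upwards [hf.eventually (by simp), hf.continuousAt.eventually_ne h0] with z hz hz0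
    rw [pd_log (hz.differentiableAt (by norm_num)) hz0, inv_mul_eq_div]
  have hd : DifferentiableAt ℝ (pd j f) y := by
    have : DifferentiableAt ℝ (fderiv ℝ f) y :=
      (hf.fderiv_right (m := 1) (by norm_num)).differentiableAt (by norm_num)
    exact this.clm_apply (differentiableAt_const _)
  rw [pd_congr h1, pd_div hd (hf.differentiableAt (by norm_num)) h0]
  field_simp

theorem hessian_log (hf : ContDiffAt ℝ 2 f y) (h0 : f y ≠ 0) (i j : Fin n) :
    hessian σ (fun z => Real.log (f z)) i j y
      = (f y)⁻¹ * hessian σ f i j y - (f y)⁻¹ ^ 2 * (pd i f y * pd j f y) := by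
  simp_rw [hessian, pd_pd_log hf h0, pd_log (hf.differentiableAt (by norm_num)) h0]
  rw [mul_sub, Finset.mul_sum]
  have : ∀ k, christoffel σ k i j y * ((f y)⁻¹ * pd k f y)
    = (f y)⁻¹ * (christoffel σ k i j y * pd k f y) := fun k => by ring
  simp_rw [this]
  ring

theorem gradVec_log (hf : DifferentiableAt ℝ f y) (h0 : f y ≠ 0) (k : Fin n) :
    gradVec σ (fun z => Real.log (f z)) k y = (f y)⁻¹ * gradVec σ f k y := by
  simp_rw [gradVec, pd_log hf h0, Finset.mul_sum]
  exact Finset.sum_congr rfl fun _ _ => by ring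

theorem gradNormSq_log (hf : DifferentiableAt ℝ f y) (h0 : f y ≠ 0) :
    gradNormSq σ (fun z => Real.log (f z)) y = (f y)⁻¹ ^ 2 * gradNormSq σ f y := by
  simp_rw [gradNormSq_eq_sum, gradVec_log hf h0, pd_log hf h0, Finset.mul_sum]
  exact Finset.sum_congr rfl fun _ _ => by ring

theorem slant_eq_log (hf : DifferentiableAt ℝ f y) (h0 : f y ≠ 0) :
    slant σ f y = √(1 + gradNormSq σ (fun z => Real.log (f z)) y) := by
  rw [slant, gradNormSq_log hf h0]

theorem laplacian_log (hf : ContDiffAt ℝ 2 f y) (h0 : f y ≠ 0) :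
    laplacian σ (fun z => Real.log (f z)) y
      = (f y)⁻¹ * laplacian σ f y - (f y)⁻¹ ^ 2 * gradNormSq σ f y := by
  simp_rw [laplacian, gradNormSq, hessian_log hf h0, Finset.mul_sum, ← Finset.sum_sub_distrib]
  exact Finset.sum_congr rfl fun _ _ => Finset.sum_congr rfl fun _ _ => by ring

theorem hessGrad_log (hf : ContDiffAt ℝ 2 f y) (h0 : f y ≠ 0) :
    hessGrad σ (fun z => Real.log (f z)) y
      = (f y)⁻¹ ^ 3 * hessGrad σ f y - (f y)⁻¹ ^ 4 * gradNormSq σ f y ^ 2 := by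
  rw [gradNormSq_eq_sum, sq (∑ i, pd i f y * gradVec σ f i y), Finset.sum_mul_sum]
  simp_rw [hessGrad, gradVec_log (hf.differentiableAt (by norm_num)) h0, hessian_log hf h0,
    Finset.mul_sum, ← Finset.sum_sub_distrib]
  exact Finset.sum_congr rfl fun _ _ => Finset.sum_congr rfl fun _ _ => by ring

theorem meanCurv_eq_graphOp (h : (σ y).PosDef)
    (hσ : ∀ i j, DifferentiableAt ℝ (fun z => σ z i j) y) (hf : ContDiffAt ℝ 2 f y)
    (h0 : f y ≠ 0) :
    meanCurv (warped σ) (graphMap f) (graphNormal σ f y) y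
      = graphOp σ (fun z => Real.log (f z)) y / (f y * slant σ f y) := by
  have hq := gradNormSq_nonneg (f := f) h
  have hpos : f y ^ 2 + gradNormSq σ f y ≠ 0 := by positivity
  have hs : slant σ f y ≠ 0 := (Real.sqrt_pos.2 (by positivity)).ne'
  have e : 1 + (f y)⁻¹ ^ 2 * gradNormSq σ f y = (f y ^ 2 + gradNormSq σ f y) / f y ^ 2 := by
    field_simp
  rw [meanCurv_graph h hσ h0, graphOp, gradNormSq_log (hf.differentiableAt (by norm_num)) h0,
    laplacian_log hf h0, hessGrad_log hf h0, e]
  field_simp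
  ring

theorem ip_radial_graphNormal (a : ℝ) :
    ip (warped σ) (graphMap f y) (Fin.cons a fun _ => 0) (graphNormal σ f y)
      = a / slant σ f y := by
  rw [ip_warped]
  simp [graphNormal, div_eq_mul_inv]

/-- The matrix `σᵏˡ - fᵏ fˡ / (1 + |Df|²)` of the leading coefficients of the linearized flow is
positive semidefinite. -/
theorem posSemidef_tilted (h : (σ y).PosDef) :
    (Matrix.of fun k l => (σ y)⁻¹ k l
      - gradVec σ f k y * gradVec σ f l y / (1 + gradNormSq σ f y)).PosSemidef := by
  have hq := gradNormSq_nonneg (f := f) h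
  refine Matrix.PosSemidef.of_dotProduct_mulVec_nonneg ?_ fun X => ?_
  · ext k l
    simp [h.inv.apply_comm l k, mul_comm]
  set Y := ∑ k, X k * gradVec σ f k y with hY
  set q := gradNormSq σ f y with hq'
  -- positivity of `σⁱʲ` on this covector gives `σ(X, X) ≥ 2 Y² / (1 + q) - q Y² / (1 + q)²`
  have h1 := h.inv.posSemidef.dotProduct_mulVec_nonneg
    (fun k => X k - Y / (1 + q) * pd k f y)
  have hsym : ∑ k, pd k f y * ∑ l, (σ y)⁻¹ k l * X l = Y := by
    simp_rw [hY, gradVec, Finset.mul_sum]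
    rw [Finset.sum_comm]
    exact Finset.sum_congr rfl fun l _ => Finset.sum_congr rfl fun k _ => by
      rw [h.inv.apply_comm k l]; ring
  have hG : ∀ k, ∑ l, (σ y)⁻¹ k l * (X l - Y / (1 + q) * pd l f y)
      = ∑ l, (σ y)⁻¹ k l * X l - Y / (1 + q) * gradVec σ f k y := by
    intro k
    simp_rw [gradVec, mul_sub, Finset.sum_sub_distrib, Finset.mul_sum]
    congr 1
    exact Finset.sum_congr rfl fun l _ => by ring
  simp only [dotProduct, Matrix.mulVec, star_trivial, Pi.star_apply] at h1 ⊢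
  simp_rw [hG, sub_mul, mul_sub, Finset.sum_sub_distrib] at h1
  have e1 : ∑ k, Y / (1 + q) * pd k f y * ∑ l, (σ y)⁻¹ k l * X l = Y / (1 + q) * Y := by
    rw [← hsym, Finset.mul_sum]
    simp_rw [hsym]
    exact Finset.sum_congr rfl fun _ _ => by ring
  have e2 : ∑ k, X k * (Y / (1 + q) * gradVec σ f k y) = Y / (1 + q) * Y := by
    rw [Finset.mul_sum]
    exact Finset.sum_congr rfl fun _ _ => by ring
  have e3 : ∑ k, Y / (1 + q) * pd k f y * (Y / (1 + q) * gradVec σ f k y)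
      = (Y / (1 + q)) ^ 2 * q := by
    rw [hq', gradNormSq_eq_sum, Finset.mul_sum]
    exact Finset.sum_congr rfl fun _ _ => by ring
  rw [e1, e2, e3] at h1
  have hgoal : ∑ k, X k * ∑ l, Matrix.of (fun k l => (σ y)⁻¹ k l
      - gradVec σ f k y * gradVec σ f l y / (1 + q)) k l * X l
      = ∑ k, X k * ∑ l, (σ y)⁻¹ k l * X l - Y ^ 2 / (1 + q) := by
    have e4 : Y ^ 2 / (1 + q) = ∑ k, X k * ∑ l, gradVec σ f k y * gradVec σ f l y / (1 + q) * X l := by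
      rw [sq, hY, Finset.sum_mul_sum, Finset.sum_div]
      simp_rw [Finset.sum_div, Finset.mul_sum]
      exact Finset.sum_congr rfl fun _ _ => Finset.sum_congr rfl fun _ _ => by ring
    rw [e4]
    simp_rw [Matrix.of_apply, sub_mul, Finset.sum_sub_distrib, mul_sub, Finset.sum_sub_distrib]
  rw [hgoal]
  have h2 : (Y / (1 + q)) ^ 2 * q ≤ Y ^ 2 / (1 + q) := by
    rw [div_pow, div_mul_eq_mul_div, div_le_div_iff₀ (by positivity) (by positivity)]
    nlinarith [mul_nonneg (sq_nonneg Y) hq, sq_nonneg Y]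
  have h3 : Y / (1 + q) * Y = Y ^ 2 / (1 + q) := by ring
  linarith

end Log

/-! ### Evolution equations -/

section Evolution

variable {n : ℕ} {σ : Eucl n → Matrix (Fin n) (Fin n) ℝ} {I : Set ℝ} {Ω : Set (Eucl n)}
  {f : ℝ → Eucl n → ℝ} {t : ℝ} {y : Eucl n}

theorem pd_eq_zero_of_isLocalExtr {g : Eucl n → ℝ} (h : IsLocalExtr g y) (i : Fin n) :
    pd i g y = 0 := by
  rw [pd, h.fderiv_eq_zero]; rfl

theorem hessian_of_critical {g : Eucl n → ℝ} (h : ∀ i, pd i g y = 0) (i j : Fin n) :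
    hessian σ g i j y = pd i (pd j g) y := by
  simp [hessian, h]

theorem gradVec_of_critical {g : Eucl n → ℝ} (h : ∀ i, pd i g y = 0) (k : Fin n) :
    gradVec σ g k y = 0 := by
  simp [gradVec, h]

theorem graphOp_of_critical {g : Eucl n → ℝ} (h : ∀ i, pd i g y = 0) :
    graphOp σ g y = n - ∑ i, ∑ j, (σ y)⁻¹ i j * pd i (pd j g) y := by
  simp [graphOp, hessGrad, laplacian, gradVec_of_critical h, hessian_of_critical h]

theorem le_graphOp_of_isLocalMax {g : Eucl n → ℝ} (hσ : (σ y).PosDef) (hg : ContDiffAt ℝ 2 g y)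
    (h : IsLocalMax g y) : n ≤ graphOp σ g y := by
  rw [graphOp_of_critical (pd_eq_zero_of_isLocalExtr h.isExtr)]
  linarith [sum_mul_pd_pd_nonpos hg h hσ.inv.posSemidef]

theorem pd_neg {g : Eucl n → ℝ} (i : Fin n) : pd i (fun z => -g z) = fun z => -pd i g z := by
  ext z; simp [pd, fderiv_fun_neg]

theorem sum_mul_pd_pd_nonneg {g : Eucl n → ℝ} (hg : ContDiffAt ℝ 2 g y)
    (h : IsLocalMin g y) {A : Matrix (Fin n) (Fin n) ℝ} (hA : A.PosSemidef) :
    0 ≤ ∑ k, ∑ l, A k l * pd k (pd l g) y := by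
  have := sum_mul_pd_pd_nonpos hg.neg h.neg hA
  simp only [pd_neg, mul_neg, Finset.sum_neg_distrib] at this
  linarith

theorem graphOp_le_of_isLocalMin {g : Eucl n → ℝ} (hσ : (σ y).PosDef) (hg : ContDiffAt ℝ 2 g y)
    (h : IsLocalMin g y) : graphOp σ g y ≤ n := by
  rw [graphOp_of_critical (pd_eq_zero_of_isLocalExtr h.isExtr)]
  linarith [sum_mul_pd_pd_nonneg hg h hσ.inv.posSemidef]

/-- The time derivative of `f`. -/
def speed (f : ℝ → Eucl n → ℝ) (t : ℝ) (z : Eucl n) : ℝ := deriv (fun s => f s z) t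

/-- `f` solves the evolution equation `∂ₜf = v² / (u v H)` of `f = log u` on `I × Ω`. -/
structure IsLogFlowOn (σ : Eucl n → Matrix (Fin n) (Fin n) ℝ) (f : ℝ → Eucl n → ℝ) (I : Set ℝ)
    (Ω : Set (Eucl n)) : Prop where
  isOpen : IsOpen I
  metric : IsMetricOn σ Ω
  smooth : SmoothOn f I Ω
  graphOp_pos : ∀ t ∈ I, ∀ z ∈ Ω, 0 < graphOp σ (f t) z
  deriv_eq : ∀ t ∈ I, ∀ z ∈ Ω,
    speed f t z = (1 + gradNormSq σ (f t) z) / graphOp σ (f t) z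

namespace IsLogFlowOn

variable (hf : IsLogFlowOn σ f I Ω) (ht : t ∈ I) (hy : y ∈ Ω)

include hf

theorem smooth_speed : SmoothOn (speed f) I Ω := hf.smooth.deriv hf.isOpen hf.metric.isOpen

include ht hy

theorem hasDerivAt_pd (i : Fin n) :
    HasDerivAt (fun s => pd i (f s) y) (pd i (speed f t) y) t :=
  hf.smooth.hasDerivAt_pd hf.isOpen hf.metric.isOpen ht hy i

theorem hasDerivAt_gradVec (k : Fin n) :
    HasDerivAt (fun s => gradVec σ (f s) k y) (gradVec σ (speed f t) k y) t := by
  unfold gradVec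
  exact HasDerivAt.fun_sum fun l _ => (hf.hasDerivAt_pd ht hy l).const_mul _

theorem hasDerivAt_hessian (i j : Fin n) :
    HasDerivAt (fun s => hessian σ (f s) i j y) (hessian σ (speed f t) i j y) t := by
  unfold hessian
  exact (hf.smooth.hasDerivAt_pd_pd hf.isOpen hf.metric.isOpen ht hy i j).fun_sub
    (HasDerivAt.fun_sum fun k _ => (hf.hasDerivAt_pd ht hy k).const_mul _)

theorem hasDerivAt_laplacian :
    HasDerivAt (fun s => laplacian σ (f s) y) (laplacian σ (speed f t) y) t := by
  unfold laplacian
  exact HasDerivAt.fun_sum fun i _ => HasDerivAt.fun_sum fun j _ =>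
    (hf.hasDerivAt_hessian ht hy i j).const_mul _

theorem hasDerivAt_gradNormSq :
    HasDerivAt (fun s => gradNormSq σ (f s) y)
      (2 * ∑ i, gradVec σ (f t) i y * pd i (speed f t) y) t := by
  have h : HasDerivAt (fun s => ∑ i, pd i (f s) y * gradVec σ (f s) i y)
      (∑ i, (pd i (speed f t) y * gradVec σ (f t) i y
        + pd i (f t) y * gradVec σ (speed f t) i y)) t :=
    HasDerivAt.fun_sum fun i _ =>
      (hf.hasDerivAt_pd ht hy i).fun_mul (hf.hasDerivAt_gradVec ht hy i)
  simp only [gradNormSq_eq_sum]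
  convert h using 1
  have : ∑ i, pd i (f t) y * gradVec σ (speed f t) i y
      = ∑ i, gradVec σ (f t) i y * pd i (speed f t) y := by
    simp_rw [gradVec, Finset.mul_sum, Finset.sum_mul]
    rw [Finset.sum_comm]
    exact Finset.sum_congr rfl fun i _ => Finset.sum_congr rfl fun j _ => by
      rw [(hf.metric.posDef y hy).inv.apply_comm j i]; ring
  rw [Finset.sum_add_distrib, this, two_mul]
  congr 1
  exact Finset.sum_congr rfl fun _ _ => by ring

/-- At a spatially critical point of `w = ∂ₜf` the first order terms of its evolution equation
vanish: `∂ₜw = v² (u v H)⁻² (σᵏˡ - fᵏ fˡ / v²) w_{kl}`. -/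
theorem hasDerivAt_speed (hcrit : ∀ i, pd i (speed f t) y = 0) :
    HasDerivAt (fun s => speed f s y)
      ((1 + gradNormSq σ (f t) y) / graphOp σ (f t) y ^ 2 *
        ∑ k, ∑ l, Matrix.of (fun k l => (σ y)⁻¹ k l - gradVec σ (f t) k y * gradVec σ (f t) l y
          / (1 + gradNormSq σ (f t) y)) k l * pd k (pd l (speed f t)) y) t := by
  have hq := gradNormSq_nonneg (f := f t) (hf.metric.posDef y hy)
  have hF := (hf.graphOp_pos t ht y hy).ne'
  have dq := hf.hasDerivAt_gradNormSq ht hy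
  simp only [hcrit, mul_zero, Finset.sum_const_zero] at dq
  have dl := hf.hasDerivAt_laplacian ht hy
  have dP : ∀ k, HasDerivAt (fun s => gradVec σ (f s) k y) 0 t := fun k => by
    simpa only [gradVec_of_critical hcrit] using hf.hasDerivAt_gradVec ht hy k
  have dh : HasDerivAt (fun s => hessGrad σ (f s) y)
      (∑ i, ∑ j, pd i (pd j (speed f t)) y * gradVec σ (f t) i y * gradVec σ (f t) j y) t := by
    unfold hessGrad
    refine HasDerivAt.fun_sum fun i _ => HasDerivAt.fun_sum fun j _ => ?_
    have dA := hf.hasDerivAt_hessian ht hy i j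
    rw [hessian_of_critical hcrit] at dA
    simpa using (dA.fun_mul (dP i)).fun_mul (dP j)
  have dF : HasDerivAt (fun s => graphOp σ (f s) y)
      (-(∑ k, ∑ l, Matrix.of (fun k l => (σ y)⁻¹ k l - gradVec σ (f t) k y * gradVec σ (f t) l y
          / (1 + gradNormSq σ (f t) y)) k l * pd k (pd l (speed f t)) y)) t := by
    unfold graphOp
    refine ((dl.const_sub (n : ℝ)).fun_add
      (dh.fun_div (dq.const_add 1) (by positivity))).congr_deriv ?_
    simp only [laplacian, hessian_of_critical hcrit, mul_zero, sub_zero, Matrix.of_apply, sub_mul,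
      Finset.sum_sub_distrib]
    have : ∑ k, ∑ l, gradVec σ (f t) k y * gradVec σ (f t) l y / (1 + gradNormSq σ (f t) y)
        * pd k (pd l (speed f t)) y
        = (∑ i, ∑ j, pd i (pd j (speed f t)) y * gradVec σ (f t) i y * gradVec σ (f t) j y)
          / (1 + gradNormSq σ (f t) y) := by
      simp_rw [Finset.sum_div]
      exact Finset.sum_congr rfl fun _ _ => Finset.sum_congr rfl fun _ _ => by ring
    rw [this]
    field_simp
    ring
  have hev : (fun s => speed f s y) =ᶠ[nhds t]
      fun s => (1 + gradNormSq σ (f s) y) / graphOp σ (f s) y := by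
    filter_upwards [hf.isOpen.mem_nhds ht] with s hs using hf.deriv_eq s hs y hy
  refine HasDerivAt.congr_of_eventuallyEq ?_ hev
  refine ((dq.const_add 1).fun_div dF hF).congr_deriv ?_
  ring

theorem deriv_speed_nonpos (hmax : IsLocalMax (speed f t) y) :
    ∃ c ≤ 0, HasDerivAt (fun s => speed f s y) c t := by
  have hc : ContDiffAt ℝ 2 (speed f t) y :=
    ((hf.smooth_speed.contDiffOn ht).contDiffAt (hf.metric.isOpen.mem_nhds hy)).of_le
      (WithTop.coe_le_coe.2 le_top)
  refine ⟨_, ?_, hf.hasDerivAt_speed ht hy (pd_eq_zero_of_isLocalExtr hmax.isExtr)⟩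
  have hq := gradNormSq_nonneg (f := f t) (hf.metric.posDef y hy)
  exact mul_nonpos_of_nonneg_of_nonpos (by positivity)
    (sum_mul_pd_pd_nonpos hc hmax (posSemidef_tilted (hf.metric.posDef y hy)))

theorem deriv_speed_nonneg (hmin : IsLocalMin (speed f t) y) :
    ∃ c ≥ 0, HasDerivAt (fun s => speed f s y) c t := by
  have hc : ContDiffAt ℝ 2 (speed f t) y :=
    ((hf.smooth_speed.contDiffOn ht).contDiffAt (hf.metric.isOpen.mem_nhds hy)).of_le
      (WithTop.coe_le_coe.2 le_top)
  refine ⟨_, ?_, hf.hasDerivAt_speed ht hy (pd_eq_zero_of_isLocalExtr hmin.isExtr)⟩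
  have hq := gradNormSq_nonneg (f := f t) (hf.metric.posDef y hy)
  exact mul_nonneg (by positivity)
    (sum_mul_pd_pd_nonneg hc hmin (posSemidef_tilted (hf.metric.posDef y hy)))

/-- At a spatial maximum of `|Df|²` its time derivative is
`-2 v² (u v H)⁻² (|D²f|² + Ric(Df, Df) - ½ (σᵏˡ - fᵏ fˡ / v²) (|Df|²)_{kl})`, by the Bochner
formula, and each of the three terms has a sign. -/
theorem deriv_gradNormSq_nonpos (hmax : IsLocalMax (gradNormSq σ (f t)) y)
    (hric : ∀ X : Fin n → ℝ, 0 ≤ ∑ i, ∑ j, ricci σ i j y * X i * X j) :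
    ∃ c ≤ 0, HasDerivAt (fun s => gradNormSq σ (f s) y) c t := by
  refine ⟨_, ?_, hf.hasDerivAt_gradNormSq ht hy⟩
  have hpos := hf.metric.posDef y hy
  have hq := gradNormSq_nonneg (f := f t) hpos
  have hF := hf.graphOp_pos t ht y hy
  have hcf := hf.smooth.contDiffOn ht
  have hcrit := pd_eq_zero_of_isLocalExtr (g := gradNormSq σ (f t)) hmax.isExtr
  have dAt : ∀ {g : Eucl n → ℝ}, ContDiffOn ℝ ∞ g Ω → DifferentiableAt ℝ g y := fun hg =>
    ContDiffOn.differentiableAt_of_isOpen hg hf.metric.isOpen hy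
  have sq' := hf.metric.contDiffOn_gradNormSq hcf
  have hc2 : ContDiffAt ℝ 2 (gradNormSq σ (f t)) y :=
    (sq'.contDiffAt (hf.metric.isOpen.mem_nhds hy)).of_le (WithTop.coe_le_coe.2 le_top)
  have dq := dAt sq'
  have dl := dAt (hf.metric.contDiffOn_laplacian hcf)
  have dh := dAt (hf.metric.contDiffOn_hessGrad hcf)
  have dP := fun k => dAt (hf.metric.contDiffOn_gradVec hcf k)
  have h1q : 1 + gradNormSq σ (f t) y ≠ 0 := by positivity
  have d1q : DifferentiableAt ℝ (fun z => 1 + gradNormSq σ (f t) z) y := dq.const_add 1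
  have p1q : ∀ k, pd k (fun z => 1 + gradNormSq σ (f t) z) y = 0 := fun k => by
    rw [pd_add (differentiableAt_const _) dq, pd_const, hcrit, add_zero]
  -- `f_{ij} fⁱ fʲ = ½ fˡ (|Df|²)_l`
  have ph : ∀ k, pd k (hessGrad σ (f t)) y
      = (1 / 2) * ∑ l, gradVec σ (f t) l y * pd k (pd l (gradNormSq σ (f t))) y := by
    intro k
    have e : ∀ z ∈ Ω, hessGrad σ (f t) z
        = ∑ l, (1 / 2) * (gradVec σ (f t) l z * pd l (gradNormSq σ (f t)) z) := by
      intro z hz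
      simp_rw [hessGrad, hf.metric.pd_gradNormSq hcf hz, Finset.mul_sum]
      exact Finset.sum_congr rfl fun _ _ => Finset.sum_congr rfl fun _ _ => by ring
    have d2 : ∀ l, DifferentiableAt ℝ (pd l (gradNormSq σ (f t))) y := fun l =>
      dAt (contDiffOn_pd hf.metric.isOpen sq' l)
    rw [pd_congr_on hf.metric.isOpen e hy k,
      pd_sum fun l _ => ((dP l).fun_mul (d2 l)).const_mul _, Finset.mul_sum]
    refine Finset.sum_congr rfl fun l _ => ?_
    rw [pd_mul (differentiableAt_const _) ((dP l).fun_mul (d2 l)), pd_mul (dP l) (d2 l), hcrit,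
      pd_const]
    ring
  have dquot : DifferentiableAt ℝ
      (fun z => hessGrad σ (f t) z / (1 + gradNormSq σ (f t) z)) y := by
    simpa only [div_eq_mul_inv] using dh.fun_mul (d1q.fun_inv h1q)
  have dF : DifferentiableAt ℝ (graphOp σ (f t)) y := (dl.const_sub (n : ℝ)).fun_add dquot
  have pF : ∀ k, pd k (graphOp σ (f t)) y = - pd k (laplacian σ (f t)) y
      + pd k (hessGrad σ (f t)) y / (1 + gradNormSq σ (f t) y) := by
    intro k
    have e : graphOp σ (f t) = fun z => (n - laplacian σ (f t) z)
      + hessGrad σ (f t) z / (1 + gradNormSq σ (f t) z) := rfl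
    rw [e, pd_add (dl.const_sub _) dquot,
      pd_sub (differentiableAt_const _) dl, pd_const, pd_div dh d1q h1q, p1q]
    field_simp
    ring
  have pw : ∀ k, pd k (speed f t) y
      = -((1 + gradNormSq σ (f t) y) / graphOp σ (f t) y ^ 2) * pd k (graphOp σ (f t)) y := by
    intro k
    rw [pd_congr_on hf.metric.isOpen (fun z hz => hf.deriv_eq t ht z hz) hy k,
      pd_div d1q dF hF.ne', p1q]
    ring
  have hB := hf.metric.bochner hcf hy hcrit
  have htr := sum_mul_pd_pd_nonpos hc2 hmax (posSemidef_tilted (f := f t) hpos)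
  have key : ∑ i, gradVec σ (f t) i y * pd i (speed f t) y
      = -((1 + gradNormSq σ (f t) y) / graphOp σ (f t) y ^ 2) *
        (hessNormSq σ (f t) y
          + ∑ i, ∑ j, ricci σ i j y * gradVec σ (f t) i y * gradVec σ (f t) j y
          - (1 / 2) * ∑ k, ∑ l, Matrix.of (fun k l => (σ y)⁻¹ k l
            - gradVec σ (f t) k y * gradVec σ (f t) l y / (1 + gradNormSq σ (f t) y)) k l
              * pd k (pd l (gradNormSq σ (f t))) y) := by
    have e1 : ∑ i, gradVec σ (f t) i y * pd i (speed f t) y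
        = -((1 + gradNormSq σ (f t) y) / graphOp σ (f t) y ^ 2) *
          ∑ i, gradVec σ (f t) i y * pd i (graphOp σ (f t)) y := by
      rw [Finset.mul_sum]
      exact Finset.sum_congr rfl fun i _ => by rw [pw]; ring
    have e2 : ∑ i, gradVec σ (f t) i y * pd i (graphOp σ (f t)) y
        = - ∑ i, gradVec σ (f t) i y * pd i (laplacian σ (f t)) y
          + (1 / 2) * ∑ k, ∑ l, gradVec σ (f t) k y * gradVec σ (f t) l y
            / (1 + gradNormSq σ (f t) y) * pd k (pd l (gradNormSq σ (f t))) y := by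
      simp_rw [pF, ph, mul_add, Finset.sum_add_distrib, mul_neg, Finset.sum_neg_distrib]
      congr 1
      simp_rw [Finset.mul_sum, Finset.sum_div, Finset.mul_sum]
      exact Finset.sum_congr rfl fun i _ => Finset.sum_congr rfl fun j _ => by ring
    rw [e1, e2]
    simp_rw [Matrix.of_apply, sub_mul, Finset.sum_sub_distrib]
    congr 1
    linarith [hB]
  rw [key]
  have h1 : 0 ≤ (1 + gradNormSq σ (f t) y) / graphOp σ (f t) y ^ 2 := by positivity
  have h2 := hric fun k => gradVec σ (f t) k y
  have h3 := hessNormSq_nonneg (f := f t) hpos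
  nlinarith [mul_nonneg h1 (by linarith : 0 ≤ hessNormSq σ (f t) y
          + ∑ i, ∑ j, ricci σ i j y * gradVec σ (f t) i y * gradVec σ (f t) j y
          - (1 / 2) * ∑ k, ∑ l, Matrix.of (fun k l => (σ y)⁻¹ k l
            - gradVec σ (f t) k y * gradVec σ (f t) l y / (1 + gradNormSq σ (f t) y)) k l
              * pd k (pd l (gradNormSq σ (f t))) y)]

end IsLogFlowOn

end Evolution

/-! ### The maximum principle -/

/-- Maximum principle: if at positive times the time derivative is nonpositive at spatial maxima,
then the initial upper bound is preserved. -/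
theorem le_of_deriv_nonpos_at_max {M : Type*} [TopologicalSpace M] [CompactSpace M] {T K : ℝ}
    {Θ : ℝ → M → ℝ}
    (hc : ContinuousOn (fun q : ℝ × M => Θ q.1 q.2) (Set.Ico 0 T ×ˢ Set.univ))
    (h0 : ∀ p, Θ 0 p ≤ K)
    (hd : ∀ t ∈ Set.Ioo 0 T, ∀ p, (∀ p', Θ t p' ≤ Θ t p) →
      ∃ c ≤ 0, HasDerivAt (fun s => Θ s p) c t) {t : ℝ} (ht : t ∈ Set.Ico 0 T) (p : M) :
    Θ t p ≤ K := by
  refine le_of_forall_pos_le_add fun δ hδ => ?_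
  -- the slope `ε` makes the derivative strictly negative, at a cost of at most `δ` up to time `t`
  obtain ⟨ε, hε, hεt⟩ : ∃ ε > 0, ε * t ≤ δ :=
    ⟨δ / (t + 1), div_pos hδ (by linarith [ht.1]), by
      rw [div_mul_eq_mul_div, div_le_iff₀ (by linarith [ht.1])]; nlinarith [ht.1]⟩
  have hK : IsCompact (Set.Icc 0 t ×ˢ (Set.univ : Set M)) := isCompact_Icc.prod isCompact_univ
  have hsub : Set.Icc 0 t ×ˢ (Set.univ : Set M) ⊆ Set.Ico 0 T ×ˢ Set.univ :=
    Set.prod_mono (fun s hs => ⟨hs.1, hs.2.trans_lt ht.2⟩) le_rfl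
  have hcont : ContinuousOn (fun q : ℝ × M => Θ q.1 q.2 - ε * q.1)
      (Set.Icc 0 t ×ˢ Set.univ) :=
    (hc.mono hsub).sub (by fun_prop)
  obtain ⟨⟨t₁, p₁⟩, ⟨ht₁, -⟩, hmax⟩ :=
    hK.exists_isMaxOn ⟨(t, p), ⟨⟨ht.1, le_rfl⟩, trivial⟩⟩ hcont
  have hle : ∀ s ∈ Set.Icc 0 t, ∀ x, Θ s x - ε * s ≤ Θ t₁ p₁ - ε * t₁ :=
    fun s hs x => hmax (a := (s, x)) ⟨hs, trivial⟩
  have h1 := hle t ⟨ht.1, le_rfl⟩ p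
  rcases ht₁.1.eq_or_lt with h | h
  · subst h
    linarith [h0 p₁]
  · -- the derivative at `t₁` is at most `-ε`, so the function is larger slightly before `t₁`
    exfalso
    obtain ⟨c, hc0, hder⟩ := hd t₁ ⟨h, ht₁.2.trans_lt ht.2⟩ p₁ fun p' => by
      linarith [hle t₁ ht₁ p']
    have hder' : HasDerivAt (fun s => Θ s p₁ - ε * s) (c - ε) t₁ := by
      simpa using hder.fun_sub ((hasDerivAt_id t₁).const_mul ε)
    have hslope := (hasDerivAt_iff_tendsto_slope.1 hder').eventually
      (gt_mem_nhds (show c - ε < 0 by linarith))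
    have hleft : ∀ᶠ s in nhdsWithin t₁ (Set.Iio t₁), slope (fun s => Θ s p₁ - ε * s) t₁ s < 0 :=
      hslope.filter_mono (nhdsWithin_mono _ fun s hs => ne_of_lt hs)
    have hIoo : ∀ᶠ s in nhdsWithin t₁ (Set.Iio t₁), s ∈ Set.Ioo 0 t₁ :=
      Ioo_mem_nhdsLT h
    obtain ⟨s, hs, hs'⟩ := (hleft.and hIoo).exists
    have h2 := hle s ⟨hs'.1.le, hs'.2.le.trans ht₁.2⟩ p₁
    rw [slope_def_field, div_neg_iff] at hs
    rcases hs with hs | hs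
    · linarith [hs.1]
    · linarith [hs.2, hs'.2]

/-! ### Charts -/

section Charts

variable {n : ℕ} {M : Type*} [TopologicalSpace M] [ChartedSpace (Eucl n) M]
  [IsManifold 𝓘(ℝ, Eucl n) ∞ M] {σ : Metric n M} {x₀ p : M} {y : Eucl n}

theorem mdifferentiableAt_extChartAt_symm (hy : y ∈ (extChartAt 𝓘(ℝ, Eucl n) x₀).target) :
    MDifferentiableAt 𝓘(ℝ, Eucl n) 𝓘(ℝ, Eucl n) (extChartAt 𝓘(ℝ, Eucl n) x₀).symm y :=
  ((contMDiffOn_extChartAt_symm (n := ∞) x₀).contMDiffAt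
    ((isOpen_extChartAt_target x₀).mem_nhds hy)).mdifferentiableAt (by simp)

theorem isInvertible_mfderiv_extChartAt_symm (hy : y ∈ (extChartAt 𝓘(ℝ, Eucl n) x₀).target) :
    (mfderiv 𝓘(ℝ, Eucl n) 𝓘(ℝ, Eucl n)
      (extChartAt 𝓘(ℝ, Eucl n) x₀).symm y).IsInvertible := by
  have := isInvertible_mfderivWithin_extChartAt_symm (I := 𝓘(ℝ, Eucl n)) hy
  simpa [mfderivWithin_univ] using this

theorem contDiffOn_chartMetric (i j : Fin n) :
    ContDiffOn ℝ ∞ (fun z => chartMetric σ x₀ z i j) (extChartAt 𝓘(ℝ, Eucl n) x₀).target := by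
  intro y hy
  have hO := (isOpen_extChartAt_target (I := 𝓘(ℝ, Eucl n)) x₀)
  have hb : ContMDiffAt 𝓘(ℝ, Eucl n) 𝓘(ℝ, Eucl n) ∞ (extChartAt 𝓘(ℝ, Eucl n) x₀).symm y :=
    (contMDiffOn_extChartAt_symm x₀).contMDiffAt (hO.mem_nhds hy)
  have hv : ∀ k : Fin n, ContMDiffAt 𝓘(ℝ, Eucl n) (𝓘(ℝ, Eucl n).prod 𝓘(ℝ, Eucl n)) ∞
      (fun z => TotalSpace.mk' (Eucl n) (E := fun p : M => TangentSpace 𝓘(ℝ, Eucl n) p)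
        ((extChartAt 𝓘(ℝ, Eucl n) x₀).symm z)
        (mfderiv 𝓘(ℝ, Eucl n) 𝓘(ℝ, Eucl n) (extChartAt 𝓘(ℝ, Eucl n) x₀).symm z
          (EuclideanSpace.single k (1 : ℝ)))) y := by
    intro k
    -- the coordinate vector field is the image of a constant one under the tangent map
    have h1 : ContMDiffAt 𝓘(ℝ, Eucl n) (𝓘(ℝ, Eucl n).prod 𝓘(ℝ, Eucl n)) ∞
        (fun z => (⟨z, EuclideanSpace.single k (1 : ℝ)⟩ : TangentBundle 𝓘(ℝ, Eucl n) (Eucl n)))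
        y := by
      rw [contMDiffAt_totalSpace]
      refine ⟨contMDiffAt_id, ?_⟩
      simp
      exact contMDiffAt_const
    have h2 := (contMDiffOn_extChartAt_symm (n := ∞) (I := 𝓘(ℝ, Eucl n))
      x₀).contMDiffOn_tangentMapWithin (m := ∞) (by simp) hO.uniqueMDiffOn
    have h3 := (h2.contMDiffAt (x := ⟨y, EuclideanSpace.single k (1 : ℝ)⟩)
      ((hO.preimage (FiberBundle.continuous_proj (Eucl n) _)).mem_nhds hy)).comp y h1
    refine h3.congr_of_eventuallyEq ?_
    filter_upwards [hO.mem_nhds hy] with z hz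
    simp only [Function.comp_apply, tangentMapWithin, mfderivWithin_of_isOpen hO hz]
  have hφ := (σ.contMDiff.contMDiffAt (x := (extChartAt 𝓘(ℝ, Eucl n) x₀).symm y)).comp y hb
  have h : ContMDiffAt 𝓘(ℝ, Eucl n) (𝓘(ℝ, Eucl n).prod 𝓘(ℝ)) ∞
      (fun z => TotalSpace.mk' ℝ (E := Bundle.Trivial M ℝ) ((extChartAt 𝓘(ℝ, Eucl n) x₀).symm z)
        (chartMetric σ x₀ z i j)) y :=
    ContMDiffAt.clm_bundle_apply₂ (F₁ := Eucl n) (F₂ := Eucl n) hφ (hv i) (hv j)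
  rw [contMDiffAt_totalSpace] at h
  exact (h.2.contDiffAt).contDiffWithinAt

theorem eucl_eq_sum (X : Eucl n) : X = ∑ i, X i • EuclideanSpace.single i (1 : ℝ) := by
  ext i
  simp [Pi.single_apply]

theorem bilinear_eucl_eq_sum {V : Type*} [AddCommGroup V] [Module ℝ V] [TopologicalSpace V]
    (B : V →L[ℝ] V →L[ℝ] ℝ) (L : Eucl n →L[ℝ] V) (X Y : Eucl n) :
    B (L X) (L Y) = ∑ i, ∑ j, B (L (EuclideanSpace.single i 1)) (L (EuclideanSpace.single j 1))
      * X i * Y j := by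
  conv_lhs => rw [eucl_eq_sum X, eucl_eq_sum Y]
  simp only [map_sum, map_smul, FunLike.coe_sum, Finset.sum_apply, FunLike.coe_smul,
      Pi.smul_apply, smul_eq_mul, Finset.mul_sum]
  rw [Finset.sum_comm]
  exact Finset.sum_congr rfl fun i _ => Finset.sum_congr rfl fun j _ => by ring

/-- The metric of `M` evaluated on coordinate vectors. -/
theorem chartMetric_bilinear (X Y : Eucl n) :
    σ.inner ((extChartAt 𝓘(ℝ, Eucl n) x₀).symm y)
      (mfderiv 𝓘(ℝ, Eucl n) 𝓘(ℝ, Eucl n) (extChartAt 𝓘(ℝ, Eucl n) x₀).symm y X)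
      (mfderiv 𝓘(ℝ, Eucl n) 𝓘(ℝ, Eucl n) (extChartAt 𝓘(ℝ, Eucl n) x₀).symm y Y)
      = ∑ i, ∑ j, chartMetric σ x₀ y i j * X i * Y j := by
  exact bilinear_eucl_eq_sum (V := TangentSpace 𝓘(ℝ, Eucl n)
    ((extChartAt 𝓘(ℝ, Eucl n) x₀).symm y)) _
    (mfderiv 𝓘(ℝ, Eucl n) 𝓘(ℝ, Eucl n) (extChartAt 𝓘(ℝ, Eucl n) x₀).symm y) X Y

theorem chartMetric_posDef (hy : y ∈ (extChartAt 𝓘(ℝ, Eucl n) x₀).target) :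
    (chartMetric σ x₀ y).PosDef := by
  refine Matrix.PosDef.of_dotProduct_mulVec_pos ?_ fun X hX => ?_
  · ext i j
    exact σ.symm _ _ _
  set L := mfderiv 𝓘(ℝ, Eucl n) 𝓘(ℝ, Eucl n) (extChartAt 𝓘(ℝ, Eucl n) x₀).symm y with hL
  have hne : L (WithLp.toLp 2 X) ≠ 0 := by
    obtain ⟨e, he⟩ := isInvertible_mfderiv_extChartAt_symm hy
    intro h0
    rw [hL, ← he] at h0
    have h1 : (WithLp.toLp 2 X : Eucl n) = 0 := e.injective (h0.trans (map_zero e).symm)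
    exact hX (by ext i; simpa using congrArg (fun Z : Eucl n => Z i) h1)
  have h := σ.pos _ _ hne
  rw [hL, chartMetric_bilinear] at h
  simpa [dotProduct, Matrix.mulVec, Finset.mul_sum, mul_assoc, mul_comm, mul_left_comm] using h

end Charts

/-! ### Functions on the manifold in charts -/

section ChartFunctions

section

variable {n : ℕ} {M : Type*} [TopologicalSpace M] [ChartedSpace (Eucl n) M] {x₀ p : M}
  {f : M → ℝ}

theorem chartRep_extChartAt (hp : p ∈ (chartAt (Eucl n) x₀).source) :
    chartRep x₀ f (extChartAt 𝓘(ℝ, Eucl n) x₀ p) = f p := by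
  rw [chartRep, (extChartAt 𝓘(ℝ, Eucl n) x₀).left_inv (by rwa [extChartAt_source])]

theorem contMDiff_log_comp (hf : ContMDiff 𝓘(ℝ, Eucl n) 𝓘(ℝ, ℝ) 2 f) (hpos : ∀ p, 0 < f p) :
    ContMDiff 𝓘(ℝ, Eucl n) 𝓘(ℝ, ℝ) 2 fun p => Real.log (f p) := fun p =>
  ((Real.contDiffAt_log.2 (hpos p).ne').contMDiffAt).comp p (hf p)

theorem extChartAt_mem_target (hp : p ∈ (chartAt (Eucl n) x₀).source) :
    extChartAt 𝓘(ℝ, Eucl n) x₀ p ∈ (extChartAt 𝓘(ℝ, Eucl n) x₀).target :=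
  (extChartAt 𝓘(ℝ, Eucl n) x₀).map_source (by rwa [extChartAt_source])

end

variable {n : ℕ} {M : Type*} [TopologicalSpace M] [ChartedSpace (Eucl n) M]
  [IsManifold 𝓘(ℝ, Eucl n) ∞ M] {σ : Metric n M} {x₀ p : M} {y : Eucl n} {f : M → ℝ}

theorem isMetricOn_chartMetric :
    IsMetricOn (chartMetric σ x₀) (extChartAt 𝓘(ℝ, Eucl n) x₀).target :=
  ⟨isOpen_extChartAt_target x₀, contDiffOn_chartMetric, fun _ => chartMetric_posDef⟩

theorem contDiffAt_chartRep (hf : ContMDiff 𝓘(ℝ, Eucl n) 𝓘(ℝ, ℝ) 2 f)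
    (hy : y ∈ (extChartAt 𝓘(ℝ, Eucl n) x₀).target) : ContDiffAt ℝ 2 (chartRep x₀ f) y := by
  have hb : ContMDiffAt 𝓘(ℝ, Eucl n) 𝓘(ℝ, Eucl n) 2 (extChartAt 𝓘(ℝ, Eucl n) x₀).symm y :=
    ((contMDiffOn_extChartAt_symm (n := ∞) x₀).contMDiffAt
      ((isOpen_extChartAt_target x₀).mem_nhds hy)).of_le (WithTop.coe_le_coe.2 le_top)
  exact ((hf _).comp y hb).contDiffAt

theorem fderiv_chartRep (hy : y ∈ (extChartAt 𝓘(ℝ, Eucl n) x₀).target)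
    (hf : MDifferentiableAt 𝓘(ℝ, Eucl n) 𝓘(ℝ, ℝ) f ((extChartAt 𝓘(ℝ, Eucl n) x₀).symm y))
    (Z : Eucl n) :
    fderiv ℝ (chartRep x₀ f) y Z = mfderiv 𝓘(ℝ, Eucl n) 𝓘(ℝ, ℝ) f
      ((extChartAt 𝓘(ℝ, Eucl n) x₀).symm y)
      (mfderiv 𝓘(ℝ, Eucl n) 𝓘(ℝ, Eucl n) (extChartAt 𝓘(ℝ, Eucl n) x₀).symm y Z) := by
  have h := mfderiv_comp y hf (mdifferentiableAt_extChartAt_symm hy)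
  rw [mfderiv_eq_fderiv] at h
  exact congrArg (fun A => A Z) h

/-- The squared norm `|Df|²` in a chart is `df(X)` for the gradient `X`, the vector which
represents `df`. -/
theorem exists_gradient (hy : y ∈ (extChartAt 𝓘(ℝ, Eucl n) x₀).target)
    (hp : (extChartAt 𝓘(ℝ, Eucl n) x₀).symm y = p)
    (hf : MDifferentiableAt 𝓘(ℝ, Eucl n) 𝓘(ℝ, ℝ) f p) :
    ∃ X : TangentSpace 𝓘(ℝ, Eucl n) p,
      (∀ Y, σ.inner p X Y = mfderiv 𝓘(ℝ, Eucl n) 𝓘(ℝ, ℝ) f p Y) ∧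
        gradNormSq (chartMetric σ x₀) (chartRep x₀ f) y
          = mfderiv 𝓘(ℝ, Eucl n) 𝓘(ℝ, ℝ) f p X := by
  subst hp
  have hpos := chartMetric_posDef (σ := σ) hy
  have hsum : ∀ Z : Eucl n, fderiv ℝ (chartRep x₀ f) y Z
      = ∑ i, pd i (chartRep x₀ f) y * Z i := by
    intro Z
    conv_lhs => rw [eucl_eq_sum Z]
    simp [pd, mul_comm]
  refine ⟨mfderiv 𝓘(ℝ, Eucl n) 𝓘(ℝ, Eucl n) (extChartAt 𝓘(ℝ, Eucl n) x₀).symm y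
    (WithLp.toLp 2 fun i => gradVec (chartMetric σ x₀) (chartRep x₀ f) i y), fun Y => ?_, ?_⟩
  · obtain ⟨e, he⟩ := isInvertible_mfderiv_extChartAt_symm hy
    obtain ⟨Z, rfl⟩ := e.surjective Y
    have heZ : e Z = mfderiv 𝓘(ℝ, Eucl n) 𝓘(ℝ, Eucl n)
      (extChartAt 𝓘(ℝ, Eucl n) x₀).symm y Z := by rw [← he]; rfl
    rw [heZ]
    refine (chartMetric_bilinear _ _).trans (Eq.trans ?_ ((hsum Z).symm.trans (fderiv_chartRep hy hf Z)))
    rw [Finset.sum_comm]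
    refine Finset.sum_congr rfl fun j _ => ?_
    rw [← sum_metric_gradVec hpos, Finset.sum_mul]
    exact Finset.sum_congr rfl fun i _ => by rw [hpos.apply_comm i j]
  · exact gradNormSq_eq_sum.trans ((hsum (WithLp.toLp 2 fun i => gradVec (chartMetric σ x₀)
      (chartRep x₀ f) i y)).symm.trans (fderiv_chartRep hy hf _))

theorem gradNormSq_chart_indep {x₁ : M} (hf : MDifferentiableAt 𝓘(ℝ, Eucl n) 𝓘(ℝ, ℝ) f p)
    (h₀ : p ∈ (chartAt (Eucl n) x₀).source) (h₁ : p ∈ (chartAt (Eucl n) x₁).source) :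
    gradNormSq (chartMetric σ x₀) (chartRep x₀ f) (extChartAt 𝓘(ℝ, Eucl n) x₀ p)
      = gradNormSq (chartMetric σ x₁) (chartRep x₁ f) (extChartAt 𝓘(ℝ, Eucl n) x₁ p) := by
  obtain ⟨X, hX, eX⟩ := exists_gradient (σ := σ) (extChartAt_mem_target h₀)
    ((extChartAt 𝓘(ℝ, Eucl n) x₀).left_inv (by rwa [extChartAt_source])) hf
  obtain ⟨Y, hY, eY⟩ := exists_gradient (σ := σ) (extChartAt_mem_target h₁)
    ((extChartAt 𝓘(ℝ, Eucl n) x₁).left_inv (by rwa [extChartAt_source])) hf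
  rw [eX, eY, ← hY, ← hX, σ.symm]

theorem graphMeanCurv_eq (hf : ContMDiff 𝓘(ℝ, Eucl n) 𝓘(ℝ, ℝ) 2 f) (h0 : f p ≠ 0)
    (hp : p ∈ (chartAt (Eucl n) x₀).source) :
    graphMeanCurv σ x₀ f p
      = graphOp (chartMetric σ x₀) (chartRep x₀ fun p => Real.log (f p))
          (extChartAt 𝓘(ℝ, Eucl n) x₀ p)
        / (f p * √(1 + gradNormSq (chartMetric σ x₀) (chartRep x₀ fun p => Real.log (f p))
          (extChartAt 𝓘(ℝ, Eucl n) x₀ p))) := by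
  have hy := extChartAt_mem_target hp
  have hm := isMetricOn_chartMetric (σ := σ) (x₀ := x₀)
  have h0' : chartRep x₀ f (extChartAt 𝓘(ℝ, Eucl n) x₀ p) ≠ 0 := by
    rwa [chartRep_extChartAt hp]
  rw [graphMeanCurv, meanCurv_eq_graphOp (hm.posDef _ hy)
    (fun i j => ContDiffOn.differentiableAt_of_isOpen (hm.contDiffOn i j) hm.isOpen hy)
    (contDiffAt_chartRep hf hy) h0',
    slant_eq_log ((contDiffAt_chartRep hf hy).differentiableAt (by norm_num)) h0',
    chartRep_extChartAt hp]
  rfl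

theorem normalSpeed_eq (hf : ContMDiff 𝓘(ℝ, Eucl n) 𝓘(ℝ, ℝ) 2 f) (h0 : f p ≠ 0)
    (hp : p ∈ (chartAt (Eucl n) x₀).source) (a : ℝ) :
    normalSpeed σ x₀ f a p
      = a / √(1 + gradNormSq (chartMetric σ x₀) (chartRep x₀ fun p => Real.log (f p))
          (extChartAt 𝓘(ℝ, Eucl n) x₀ p)) := by
  have hy := extChartAt_mem_target hp
  have h0' : chartRep x₀ f (extChartAt 𝓘(ℝ, Eucl n) x₀ p) ≠ 0 := by
    rwa [chartRep_extChartAt hp]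
  rw [normalSpeed, ip_radial_graphNormal,
    slant_eq_log ((contDiffAt_chartRep hf hy).differentiableAt (by norm_num)) h0']
  rfl

end ChartFunctions

/-! ### Joint continuity -/

section Continuity

variable {n : ℕ} {σ : Eucl n → Matrix (Fin n) (Fin n) ℝ} {J : Set ℝ} {Ω : Set (Eucl n)}
  {f : ℝ → Eucl n → ℝ}

/-- `f` and its spatial derivatives up to second order are continuous in time and space. -/
structure ContTwoOn (f : ℝ → Eucl n → ℝ) (J : Set ℝ) (Ω : Set (Eucl n)) : Prop where
  pd : ∀ i, ContinuousOn (fun q : ℝ × Eucl n => pd i (f q.1) q.2) (J ×ˢ Ω)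
  pd_pd : ∀ i j, ContinuousOn (fun q : ℝ × Eucl n => IMCF.pd i (IMCF.pd j (f q.1)) q.2) (J ×ˢ Ω)

theorem ContTwoOn.log (hf : ContTwoOn f J Ω)
    (h : ContinuousOn (fun q : ℝ × Eucl n => f q.1 q.2) (J ×ˢ Ω))
    (h2 : ∀ t ∈ J, ∀ z ∈ Ω, ContDiffAt ℝ 2 (f t) z) (h0 : ∀ t ∈ J, ∀ z ∈ Ω, f t z ≠ 0) :
    ContTwoOn (fun t z => Real.log (f t z)) J Ω := by
  have hi : ContinuousOn (fun q : ℝ × Eucl n => (f q.1 q.2)⁻¹) (J ×ˢ Ω) :=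
    h.inv₀ fun q hq => h0 _ hq.1 _ hq.2
  refine ⟨fun i => ?_, fun i j => ?_⟩
  · exact (hi.mul (hf.pd i)).congr fun q hq =>
      pd_log ((h2 _ hq.1 _ hq.2).differentiableAt (by norm_num)) (h0 _ hq.1 _ hq.2) i
  · exact ((hi.mul (hf.pd_pd i j)).sub ((hi.pow 2).mul ((hf.pd i).mul (hf.pd j)))).congr
      fun q hq => pd_pd_log (h2 _ hq.1 _ hq.2) (h0 _ hq.1 _ hq.2) i j

theorem continuousOn_comp_snd {g : Eucl n → ℝ} (hg : ContDiffOn ℝ ∞ g Ω) :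
    ContinuousOn (fun q : ℝ × Eucl n => g q.2) (J ×ˢ Ω) :=
  hg.continuousOn.comp continuousOn_snd fun _ hq => hq.2

theorem ContTwoOn.gradNormSq (hσ : IsMetricOn σ Ω) (hf : ContTwoOn f J Ω) :
    ContinuousOn (fun q : ℝ × Eucl n => gradNormSq σ (f q.1) q.2) (J ×ˢ Ω) := by
  unfold IMCF.gradNormSq
  exact continuousOn_finsetSum _ fun i _ => continuousOn_finsetSum _ fun j _ =>
    ((continuousOn_comp_snd (hσ.contDiffOn_inv i j)).mul (hf.pd i)).mul (hf.pd j)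

theorem ContTwoOn.graphOp (hσ : IsMetricOn σ Ω) (hf : ContTwoOn f J Ω) :
    ContinuousOn (fun q : ℝ × Eucl n => graphOp σ (f q.1) q.2) (J ×ˢ Ω) := by
  have hP : ∀ k, ContinuousOn (fun q : ℝ × Eucl n => gradVec σ (f q.1) k q.2) (J ×ˢ Ω) :=
    fun k => continuousOn_finsetSum _ fun l _ =>
      (continuousOn_comp_snd (hσ.contDiffOn_inv k l)).mul (hf.pd l)
  have hh : ∀ i j, ContinuousOn (fun q : ℝ × Eucl n => hessian σ (f q.1) i j q.2) (J ×ˢ Ω) :=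
    fun i j => (hf.pd_pd i j).sub (continuousOn_finsetSum _ fun k _ =>
      (continuousOn_comp_snd (hσ.contDiffOn_christoffel k i j)).mul (hf.pd k))
  unfold IMCF.graphOp laplacian hessGrad
  refine (continuousOn_const.sub (continuousOn_finsetSum _ fun i _ => continuousOn_finsetSum _
    fun j _ => (continuousOn_comp_snd (hσ.contDiffOn_inv i j)).mul (hh i j))).add
    (ContinuousOn.div (continuousOn_finsetSum _ fun i _ => continuousOn_finsetSum _
      fun j _ => ((hh i j).mul (hP i)).mul (hP j))
      (continuousOn_const.add (hf.gradNormSq hσ)) fun q hq => ?_)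
  have := gradNormSq_nonneg (f := f q.1) (hσ.posDef q.2 hq.2)
  positivity

/-- Continuity on `J × M` can be checked in charts. -/
theorem continuousOn_of_charts {M : Type*} [TopologicalSpace M] [ChartedSpace (Eucl n) M]
    {Θ : ℝ → M → ℝ} (g : M → ℝ × Eucl n → ℝ)
    (hg : ∀ x₀, ContinuousOn (g x₀) (J ×ˢ (extChartAt 𝓘(ℝ, Eucl n) x₀).target))
    (h : ∀ x₀, ∀ t ∈ J, ∀ p ∈ (chartAt (Eucl n) x₀).source,
      Θ t p = g x₀ (t, extChartAt 𝓘(ℝ, Eucl n) x₀ p)) :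
    ContinuousOn (fun q : ℝ × M => Θ q.1 q.2) (J ×ˢ Set.univ) := by
  rintro ⟨t, p⟩ ⟨ht, -⟩
  have h1 : ContinuousOn (fun q : ℝ × M => g p (q.1, extChartAt 𝓘(ℝ, Eucl n) p q.2))
      (J ×ˢ (chartAt (Eucl n) p).source) := by
    refine (hg p).comp (continuousOn_fst.prodMk ?_) fun q hq => ⟨hq.1, ?_⟩
    · have := (continuousOn_extChartAt (I := 𝓘(ℝ, Eucl n)) p)
      rw [extChartAt_source] at this
      exact this.comp continuousOn_snd fun q hq => hq.2
    · exact (extChartAt 𝓘(ℝ, Eucl n) p).map_source (by rw [extChartAt_source]; exact hq.2)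
  have h2 : ContinuousOn (fun q : ℝ × M => Θ q.1 q.2) (J ×ˢ (chartAt (Eucl n) p).source) :=
    h1.congr fun q hq => h p q.1 hq.1 q.2 hq.2
  refine (h2 (t, p) ⟨ht, mem_chart_source _ p⟩).mono_of_mem_nhdsWithin ?_
  have h3 : (Set.univ : Set ℝ) ×ˢ (chartAt (Eucl n) p).source ∈ nhds (t, p) :=
    (isOpen_univ.prod (chartAt (Eucl n) p).open_source).mem_nhds ⟨trivial, mem_chart_source _ p⟩
  filter_upwards [mem_nhdsWithin_of_mem_nhds h3, self_mem_nhdsWithin] with q hq hq'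
  exact ⟨hq'.1, hq.2⟩

end Continuity

/-! ### Estimates along the flow -/

section

variable {n : ℕ} {M : Type*} [TopologicalSpace M] [ChartedSpace (Eucl n) M] {x₀ p : M} {T : ℝ}
  {u : ℝ → M → ℝ} {t : ℝ}

/-- `log u` in the chart at `x₀`. -/
def chartLog (x₀ : M) (u : ℝ → M → ℝ) (t : ℝ) : Eucl n → ℝ :=
  chartRep x₀ fun p => Real.log (u t p)

/-- `∂ₜ log u`, as a one-sided derivative at the initial time. -/
def logSpeed (T : ℝ) (u : ℝ → M → ℝ) (t : ℝ) (p : M) : ℝ :=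
  derivWithin (fun s => Real.log (u s p)) (Set.Ico 0 T) t

theorem logSpeed_eq_speed (ht : t ∈ Set.Ioo 0 T) {z : Eucl n} :
    speed (chartLog x₀ u) t z = logSpeed T u t ((extChartAt 𝓘(ℝ, Eucl n) x₀).symm z) :=
  (derivWithin_of_mem_nhds (Ico_mem_nhds ht.1 ht.2)).symm

/-- A spatial maximum on `M` is a local maximum in a chart. -/
theorem isLocalMax_chartRep {f : M → ℝ} (hmax : ∀ p', f p' ≤ f p) {g : Eucl n → ℝ}
    (hg : ∀ z ∈ (extChartAt 𝓘(ℝ, Eucl n) p).target,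
      g z = f ((extChartAt 𝓘(ℝ, Eucl n) p).symm z)) :
    IsLocalMax g (extChartAt 𝓘(ℝ, Eucl n) p p) := by
  filter_upwards [(isOpen_extChartAt_target (I := 𝓘(ℝ, Eucl n)) p).mem_nhds
    (mem_extChartAt_target p)] with z hz
  rw [hg z hz, hg _ (mem_extChartAt_target p), extChartAt_to_inv]
  exact hmax _

end

section Flow

variable {n : ℕ} {M : Type*} [TopologicalSpace M] [ChartedSpace (Eucl n) M]
  [IsManifold 𝓘(ℝ, Eucl n) ∞ M] {σ : Metric n M} {x₀ p : M} {u₀ : M → ℝ} {T : ℝ}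
  {u : ℝ → M → ℝ} {t : ℝ}

/-- The intrinsic quantity `|D log u|²`, computed in the preferred chart at each point. -/
def logGradSq (σ : Metric n M) (u : ℝ → M → ℝ) (t : ℝ) (p : M) : ℝ :=
  gradNormSq (chartMetric σ p) (chartLog p u t) (extChartAt 𝓘(ℝ, Eucl n) p p)

theorem logGradSq_nonneg (p : M) : 0 ≤ logGradSq σ u t p :=
  gradNormSq_nonneg (chartMetric_posDef (mem_extChartAt_target p))

namespace IsGraphIMCF

variable (h : IsGraphIMCF σ u₀ T u)

include h

theorem contTwoOn_chartLog (x₀ : M) :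
    ContTwoOn (chartLog x₀ u) (Set.Ico 0 T) (extChartAt 𝓘(ℝ, Eucl n) x₀).target := by
  have h1 : ContTwoOn (fun t => chartRep x₀ (u t)) (Set.Ico 0 T)
      (extChartAt 𝓘(ℝ, Eucl n) x₀).target := ⟨h.continuousOn_pd x₀, h.continuousOn_pd_pd x₀⟩
  refine h1.log ?_ (fun t ht z hz => contDiffAt_chartRep (h.contMDiff_two t ht) hz)
    fun t ht z _ => (h.pos t ht _).ne'
  refine h.continuousOn.comp (f := fun q : ℝ × Eucl n =>
    (q.1, (extChartAt 𝓘(ℝ, Eucl n) x₀).symm q.2)) ?_ fun q hq => ⟨hq.1, trivial⟩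
  exact continuousOn_fst.prodMk ((continuousOn_extChartAt_symm x₀).comp continuousOn_snd
    fun q hq => hq.2)

theorem contMDiff_log (ht : t ∈ Set.Ico 0 T) :
    ContMDiff 𝓘(ℝ, Eucl n) 𝓘(ℝ, ℝ) 2 fun p => Real.log (u t p) :=
  contMDiff_log_comp (h.contMDiff_two t ht) (h.pos t ht)

theorem logGradSq_eq (ht : t ∈ Set.Ico 0 T) (hp : p ∈ (chartAt (Eucl n) x₀).source) :
    logGradSq σ u t p
      = gradNormSq (chartMetric σ x₀) (chartLog x₀ u t) (extChartAt 𝓘(ℝ, Eucl n) x₀ p) :=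
  gradNormSq_chart_indep ((h.contMDiff_log ht p).mdifferentiableAt (by norm_num))
    (mem_chart_source _ p) hp

theorem continuousOn_logGradSq :
    ContinuousOn (fun q : ℝ × M => logGradSq σ u q.1 q.2) (Set.Ico 0 T ×ˢ Set.univ) :=
  continuousOn_of_charts (fun x₀ q => gradNormSq (chartMetric σ x₀) (chartLog x₀ u q.1) q.2)
    (fun x₀ => (h.contTwoOn_chartLog x₀).gradNormSq isMetricOn_chartMetric)
    fun _ _ ht _ hp => h.logGradSq_eq ht hp

theorem graphMeanCurv_eq (ht : t ∈ Set.Ico 0 T) (hp : p ∈ (chartAt (Eucl n) x₀).source) :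
    graphMeanCurv σ x₀ (u t) p
      = graphOp (chartMetric σ x₀) (chartLog x₀ u t) (extChartAt 𝓘(ℝ, Eucl n) x₀ p)
        / (u t p * √(1 + logGradSq σ u t p)) := by
  rw [h.logGradSq_eq ht hp]
  exact IMCF.graphMeanCurv_eq (h.contMDiff_two t ht) (h.pos t ht p).ne' hp

/-- The mean curvature stays positive, since it is continuous in time and never vanishes. -/
theorem graphOp_pos (h0 : 0 < graphMeanCurv σ x₀ u₀ p) (ht : t ∈ Set.Ico 0 T)
    (hp : p ∈ (chartAt (Eucl n) x₀).source) :
    0 < graphOp (chartMetric σ x₀) (chartLog x₀ u t) (extChartAt 𝓘(ℝ, Eucl n) x₀ p) := by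
  set F : ℝ → ℝ := fun s => graphOp (chartMetric σ x₀) (chartLog x₀ u s)
    (extChartAt 𝓘(ℝ, Eucl n) x₀ p) with hF
  have hden : ∀ s ∈ Set.Ico 0 T, 0 < u s p * √(1 + logGradSq σ u s p) := fun s hs =>
    mul_pos (h.pos s hs p) (Real.sqrt_pos.2 (by linarith [logGradSq_nonneg (σ := σ) (u := u) (t := s) p]))
  have hH : ∀ s ∈ Set.Ico 0 T, graphMeanCurv σ x₀ (u s) p
      = F s / (u s p * √(1 + logGradSq σ u s p)) := fun s hs => h.graphMeanCurv_eq hs hp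
  have hT : (0 : ℝ) ∈ Set.Ico 0 T := ⟨le_rfl, ht.1.trans_lt ht.2⟩
  have hF0 : 0 < F 0 := by
    rw [← h.initial, hH 0 hT] at h0
    exact (div_pos_iff_of_pos_right (hden 0 hT)).1 h0
  have hne : ∀ s ∈ Set.Ico 0 T, F s ≠ 0 := by
    intro s hs h1
    obtain ⟨u', -, hu'⟩ := h.flow s hs p
    exact (hu' x₀ hp).1 (by rw [hH s hs, h1, zero_div])
  have hc : ContinuousOn F (Set.Icc 0 t) := by
    refine ((h.contTwoOn_chartLog x₀).graphOp isMetricOn_chartMetric).comp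
      (f := fun s => (s, extChartAt 𝓘(ℝ, Eucl n) x₀ p)) (by fun_prop) fun s hs => ?_
    exact ⟨⟨hs.1, hs.2.trans_lt ht.2⟩, extChartAt_mem_target hp⟩
  by_contra! hneg
  obtain ⟨s, hs, hs0⟩ := intermediate_value_Icc' ht.1 hc ⟨hneg, hF0.le⟩
  exact hne s ⟨hs.1, hs.2.trans_lt ht.2⟩ hs0

/-- The evolution equation of `log u`. -/
theorem hasDerivWithinAt_log (ht : t ∈ Set.Ico 0 T) (hp : p ∈ (chartAt (Eucl n) x₀).source) :
    HasDerivWithinAt (fun s => Real.log (u s p))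
      ((1 + logGradSq σ u t p) / graphOp (chartMetric σ x₀) (chartLog x₀ u t)
        (extChartAt 𝓘(ℝ, Eucl n) x₀ p)) (Set.Ico 0 T) t := by
  obtain ⟨u', hu', hfl⟩ := h.flow t ht p
  obtain ⟨hH, hs⟩ := hfl x₀ hp
  have hu := h.pos t ht p
  have hq := logGradSq_nonneg (σ := σ) (u := u) (t := t) p
  have hv : 0 < √(1 + logGradSq σ u t p) := Real.sqrt_pos.2 (by linarith)
  have hns : normalSpeed σ x₀ (u t) u' p = u' / √(1 + logGradSq σ u t p) := by
    rw [h.logGradSq_eq ht hp]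
    exact normalSpeed_eq (h.contMDiff_two t ht) hu.ne' hp u'
  rw [hns, h.graphMeanCurv_eq ht hp] at hs
  rw [h.graphMeanCurv_eq ht hp] at hH
  have hF : graphOp (chartMetric σ x₀) (chartLog x₀ u t) (extChartAt 𝓘(ℝ, Eucl n) x₀ p) ≠ 0 := by
    intro h0; exact hH (by rw [h0, zero_div])
  refine (hu'.log hu.ne').congr_deriv ?_
  rw [inv_div, div_eq_iff hv.ne'] at hs
  rw [hs, div_eq_iff hu.ne']
  have := Real.mul_self_sqrt (show 0 ≤ 1 + logGradSq σ u t p by linarith)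
  field_simp
  rw [sq, this]

theorem logSpeed_eq (ht : t ∈ Set.Ico 0 T) (hp : p ∈ (chartAt (Eucl n) x₀).source) :
    logSpeed T u t p = (1 + logGradSq σ u t p) / graphOp (chartMetric σ x₀) (chartLog x₀ u t)
        (extChartAt 𝓘(ℝ, Eucl n) x₀ p) :=
  (h.hasDerivWithinAt_log ht hp).derivWithin
    (uniqueDiffOn_Ico 0 T t ht)

theorem continuousOn_logSpeed (h0 : ∀ x₀ p : M, p ∈ (chartAt (Eucl n) x₀).source →
      0 < graphMeanCurv σ x₀ u₀ p) :
    ContinuousOn (fun q : ℝ × M => logSpeed T u q.1 q.2) (Set.Ico 0 T ×ˢ Set.univ) := by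
  refine continuousOn_of_charts (fun x₀ q =>
    (1 + gradNormSq (chartMetric σ x₀) (chartLog x₀ u q.1) q.2)
      / graphOp (chartMetric σ x₀) (chartLog x₀ u q.1) q.2) (fun x₀ => ?_)
    fun x₀ t ht p hp => by rw [h.logSpeed_eq ht hp, h.logGradSq_eq ht hp]
  have hc := h.contTwoOn_chartLog x₀
  refine (continuousOn_const.add (hc.gradNormSq isMetricOn_chartMetric)).div
    (hc.graphOp isMetricOn_chartMetric) fun q hq => ?_
  have hs := (extChartAt 𝓘(ℝ, Eucl n) x₀).map_target hq.2
  rw [extChartAt_source] at hs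
  have := h.graphOp_pos (h0 x₀ _ hs) hq.1 hs
  rw [(extChartAt 𝓘(ℝ, Eucl n) x₀).right_inv hq.2] at this
  exact this.ne'

theorem smoothOn_chartLog (x₀ : M) :
    SmoothOn (chartLog x₀ u) (Set.Ioo 0 T) (extChartAt 𝓘(ℝ, Eucl n) x₀).target := by
  have h1 : ContMDiffOn 𝓘(ℝ, ℝ × Eucl n) (𝓘(ℝ, ℝ).prod 𝓘(ℝ, Eucl n)) ∞
      (fun q : ℝ × Eucl n => (q.1, (extChartAt 𝓘(ℝ, Eucl n) x₀).symm q.2))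
      (Set.Ioo 0 T ×ˢ (extChartAt 𝓘(ℝ, Eucl n) x₀).target) :=
    (contDiff_fst.contMDiff.contMDiffOn).prodMk
      ((contMDiffOn_extChartAt_symm x₀).comp contDiff_snd.contMDiff.contMDiffOn
        fun q hq => hq.2)
  have h2 := (h.smooth.comp h1 fun q hq => ⟨hq.1, trivial⟩).contDiffOn
  exact h2.log fun q hq => (h.pos q.1 ⟨hq.1.1.le, hq.1.2⟩ _).ne'

theorem isLogFlowOn (h0 : ∀ x₀ p : M, p ∈ (chartAt (Eucl n) x₀).source →
      0 < graphMeanCurv σ x₀ u₀ p) (x₀ : M) :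
    IsLogFlowOn (chartMetric σ x₀) (chartLog x₀ u) (Set.Ioo 0 T)
      (extChartAt 𝓘(ℝ, Eucl n) x₀).target := by
  have hsrc : ∀ z ∈ (extChartAt 𝓘(ℝ, Eucl n) x₀).target,
      (extChartAt 𝓘(ℝ, Eucl n) x₀).symm z ∈ (chartAt (Eucl n) x₀).source := fun z hz => by
    rw [← extChartAt_source 𝓘(ℝ, Eucl n)]
    exact (extChartAt 𝓘(ℝ, Eucl n) x₀).map_target hz
  refine ⟨isOpen_Ioo, isMetricOn_chartMetric, h.smoothOn_chartLog x₀, fun t ht z hz => ?_,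
    fun t ht z hz => ?_⟩
  · have := h.graphOp_pos (h0 x₀ _ (hsrc z hz)) ⟨ht.1.le, ht.2⟩ (hsrc z hz)
    rwa [(extChartAt 𝓘(ℝ, Eucl n) x₀).right_inv hz] at this
  · have ht' : t ∈ Set.Ico 0 T := ⟨ht.1.le, ht.2⟩
    have h1 := (h.hasDerivWithinAt_log ht' (hsrc z hz)).hasDerivAt (Ico_mem_nhds ht.1 ht.2)
    rw [h.logGradSq_eq ht' (hsrc z hz), (extChartAt 𝓘(ℝ, Eucl n) x₀).right_inv hz] at h1
    exact h1.deriv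

end IsGraphIMCF

end Flow

section Bounds

variable {n : ℕ} {M : Type*} [TopologicalSpace M] [ChartedSpace (Eucl n) M]
  [IsManifold 𝓘(ℝ, Eucl n) ∞ M] {σ : Metric n M} {u₀ : M → ℝ} {T : ℝ}
  {u : ℝ → M → ℝ} {t : ℝ}

theorem IsGraphIMCF.continuousOn_log (h : IsGraphIMCF σ u₀ T u) :
    ContinuousOn (fun q : ℝ × M => Real.log (u q.1 q.2) - q.1 / n) (Set.Ico 0 T ×ˢ Set.univ) :=
  (h.continuousOn.log fun q hq => (h.pos q.1 hq.1 q.2).ne').sub (by fun_prop)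

/-- At a spatial critical point `∂ₜ log u = (u v H)⁻¹`, because `v = 1` there. -/
theorem IsGraphIMCF.hasDerivAt_log_of_critical (h : IsGraphIMCF σ u₀ T u) {p : M}
    (ht : t ∈ Set.Ioo 0 T)
    (hcrit : ∀ i, pd i (chartLog p u t) (extChartAt 𝓘(ℝ, Eucl n) p p) = 0) :
    HasDerivAt (fun s => Real.log (u s p) - s / n)
      ((graphOp (chartMetric σ p) (chartLog p u t) (extChartAt 𝓘(ℝ, Eucl n) p p))⁻¹
        - (n : ℝ)⁻¹) t := by
  have hd := (h.hasDerivWithinAt_log ⟨ht.1.le, ht.2⟩ (mem_chart_source (Eucl n) p)).hasDerivAt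
    (Ico_mem_nhds ht.1 ht.2)
  have hq : logGradSq σ u t p = 0 := by
    rw [logGradSq, gradNormSq_eq_sum]
    exact Finset.sum_eq_zero fun i _ => by rw [hcrit, zero_mul]
  rw [hq, add_zero, one_div] at hd
  simpa using hd.fun_sub ((hasDerivAt_id t).div_const (n : ℝ))

variable [CompactSpace M]

/-- The gradient estimate, which uses the sign of the Ricci curvature. -/
theorem IsGraphIMCF.logGradSq_le (h : IsGraphIMCF σ u₀ T u) (hric : RicciPos σ)
    (h0 : ∀ x₀ p : M, p ∈ (chartAt (Eucl n) x₀).source → 0 < graphMeanCurv σ x₀ u₀ p) {K : ℝ}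
    (hK : ∀ p, logGradSq σ u 0 p ≤ K) (ht : t ∈ Set.Ico 0 T) (p : M) :
    logGradSq σ u t p ≤ K := by
  refine le_of_deriv_nonpos_at_max h.continuousOn_logGradSq hK (fun t ht p hmax => ?_) ht p
  have hy := mem_extChartAt_target (I := 𝓘(ℝ, Eucl n)) p
  refine (h.isLogFlowOn h0 p).deriv_gradNormSq_nonpos ht hy
    (isLocalMax_chartRep hmax fun z hz => ?_) fun X => ?_
  · have hs := (extChartAt 𝓘(ℝ, Eucl n) p).map_target hz
    rw [extChartAt_source] at hs
    rw [h.logGradSq_eq ⟨ht.1.le, ht.2⟩ hs, (extChartAt 𝓘(ℝ, Eucl n) p).right_inv hz]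
  · rcases eq_or_ne X 0 with rfl | hX
    · simp
    · exact (hric p _ hy X hX).le

theorem IsGraphIMCF.logSpeed_le (h : IsGraphIMCF σ u₀ T u)
    (h0 : ∀ x₀ p : M, p ∈ (chartAt (Eucl n) x₀).source → 0 < graphMeanCurv σ x₀ u₀ p) {K : ℝ}
    (hK : ∀ p, logSpeed T u 0 p ≤ K) (ht : t ∈ Set.Ico 0 T) (p : M) :
    logSpeed T u t p ≤ K := by
  refine le_of_deriv_nonpos_at_max (h.continuousOn_logSpeed h0) hK (fun t ht p hmax => ?_) ht p
  obtain ⟨c, hc, hd⟩ := (h.isLogFlowOn h0 p).deriv_speed_nonpos ht (mem_extChartAt_target p)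
    (isLocalMax_chartRep hmax fun z hz => logSpeed_eq_speed ht)
  refine ⟨c, hc, hd.congr_of_eventuallyEq ?_⟩
  filter_upwards [Ioo_mem_nhds ht.1 ht.2] with s hs
  rw [logSpeed_eq_speed hs, extChartAt_to_inv]

theorem IsGraphIMCF.le_logSpeed (h : IsGraphIMCF σ u₀ T u)
    (h0 : ∀ x₀ p : M, p ∈ (chartAt (Eucl n) x₀).source → 0 < graphMeanCurv σ x₀ u₀ p) {K : ℝ}
    (hK : ∀ p, K ≤ logSpeed T u 0 p) (ht : t ∈ Set.Ico 0 T) (p : M) :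
    K ≤ logSpeed T u t p := by
  refine neg_le_neg_iff.1 (le_of_deriv_nonpos_at_max (Θ := fun t p => -logSpeed T u t p)
    (h.continuousOn_logSpeed h0).neg (fun p => neg_le_neg (hK p)) (fun t ht p hmax => ?_) ht p)
  have hmax' := isLocalMax_chartRep hmax (g := fun z : Eucl n => -speed (chartLog p u) t z)
    fun z hz => by rw [logSpeed_eq_speed ht]
  obtain ⟨c, hc, hd⟩ := (h.isLogFlowOn h0 p).deriv_speed_nonneg ht (mem_extChartAt_target p)
    (by simpa using hmax'.neg)
  refine ⟨-c, by linarith, hd.fun_neg.congr_of_eventuallyEq ?_⟩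
  filter_upwards [Ioo_mem_nhds ht.1 ht.2] with s hs
  rw [logSpeed_eq_speed hs, extChartAt_to_inv]

/-- The height grows at most like `e^{t/n}`, since `u v H ≥ n` at a spatial maximum. -/
theorem IsGraphIMCF.log_le (h : IsGraphIMCF σ u₀ T u) (hn : 0 < n)
    {K : ℝ} (hK : ∀ p, Real.log (u₀ p) ≤ K) (ht : t ∈ Set.Ico 0 T) (p : M) :
    Real.log (u t p) - t / n ≤ K := by
  have hn' : (0 : ℝ) < n := Nat.cast_pos.2 hn
  refine le_of_deriv_nonpos_at_max (Θ := fun t p => Real.log (u t p) - t / n)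
    h.continuousOn_log (fun p => by simpa [h.initial] using hK p) (fun t ht p hmax => ?_) ht p
  have hmax' : IsLocalMax (chartLog p u t) (extChartAt 𝓘(ℝ, Eucl n) p p) :=
    isLocalMax_chartRep (f := fun p => Real.log (u t p))
      (fun p' => by linarith [hmax p']) fun z _ => rfl
  have hy := mem_extChartAt_target (I := 𝓘(ℝ, Eucl n)) p
  have hF := le_graphOp_of_isLocalMax (chartMetric_posDef (σ := σ) hy)
    (contDiffAt_chartRep (h.contMDiff_log ⟨ht.1.le, ht.2⟩) hy) hmax'
  exact ⟨_, sub_nonpos.2 (inv_anti₀ hn' hF),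
    h.hasDerivAt_log_of_critical ht (pd_eq_zero_of_isLocalExtr hmax'.isExtr)⟩

/-- The height grows at least like `e^{t/n}`, since `u v H ≤ n` at a spatial minimum. -/
theorem IsGraphIMCF.le_log (h : IsGraphIMCF σ u₀ T u)
    (h0 : ∀ x₀ p : M, p ∈ (chartAt (Eucl n) x₀).source → 0 < graphMeanCurv σ x₀ u₀ p)
    {K : ℝ} (hK : ∀ p, K ≤ Real.log (u₀ p)) (ht : t ∈ Set.Ico 0 T) (p : M) :
    K ≤ Real.log (u t p) - t / n := by
  refine neg_le_neg_iff.1 (le_of_deriv_nonpos_at_max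
    (Θ := fun t p => -(Real.log (u t p) - t / n))
    h.continuousOn_log.neg (fun p => by simpa [h.initial] using hK p) (fun t ht p hmax => ?_) ht p)
  have hmin : IsLocalMin (chartLog p u t) (extChartAt 𝓘(ℝ, Eucl n) p p) := by
    have := isLocalMax_chartRep (f := fun p => -Real.log (u t p)) (p := p)
      (fun p' => by linarith [hmax p']) (g := fun z : Eucl n => -chartLog p u t z) fun z _ => rfl
    simpa using this.neg
  have hy := mem_extChartAt_target (I := 𝓘(ℝ, Eucl n)) p
  have hF := graphOp_le_of_isLocalMin (chartMetric_posDef (σ := σ) hy)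
    (contDiffAt_chartRep (h.contMDiff_log ⟨ht.1.le, ht.2⟩) hy) hmin
  have hpos := (h.isLogFlowOn h0 p).graphOp_pos t ht _ hy
  refine ⟨_, ?_, (h.hasDerivAt_log_of_critical ht
    (pd_eq_zero_of_isLocalExtr hmin.isExtr)).fun_neg⟩
  exact neg_nonpos.2 (sub_nonneg.2 (inv_anti₀ hpos hF))

/-- The bounds `K⁻¹ ≤ u₀ ≤ K`, `K⁻¹ ≤ u₀ v₀ H₀ ≤ K` and `|D log u₀|² ≤ K` at the point `p`, in the
chart at `x₀`. -/
structure InitialBound (σ : Metric n M) (u₀ : M → ℝ) (K : ℝ) (x₀ p : M) : Prop where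
  mem_source : p ∈ (chartAt (Eucl n) x₀).source
  le_height : K⁻¹ ≤ u₀ p
  height_le : u₀ p ≤ K
  le_graphOp : K⁻¹ ≤ graphOp (chartMetric σ x₀) (chartRep x₀ fun p => Real.log (u₀ p))
    (extChartAt 𝓘(ℝ, Eucl n) x₀ p)
  graphOp_le : graphOp (chartMetric σ x₀) (chartRep x₀ fun p => Real.log (u₀ p))
    (extChartAt 𝓘(ℝ, Eucl n) x₀ p) ≤ K
  gradNormSq_le : gradNormSq (chartMetric σ x₀) (chartRep x₀ fun p => Real.log (u₀ p))
    (extChartAt 𝓘(ℝ, Eucl n) x₀ p) ≤ K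

/-- The estimate of `H e^{t/n} = v (w u e^{-t/n})⁻¹`, `w = ∂ₜ log u`, in terms of one bound `K` for
the initial data, where the bounds may refer to any chart around the given point. -/
theorem IsGraphIMCF.meanCurv_bounds (h : IsGraphIMCF σ u₀ T u) (hric : RicciPos σ) (hn : 0 < n)
    (h0 : ∀ x₀ p : M, p ∈ (chartAt (Eucl n) x₀).source → 0 < graphMeanCurv σ x₀ u₀ p) {K : ℝ}
    (hK0 : 0 < K)
    (hK : ∀ p, ∃ x₀ : M, InitialBound σ u₀ K x₀ p)
    (ht : t ∈ Set.Ico 0 T) {x₀ p : M} (hp : p ∈ (chartAt (Eucl n) x₀).source) :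
    ((1 + K) * K * K)⁻¹ ≤ graphMeanCurv σ x₀ (u t) p * Real.exp (t / n) ∧
      graphMeanCurv σ x₀ (u t) p * Real.exp (t / n) ≤ √(1 + K) * K * K := by
  have hT : (0 : ℝ) ∈ Set.Ico 0 T := ⟨le_rfl, ht.1.trans_lt ht.2⟩
  have hKi : 0 < K⁻¹ := inv_pos.2 hK0
  have hq0 : ∀ p, logGradSq σ u 0 p ≤ K := fun p => by
    obtain ⟨x, hx, -, -, -, -, hq⟩ := hK p
    rw [h.logGradSq_eq hT hx, chartLog, h.initial]
    exact hq
  have hw0 : ∀ p, K⁻¹ ≤ logSpeed T u 0 p ∧ logSpeed T u 0 p ≤ (1 + K) * K := fun p => by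
    obtain ⟨x, hx, -, -, hF1, hF2, hq⟩ := hK p
    have hq1 := logGradSq_nonneg (σ := σ) (u := u) (t := 0) p
    have hq2 := hq0 p
    rw [h.logSpeed_eq hT hx, chartLog, h.initial]
    have hF := hKi.trans_le hF1
    constructor
    · rw [le_div_iff₀ hF]
      calc _ ≤ K⁻¹ * K := by gcongr
        _ = 1 := inv_mul_cancel₀ hK0.ne'
        _ ≤ _ := by linarith
    · rw [div_le_iff₀ hF]
      calc _ ≤ (1 + K) * K * K⁻¹ := by rw [mul_assoc, mul_inv_cancel₀ hK0.ne']; linarith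
        _ ≤ _ := mul_le_mul_of_nonneg_left hF1 (by positivity)
  have hu1 : u t p ≤ K * Real.exp (t / n) := by
    have := h.log_le hn (K := Real.log K) (fun p => by
      obtain ⟨x, hx, h1, h2, -⟩ := hK p
      exact Real.log_le_log (hKi.trans_le h1) h2) ht p
    rw [← Real.exp_log (h.pos t ht p)]
    conv_rhs => rw [← Real.exp_log hK0]
    rw [← Real.exp_add]
    exact Real.exp_le_exp.2 (by linarith)
  have hu2 : K⁻¹ * Real.exp (t / n) ≤ u t p := by
    have := h.le_log h0 (K := Real.log K⁻¹) (fun p => by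
      obtain ⟨x, hx, h1, h2, -⟩ := hK p
      exact Real.log_le_log hKi h1) ht p
    rw [← Real.exp_log (h.pos t ht p)]
    conv_lhs => rw [← Real.exp_log hKi]
    rw [← Real.exp_add]
    exact Real.exp_le_exp.2 (by linarith)
  have hw1 := h.le_logSpeed h0 (fun p => (hw0 p).1) ht p
  have hw2 := h.logSpeed_le h0 (fun p => (hw0 p).2) ht p
  have hq1 := logGradSq_nonneg (σ := σ) (u := u) (t := t) p
  have hq2 := h.logGradSq_le hric h0 hq0 ht p
  have hw := h.logSpeed_eq ht hp
  have hF := h.graphOp_pos (h0 x₀ p hp) ht hp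
  have hu := h.pos t ht p
  have hv1 : 1 ≤ √(1 + logGradSq σ u t p) := by
    rw [Real.one_le_sqrt]; linarith
  have hv2 : √(1 + logGradSq σ u t p) ≤ √(1 + K) := Real.sqrt_le_sqrt (by linarith)
  have hvv := Real.mul_self_sqrt (show 0 ≤ 1 + logGradSq σ u t p by linarith)
  have hH : graphMeanCurv σ x₀ (u t) p * Real.exp (t / n)
      = √(1 + logGradSq σ u t p) * Real.exp (t / n) / (logSpeed T u t p * u t p) := by
    rw [h.graphMeanCurv_eq ht hp, hw]
    field_simp
    rw [sq, hvv]
  have hwpos : 0 < logSpeed T u t p := hKi.trans_le hw1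
  have hE := Real.exp_pos (t / n)
  rw [hH]
  constructor
  · rw [le_div_iff₀ (mul_pos hwpos hu)]
    calc _ ≤ ((1 + K) * K * K)⁻¹ * ((1 + K) * K * (K * Real.exp (t / n))) := by gcongr
      _ = 1 * Real.exp (t / n) := by field_simp
      _ ≤ _ := by gcongr
  · rw [div_le_iff₀ (mul_pos hwpos hu)]
    calc _ ≤ √(1 + K) * Real.exp (t / n) := by gcongr
      _ = √(1 + K) * K * K * (K⁻¹ * (K⁻¹ * Real.exp (t / n))) := by field_simp
      _ ≤ _ := by gcongr

end Bounds

/-! ### Bounds for the initial graph -/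

section Initial

variable {n : ℕ} {M : Type*} [TopologicalSpace M] [ChartedSpace (Eucl n) M]
  [IsManifold 𝓘(ℝ, Eucl n) ∞ M] {σ : Metric n M} {u₀ : M → ℝ} {x₀ p : M}

theorem InitialBound.mono {K L : ℝ} (h : InitialBound σ u₀ K x₀ p) (hK : 0 < K) (hKL : K ≤ L) :
    InitialBound σ u₀ L x₀ p :=
  have hi : L⁻¹ ≤ K⁻¹ := inv_anti₀ hK hKL
  ⟨h.mem_source, hi.trans h.le_height, h.height_le.trans hKL, hi.trans h.le_graphOp,
    h.graphOp_le.trans hKL, h.gradNormSq_le.trans hKL⟩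

/-- In dimension zero the mean curvature is an empty sum. -/
theorem dim_pos_of_graphMeanCurv_pos {f : M → ℝ} (h : 0 < graphMeanCurv σ x₀ f p) : 0 < n := by
  refine Nat.pos_of_ne_zero fun hn => ?_
  subst hn
  simp [graphMeanCurv, meanCurv] at h

theorem contTwoOn_const {Ω : Set (Eucl n)} {f : Eucl n → ℝ}
    (hf : ∀ z ∈ Ω, ContDiffAt ℝ 2 f z) : ContTwoOn (fun _ => f) Set.univ Ω := by
  have h1 : ∀ z ∈ Ω, ∀ i, ContDiffAt ℝ 1 (pd i f) z := fun z hz i =>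
    ((hf z hz).fderiv_right (m := 1) (by norm_num)).clm_apply contDiffAt_const
  refine ⟨fun i => ?_, fun i j => ?_⟩
  · exact ContinuousOn.comp (g := pd i f) (fun z hz => (h1 z hz i).continuousAt.continuousWithinAt)
      continuousOn_snd fun q hq => hq.2
  · refine ContinuousOn.comp (g := pd i (pd j f)) (fun z hz => ?_)
      continuousOn_snd fun q hq => hq.2
    exact ((((h1 z hz j).fderiv_right (m := 0) (by norm_num)).clm_apply
      contDiffAt_const).continuousAt).continuousWithinAt

theorem graphOp_eq_mul (hu : ContMDiff 𝓘(ℝ, Eucl n) 𝓘(ℝ, ℝ) 2 u₀) (hpos : 0 < u₀ p)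
    (hp : p ∈ (chartAt (Eucl n) x₀).source) :
    graphOp (chartMetric σ x₀) (chartRep x₀ fun p => Real.log (u₀ p))
        (extChartAt 𝓘(ℝ, Eucl n) x₀ p)
      = graphMeanCurv σ x₀ u₀ p * (u₀ p *
        √(1 + gradNormSq (chartMetric σ x₀) (chartRep x₀ fun p => Real.log (u₀ p))
          (extChartAt 𝓘(ℝ, Eucl n) x₀ p))) := by
  have hq := gradNormSq_nonneg (f := chartRep x₀ fun p => Real.log (u₀ p))
    (chartMetric_posDef (σ := σ) (extChartAt_mem_target hp))
  rw [graphMeanCurv_eq hu hpos.ne' hp, div_mul_cancel₀]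
  exact (mul_pos hpos (Real.sqrt_pos.2 (by linarith))).ne'

/-- On a compact manifold the initial bounds hold uniformly. -/
theorem exists_initialBound [CompactSpace M] (hu : ContMDiff 𝓘(ℝ, Eucl n) 𝓘(ℝ, ℝ) 2 u₀)
    (hpos : ∀ p, 0 < u₀ p)
    (hH : ∀ x₀ p : M, p ∈ (chartAt (Eucl n) x₀).source → 0 < graphMeanCurv σ x₀ u₀ p) :
    ∃ K > 0, ∀ p, ∃ x₀ : M, InitialBound σ u₀ K x₀ p := by
  suffices ∃ K > 0, ∀ p ∈ (Set.univ : Set M), ∃ x₀ : M, InitialBound σ u₀ K x₀ p by simpa using this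
  refine isCompact_univ.induction_on (p := fun s => ∃ K > 0, ∀ p ∈ s, ∃ x₀ : M,
    InitialBound σ u₀ K x₀ p) ⟨1, one_pos, by simp⟩ ?_ ?_ fun p₀ _ => ?_
  · rintro s t hst ⟨K, hK, h⟩
    exact ⟨K, hK, fun p hp => h p (hst hp)⟩
  · rintro s t ⟨K, hK, h⟩ ⟨L, hL, h'⟩
    refine ⟨max K L, lt_max_of_lt_left hK, fun p hp => ?_⟩
    rcases hp with hp | hp
    · obtain ⟨x, hx⟩ := h p hp
      exact ⟨x, hx.mono hK (le_max_left _ _)⟩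
    · obtain ⟨x, hx⟩ := h' p hp
      exact ⟨x, hx.mono hL (le_max_right _ _)⟩
  have hlog := contMDiff_log_comp hu hpos
  set f : Eucl n → ℝ := chartRep p₀ fun p => Real.log (u₀ p) with hf
  have hc : ContTwoOn (fun _ => f) Set.univ (extChartAt 𝓘(ℝ, Eucl n) p₀).target :=
    contTwoOn_const fun z hz => contDiffAt_chartRep hlog hz
  have hy := mem_extChartAt_target (I := 𝓘(ℝ, Eucl n)) p₀
  have hmem : (Set.univ : Set ℝ) ×ˢ (extChartAt 𝓘(ℝ, Eucl n) p₀).target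
      ∈ nhds ((0 : ℝ), extChartAt 𝓘(ℝ, Eucl n) p₀ p₀) :=
    (isOpen_univ.prod (isOpen_extChartAt_target p₀)).mem_nhds ⟨trivial, hy⟩
  have hprod : ContinuousAt (fun p : M => ((0 : ℝ), extChartAt 𝓘(ℝ, Eucl n) p₀ p)) p₀ :=
    continuousAt_const.prodMk (continuousAt_extChartAt p₀)
  have cF : ContinuousAt (fun p => graphOp (chartMetric σ p₀) f (extChartAt 𝓘(ℝ, Eucl n) p₀ p))
      p₀ := ContinuousAt.comp (f := fun p : M => ((0 : ℝ), extChartAt 𝓘(ℝ, Eucl n) p₀ p))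
        ((hc.graphOp isMetricOn_chartMetric).continuousAt hmem) hprod
  have cq : ContinuousAt
      (fun p => gradNormSq (chartMetric σ p₀) f (extChartAt 𝓘(ℝ, Eucl n) p₀ p)) p₀ :=
    ContinuousAt.comp (f := fun p : M => ((0 : ℝ), extChartAt 𝓘(ℝ, Eucl n) p₀ p))
      ((hc.gradNormSq isMetricOn_chartMetric).continuousAt hmem) hprod
  have cu : ContinuousAt u₀ p₀ := hu.continuous.continuousAt
  have hq := gradNormSq_nonneg (f := f) (chartMetric_posDef (σ := σ) hy)
  have hF : 0 < graphOp (chartMetric σ p₀) f (extChartAt 𝓘(ℝ, Eucl n) p₀ p₀) := by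
    rw [hf, graphOp_eq_mul hu (hpos p₀) (mem_chart_source _ p₀)]
    exact mul_pos (hH _ _ (mem_chart_source _ p₀))
      (mul_pos (hpos p₀) (Real.sqrt_pos.2 (by linarith)))
  have hu0 := hpos p₀
  set a := u₀ p₀ with ha
  set b := graphOp (chartMetric σ p₀) f (extChartAt 𝓘(ℝ, Eucl n) p₀ p₀) with hb
  set c := gradNormSq (chartMetric σ p₀) f (extChartAt 𝓘(ℝ, Eucl n) p₀ p₀) with hcdef
  have hai : 0 < a⁻¹ := inv_pos.2 hu0
  have hbi : 0 < b⁻¹ := inv_pos.2 hF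
  set K := 1 + a + a⁻¹ + b + b⁻¹ + c with hK
  have hK0 : 0 < K := by positivity
  have e1 : K⁻¹ < a := inv_lt_of_inv_lt₀ hu0 (by linarith)
  have e2 : K⁻¹ < b := inv_lt_of_inv_lt₀ hF (by linarith)
  refine ⟨{p | ∃ x₀ : M, InitialBound σ u₀ K x₀ p}, mem_nhdsWithin_of_mem_nhds ?_, K, hK0,
    fun p hp => hp⟩
  filter_upwards [(chartAt (Eucl n) p₀).open_source.mem_nhds (mem_chart_source _ p₀),
    cu.eventually (lt_mem_nhds e1), cu.eventually (gt_mem_nhds (show a < K by linarith)),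
    cF.eventually (lt_mem_nhds e2), cF.eventually (gt_mem_nhds (show b < K by linarith)),
    cq.eventually (gt_mem_nhds (show c < K by linarith))] with p h1 h2 h3 h4 h5 h6
  exact ⟨p₀, h1, h2.le, h3.le, h4.le, h5.le, h6.le⟩

/-- Upper bound for `u v H` in terms of the derivatives of `u = f`. -/
theorem graphOp_log_le {σ : Eucl n → Matrix (Fin n) (Fin n) ℝ} {f : Eucl n → ℝ} {y : Eucl n}
    (h : (σ y).PosDef) (hf : ContDiffAt ℝ 2 f y) {δ Λ : ℝ} (hδ : 0 < δ) (hδf : δ ≤ f y)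
    (h1 : √(gradNormSq σ f y) ≤ Λ) (h2 : √(hessNormSq σ f y) ≤ Λ) :
    graphOp σ (fun z => Real.log (f z)) y
      ≤ n + δ⁻¹ * (√n * Λ) + δ⁻¹ ^ 2 * Λ ^ 2 + δ⁻¹ ^ 3 * (Λ * Λ ^ 2) := by
  have hf0 : 0 < f y := hδ.trans_le hδf
  have hi : (f y)⁻¹ ≤ δ⁻¹ := inv_anti₀ hδ hδf
  have hi0 : 0 < (f y)⁻¹ := inv_pos.2 hf0
  have hΛ : 0 ≤ Λ := (Real.sqrt_nonneg _).trans h1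
  have hq := gradNormSq_nonneg (f := f) h
  have hq2 : gradNormSq σ f y ≤ Λ ^ 2 := (Real.sqrt_le_left hΛ).1 h1
  have hl := abs_laplacian_le (f := f) h
  have hg := abs_hessGrad_le (f := f) h
  have hl' : -laplacian σ f y ≤ √n * Λ :=
    ((neg_le_abs _).trans hl).trans (by gcongr)
  have hg' : hessGrad σ f y ≤ Λ * Λ ^ 2 :=
    ((le_abs_self _).trans hg).trans (by gcongr)
  have hq' := gradNormSq_nonneg (f := fun z => Real.log (f z)) h
  have b1 : -laplacian σ (fun z => Real.log (f z)) y ≤ δ⁻¹ * (√n * Λ) + δ⁻¹ ^ 2 * Λ ^ 2 := by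
    rw [laplacian_log hf hf0.ne']
    calc _ = (f y)⁻¹ * -laplacian σ f y + (f y)⁻¹ ^ 2 * gradNormSq σ f y := by ring
      _ ≤ (f y)⁻¹ * (√n * Λ) + (f y)⁻¹ ^ 2 * Λ ^ 2 := by gcongr
      _ ≤ _ := by gcongr
  have b2 : hessGrad σ (fun z => Real.log (f z)) y ≤ δ⁻¹ ^ 3 * (Λ * Λ ^ 2) := by
    rw [hessGrad_log hf hf0.ne']
    calc _ ≤ (f y)⁻¹ ^ 3 * hessGrad σ f y := by
          linarith [mul_nonneg (pow_nonneg hi0.le 4) (sq_nonneg (gradNormSq σ f y))]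
      _ ≤ (f y)⁻¹ ^ 3 * (Λ * Λ ^ 2) := by gcongr
      _ ≤ _ := by gcongr
  have b3 : hessGrad σ (fun z => Real.log (f z)) y
      / (1 + gradNormSq σ (fun z => Real.log (f z)) y) ≤ δ⁻¹ ^ 3 * (Λ * Λ ^ 2) := by
    rw [div_le_iff₀ (by linarith)]
    refine b2.trans (le_mul_of_one_le_right (by positivity) (by linarith))
  rw [graphOp]
  linarith

/-- The initial bounds in terms of bounds for `u₀`, `Du₀`, `D²u₀` and `H₀`. -/
theorem initialBound_of_le (hu : ContMDiff 𝓘(ℝ, Eucl n) 𝓘(ℝ, ℝ) 2 u₀) {δ Λ K : ℝ} (hδ : 0 < δ)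
    (hp : p ∈ (chartAt (Eucl n) x₀).source) (hu1 : δ ≤ u₀ p) (hu2 : u₀ p ≤ Λ)
    (h1 : gradNorm σ x₀ u₀ p ≤ Λ) (h2 : hessNorm σ x₀ u₀ p ≤ Λ)
    (hH : δ ≤ graphMeanCurv σ x₀ u₀ p) (k1 : δ⁻¹ ≤ K) (k2 : Λ ≤ K) (k3 : (δ * δ)⁻¹ ≤ K)
    (k4 : n + δ⁻¹ * (√n * Λ) + δ⁻¹ ^ 2 * Λ ^ 2 + δ⁻¹ ^ 3 * (Λ * Λ ^ 2) ≤ K)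
    (k5 : δ⁻¹ ^ 2 * Λ ^ 2 ≤ K) : InitialBound σ u₀ K x₀ p := by
  have hy := extChartAt_mem_target hp
  have hm := chartMetric_posDef (σ := σ) hy
  have hu0 : 0 < u₀ p := hδ.trans_le hu1
  have hrep := chartRep_extChartAt (f := u₀) hp
  have hq := gradNormSq_nonneg (f := chartRep x₀ fun p => Real.log (u₀ p)) hm
  have hc2 := contDiffAt_chartRep hu hy
  refine ⟨hp, ?_, hu2.trans k2, ?_, ?_, ?_⟩
  · exact (inv_le_of_inv_le₀ hδ k1).trans hu1
  · rw [graphOp_eq_mul hu hu0 hp]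
    refine (inv_le_of_inv_le₀ (mul_pos hδ hδ) k3).trans ?_
    have hv : 1 ≤ √(1 + gradNormSq (chartMetric σ x₀) (chartRep x₀ fun p => Real.log (u₀ p))
          (extChartAt 𝓘(ℝ, Eucl n) x₀ p)) := by
      rw [Real.one_le_sqrt]; linarith
    exact mul_le_mul hH (hu1.trans (le_mul_of_one_le_right hu0.le hv)) hδ.le (hδ.le.trans hH)
  · exact (graphOp_log_le hm hc2 hδ (by rwa [hrep]) h1 h2).trans k4
  · refine le_trans ?_ k5
    have e := gradNormSq_log (σ := chartMetric σ x₀) (hc2.differentiableAt (by norm_num))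
      (by rw [hrep]; exact hu0.ne')
    have hΛ : 0 ≤ Λ := hδ.le.trans (hu1.trans hu2)
    have hq2 : gradNormSq (chartMetric σ x₀) (chartRep x₀ u₀) (extChartAt 𝓘(ℝ, Eucl n) x₀ p)
      ≤ Λ ^ 2 := (Real.sqrt_le_left hΛ).1 h1
    have hq0 := gradNormSq_nonneg (f := chartRep x₀ u₀) hm
    refine e.trans_le ?_
    rw [hrep]
    gcongr

end Initial

end IMCF

end

theorem mainTheorem3 (n : ℕ) :
    -- for every initial datum there are constants, independent of the solution and of `T`
    (∀ (M : Type*) [TopologicalSpace M] [ChartedSpace (IMCF.Eucl n) M]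
        [IsManifold 𝓘(ℝ, IMCF.Eucl n) ∞ M] [T2Space M] [CompactSpace M]
        (σ : IMCF.Metric n M), IMCF.RicciPos σ →
      ∀ u₀ : M → ℝ, ContMDiff 𝓘(ℝ, IMCF.Eucl n) 𝓘(ℝ, ℝ) 2 u₀ →
        (∀ p, 0 < u₀ p) →
        (∀ x₀ p : M, p ∈ (chartAt (IMCF.Eucl n) x₀).source → 0 < IMCF.graphMeanCurv σ x₀ u₀ p) →
      ∃ c C : ℝ, 0 < c ∧ 0 < C ∧
        ∀ (T : ℝ) (u : ℝ → M → ℝ), IMCF.IsGraphIMCF σ u₀ T u →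
          ∀ t ∈ Set.Ico 0 T, ∀ x₀ p : M, p ∈ (chartAt (IMCF.Eucl n) x₀).source →
            c ≤ IMCF.graphMeanCurv σ x₀ (u t) p * Real.exp (t / n) ∧
              IMCF.graphMeanCurv σ x₀ (u t) p * Real.exp (t / n) ≤ C) ∧
    -- and these constants depend only on `n` and on bounds for `u₀`, `Du₀`, `D²u₀`
    (∀ δ Λ : ℝ, 0 < δ →
      ∃ c C : ℝ, 0 < c ∧ 0 < C ∧
        ∀ (M : Type*) [TopologicalSpace M] [ChartedSpace (IMCF.Eucl n) M]
          [IsManifold 𝓘(ℝ, IMCF.Eucl n) ∞ M] [T2Space M] [CompactSpace M]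
          (σ : IMCF.Metric n M), IMCF.RicciPos σ →
        ∀ u₀ : M → ℝ, ContMDiff 𝓘(ℝ, IMCF.Eucl n) 𝓘(ℝ, ℝ) 2 u₀ →
          (∀ p, δ ≤ u₀ p ∧ u₀ p ≤ Λ) →
          (∀ x₀ p : M, p ∈ (chartAt (IMCF.Eucl n) x₀).source →
            IMCF.gradNorm σ x₀ u₀ p ≤ Λ ∧ IMCF.hessNorm σ x₀ u₀ p ≤ Λ ∧
              δ ≤ IMCF.graphMeanCurv σ x₀ u₀ p) →
        ∀ (T : ℝ) (u : ℝ → M → ℝ), IMCF.IsGraphIMCF σ u₀ T u →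
          ∀ t ∈ Set.Ico 0 T, ∀ x₀ p : M, p ∈ (chartAt (IMCF.Eucl n) x₀).source →
            c ≤ IMCF.graphMeanCurv σ x₀ (u t) p * Real.exp (t / n) ∧
              IMCF.graphMeanCurv σ x₀ (u t) p * Real.exp (t / n) ≤ C) := by
  refine ⟨fun M _ _ _ _ _ σ hric u₀ hu hpos hH => ?_, fun δ Λ hδ => ?_⟩
  · obtain ⟨K, hK0, hK⟩ := IMCF.exists_initialBound hu hpos hH
    refine ⟨((1 + K) * K * K)⁻¹, √(1 + K) * K * K, by positivity, by positivity,
      fun T u h t ht x₀ p hp => ?_⟩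
    exact h.meanCurv_bounds hric (IMCF.dim_pos_of_graphMeanCurv_pos (hH x₀ p hp)) hH hK0 hK ht hp
  · set G : ℝ := n + δ⁻¹ * (√n * Λ) + δ⁻¹ ^ 2 * Λ ^ 2 + δ⁻¹ ^ 3 * (Λ * Λ ^ 2) with hG
    -- absolute values, since for empty `M` nothing is known about the sign of `Λ`
    set K : ℝ := δ⁻¹ + |Λ| + (δ * δ)⁻¹ + |G| + δ⁻¹ ^ 2 * Λ ^ 2 with hKdef
    have hδi : 0 < δ⁻¹ := inv_pos.2 hδ
    have hδδ : 0 < (δ * δ)⁻¹ := by positivity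
    have h5 : 0 ≤ δ⁻¹ ^ 2 * Λ ^ 2 := by positivity
    have hΛ := le_abs_self Λ
    have hG' := le_abs_self G
    have hΛ0 := abs_nonneg Λ
    have hG0 := abs_nonneg G
    have hK0 : 0 < K := by positivity
    refine ⟨((1 + K) * K * K)⁻¹, √(1 + K) * K * K, by positivity, by positivity,
      fun M _ _ _ _ _ σ hric u₀ hu hb hb' T u h t ht x₀ p hp => ?_⟩
    have hH : ∀ x₀ p : M, p ∈ (chartAt (IMCF.Eucl n) x₀).source →
        0 < IMCF.graphMeanCurv σ x₀ u₀ p := fun x₀ p hp => hδ.trans_le (hb' x₀ p hp).2.2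
    refine h.meanCurv_bounds hric (IMCF.dim_pos_of_graphMeanCurv_pos (hH x₀ p hp)) hH hK0
      (fun p => ⟨p, ?_⟩) ht hp
    have hs := mem_chart_source (IMCF.Eucl n) p
    obtain ⟨b1, b2, b3⟩ := hb' p p hs
    exact IMCF.initialBound_of_le hu hδ hs (hb p).1 (hb p).2 b1 b2 b3 (by linarith) (by linarith)
      (by linarith) (by linarith) (by linarith)
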